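/- Let $n\ge 1$ and let $S$ be the finite set of isomorphism classes of trees with $n$ vertices. **Tree shifts.** Let $G$ be a connected graph with a leaf (vertex of degree one) $l$, let $c$ be the nearest vertex to $l$ of degree greater than $2$, and let $c,c_1,\dots,c_k,l$ be the path from $c$ to $l$. Let $F$ be a nonempty set of vertices of $G-\{c,c_1,\dots,c_k,l\}$ such that the subgraph induced on $F\cup\{c\}$ is a tree, no vertex outside $F\cup\{c\}$ is adjacent to a vertex of $F$, and $G-(F\cup\{c,c_1,\dots,c_k,l\})\neq\emptyset$. A tree shift of $G$ is the graph obtained by replacing every edge $(v,c)$ with $v\in F$ by the edge $(v,l)$. For $T',T\in S$ write $T'\le T$ if $T'$ can be obtained from $T$ by a (possibly empty) sequence of tree shifts. **$\gamma$-polynomials.** For a graph $G$ with vertex set $V$, let $\mathcal B(G)$ be the set of nonempty subsets of $V$ that induce a connected subgraph, and let $P_{\mathcal B(G)}=\sum_{I\in\mathcal B(G)}\mathrm{ConvexHull}(e_i\mid i\in I)\subset\mathbb R^{V}$ (Minkowski sum). For a polytope $P$ of dimension $d$ with $f_i$ faces of dimension $i$, put $f(P)(t)=\sum_{i=0}^d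 f_it^i$ and define $h(P)(t)=\sum_{i=0}^d h_it^i$ by $h(P)(t+1)=f(P)(t)$. The $\gamma$-polynomial $\gamma(P)(t)=\sum_{i=0}^{\lfloor d/2\rfloor}\gamma_it^i$ with integer coefficients is defined by $h(P)(t)=\sum_{i=0}^{\lfloor d/2\rfloor}\gamma_it^i(1+t)^{d-2i}$, and is unique if it exists. Write $\gamma(\mathcal B(G))=\gamma(P_{\mathcal B(G)})$, and $\gamma\le\gamma'$ for the coefficientwise inequality. **Theorem.** The relation $\le$ is a partial order on $S$ with the following properties. * The path $\mathrm{Path}_n$ is the minimum of $S$ and its unique minimal element. * The star $K_{1,n-1}$ is the maximum of $S$ and its unique maximal element. * The polynomial $\gamma(\mathcal B(T))$ exists for every tree $T$ with $n$ vertices, and $T'\le T$ implies $\gamma(\mathcal B(T'))\le\gamma(\mathcal B(T))$. -/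

import Mathlib

namespace GraphAssoc

/-! ### Building sets and nestohedra -/

/-- A building set on a finite set `S`: a set of nonempty subsets of `S` that contains the
singletons and contains `I ∪ J` whenever it contains `I` and `J` and `I ∩ J ≠ ∅`. -/
structure BuildingSet (S : Type*) [DecidableEq S] where
  sets : Finset (Finset S)
  nonempty_of_mem : ∀ I ∈ sets, I.Nonempty
  union_mem : ∀ I ∈ sets, ∀ J ∈ sets, (I ∩ J).Nonempty → I ∪ J ∈ sets
  singleton_mem : ∀ i : S, {i} ∈ sets

open Classical in
/-- The graphical building set `B(G)`: the sets of vertices of `G` whose induced subgraph is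
connected (`SimpleGraph.Connected` includes nonemptiness). -/
noncomputable def graphical {V : Type*} [Fintype V] [DecidableEq V] (G : SimpleGraph V) :
    BuildingSet V where
  sets := Finset.univ.filter fun I : Finset V => (G.induce (I : Set V)).Connected
  nonempty_of_mem I hI := by
    have h := (Finset.mem_filter.1 hI).2.nonempty
    exact Finset.coe_nonempty.1 (Set.nonempty_coe_sort.1 h)
  union_mem I hI J hJ hIJ := by
    have hI := (Finset.mem_filter.1 hI).2
    have hJ := (Finset.mem_filter.1 hJ).2
    refine Finset.mem_filter.2 ⟨Finset.mem_univ _, ?_⟩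
    rw [Finset.coe_union]
    exact SimpleGraph.induce_union_connected hI.preconnected hJ.preconnected
      (by rw [← Finset.coe_inter]; exact Finset.coe_nonempty.2 hIJ)
  singleton_mem i := by
    refine Finset.mem_filter.2 ⟨Finset.mem_univ _, ?_⟩
    rw [Finset.coe_singleton]
    exact SimpleGraph.Connected.of_subsingleton

/-- The simplex `Δ_I`, the convex hull of the coordinate vectors `e_i`, `i ∈ I`. -/
def simplex {S : Type*} [DecidableEq S] (I : Finset S) : Set (S → ℝ) :=
  convexHull ℝ ((fun i : S => (Pi.single i 1 : S → ℝ)) '' (I : Set S))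

open scoped Pointwise in
/-- The nestohedron `P_B`, the Minkowski sum of the simplices `Δ_I` for `I ∈ B`. -/
def nestohedron {S : Type*} [DecidableEq S] (B : BuildingSet S) : Set (S → ℝ) :=
  ∑ I ∈ B.sets, simplex I

/-! ### Face polynomials of a polytope -/

section Polytope

variable {E : Type*} [AddCommGroup E] [Module ℝ E] [TopologicalSpace E]

/-- The dimension of a convex set, that is, of its affine span. -/
noncomputable def dim (P : Set E) : ℕ := Module.finrank ℝ (vectorSpan ℝ P)

/-- The nonempty faces of a polytope `P`: the sets of points of `P` at which some linear functional
attains its maximum over `P` (the zero functional gives `P` itself). -/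
def faces (P : Set E) : Set (Set E) := {F | F.Nonempty ∧ IsExposed ℝ P F}

open Polynomial in
/-- The `f`-polynomial `f_0 + f_1 t + ⋯ + f_d t ^ d`, with `f_i` the number of `i`-dimensional
faces. -/
noncomputable def fPolynomial (P : Set E) : ℤ[X] :=
  ∑ i ∈ Finset.range (dim P + 1), C ({F ∈ faces P | dim F = i}.ncard : ℤ) * X ^ i

open Polynomial in
/-- The `h`-polynomial, defined by `h(t + 1) = f(t)`. -/
noncomputable def hPolynomial (P : Set E) : ℤ[X] := (fPolynomial P).comp (X - 1)

open Polynomial in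
/-- `g = γ_0 + γ_1 t + ⋯ + γ_⌊d/2⌋ t ^ ⌊d/2⌋` is a `γ`-polynomial of the `d`-dimensional
polytope `P`: one has `h(t) = ∑ γ_i t ^ i (1 + t) ^ (d - 2 i)`. -/
def IsGammaPolynomial (P : Set E) (g : ℤ[X]) : Prop :=
  g.natDegree ≤ dim P / 2 ∧
    hPolynomial P =
      ∑ i ∈ Finset.range (dim P / 2 + 1), C (g.coeff i) * X ^ i * (1 + X) ^ (dim P - 2 * i)

open Polynomial in
theorem IsGammaPolynomial.unique {P : Set E} {g g' : ℤ[X]} (hg : IsGammaPolynomial P g)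
    (hg' : IsGammaPolynomial P g') : g = g' := by
  have key : ∑ i ∈ Finset.range (dim P / 2 + 1),
      C ((g - g').coeff i) * X ^ i * (1 + X) ^ (dim P - 2 * i) = 0 := by
    have h := hg.2.symm.trans hg'.2
    rw [← sub_eq_zero, ← Finset.sum_sub_distrib] at h
    rw [← h]
    refine Finset.sum_congr rfl fun i _ => ?_
    rw [coeff_sub, C_sub]
    ring
  rw [← sub_eq_zero]
  ext k
  rw [coeff_zero]
  induction k using Nat.strong_induction_on with
  | _ k ih =>
    by_cases hk : k < dim P / 2 + 1
    · have h := congrArg (fun p : ℤ[X] => p.coeff k) key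
      simp only [finsetSum_coeff, coeff_zero] at h
      rw [Finset.sum_eq_single k] at h
      · have hc : ((1 + X : ℤ[X]) ^ (dim P - 2 * k)).coeff 0 = 1 := by
          simp [coeff_zero_eq_eval_zero]
        rw [mul_assoc, coeff_C_mul, coeff_X_pow_mul', if_pos le_rfl, Nat.sub_self, hc,
          mul_one] at h
        exact h
      · intro j _ hjk
        rcases lt_or_gt_of_ne hjk with hlt | hgt
        · rw [ih j hlt]; simp
        · rw [mul_assoc, coeff_C_mul, coeff_X_pow_mul', if_neg (not_le.2 hgt), mul_zero]
      · intro hk'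
        exact absurd (Finset.mem_range.2 hk) hk'
    · rw [coeff_sub, coeff_eq_zero_of_natDegree_lt, coeff_eq_zero_of_natDegree_lt, sub_zero]
      · have := hg'.1; omega
      · have := hg.1; omega

open Classical Polynomial in
/-- The `γ`-polynomial of a polytope `P` (the zero polynomial if none exists; there is at most one
by `IsGammaPolynomial.unique`). -/
noncomputable def gammaPolynomial (P : Set E) : ℤ[X] :=
  if h : ∃ g : ℤ[X], IsGammaPolynomial P g then h.choose else 0

end Polytope

/-- `γ(B)`, the `γ`-polynomial of the nestohedron `P_B`. -/
noncomputable def gamma {S : Type*} [DecidableEq S] (B : BuildingSet S) :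
    Polynomial ℤ :=
  gammaPolynomial (nestohedron B)

/-! ### Tree shifts -/

/-- The graph obtained from `G` by removing every edge `(v, c)` with `v ∈ F` and replacing it with
the edge `(v, l)`. -/
def reattach {V : Type*} (G : SimpleGraph V) (c l : V) (F : Set V) : SimpleGraph V :=
  G.deleteEdges {e | ∃ v ∈ F, G.Adj v c ∧ e = s(v, c)} ⊔
    SimpleGraph.fromEdgeSet {e | ∃ v ∈ F, G.Adj v c ∧ e = s(v, l)}

/-- `G'` arises from the connected graph `G` by a tree shift. Here `l` is a leaf of `G`, `c` is the
nearest vertex to `l` of degree greater than two, `p` is the path `c, c₁, …, c_k, l`, and `F` is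
a nonempty set of vertices off this path such that `F ∪ {c}` induces a tree and no vertex outside
`F ∪ {c}` is adjacent to a vertex of `F`; the set of the vertices that are neither in `F` nor on
the path is not empty. The move removes `F` from `c` and reattaches it to `l`. -/
def IsTreeShift {V : Type*} (G G' : SimpleGraph V) : Prop :=
  G.Connected ∧
    ∃ (c l : V) (p : G.Walk c l) (F : Set V),
      (G.neighborSet l).ncard = 1 ∧
      2 < (G.neighborSet c).ncard ∧
      (∀ v, 2 < (G.neighborSet v).ncard → G.dist l c ≤ G.dist l v) ∧
      p.IsPath ∧
      F.Nonempty ∧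
      (∀ v ∈ F, v ∉ p.support) ∧
      (G.induce (insert c F)).IsTree ∧
      (∀ u, u ∉ insert c F → ∀ v ∈ F, ¬ G.Adj u v) ∧
      (∃ e, e ∉ F ∧ e ∉ p.support) ∧
      G' = reattach G c l F

/-! ### Isomorphism classes of trees -/

/-- The (labelled) trees on the vertex set `Fin n`. -/
abbrev LabelledTree (n : ℕ) : Type := {T : SimpleGraph (Fin n) // T.IsTree}

/-- Isomorphism of trees. -/
instance isoSetoid (n : ℕ) : Setoid (LabelledTree n) where
  r T T' := Nonempty (T.1 ≃g T'.1)
  iseqv := ⟨fun _ => ⟨SimpleGraph.Iso.refl⟩, fun ⟨e⟩ => ⟨e.symm⟩, fun ⟨e⟩ ⟨e'⟩ => ⟨e.trans e'⟩⟩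

/-- The set of (unlabelled) trees with `n` vertices, that is, of isomorphism classes of trees. -/
abbrev Tree (n : ℕ) : Type := Quotient (isoSetoid n)

/-- One tree shift on unlabelled trees: `shift T T'` means that `T'` arises from `T`. -/
def shift {n : ℕ} (T T' : Tree n) : Prop :=
  ∃ G G' : LabelledTree n, ⟦G⟧ = T ∧ ⟦G'⟧ = T' ∧ IsTreeShift G.1 G'.1

/-- `T' ≤ T`: the tree `T'` can be obtained by applying any number (possibly zero) of tree shifts
to `T`. -/
def treeLE {n : ℕ} (T' T : Tree n) : Prop := Relation.ReflTransGen shift T T'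

theorem isTree_pathGraph (n : ℕ) [NeZero n] : (SimpleGraph.pathGraph n).IsTree := by
  obtain ⟨m, rfl⟩ := Nat.exists_eq_succ_of_ne_zero (NeZero.ne n)
  rw [SimpleGraph.isTree_iff_connected_and_card]
  refine ⟨SimpleGraph.pathGraph_connected m, ?_⟩
  have hset : (SimpleGraph.pathGraph (m + 1)).edgeSet =
      Set.range fun i : Fin m => s(i.castSucc, i.succ) := by
    ext e
    induction e with
    | _ u v =>
      simp only [SimpleGraph.mem_edgeSet, SimpleGraph.pathGraph_adj, Set.mem_range,
        Sym2.eq_iff, Fin.ext_iff, Fin.val_castSucc, Fin.val_succ]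
      constructor
      · rintro (h | h)
        · exact ⟨⟨u, by omega⟩, Or.inl ⟨rfl, h⟩⟩
        · exact ⟨⟨v, by omega⟩, Or.inr ⟨rfl, h⟩⟩
      · rintro ⟨i, h | h⟩ <;> omega
  have hinj : Function.Injective fun i : Fin m => s(i.castSucc, i.succ) := by
    intro i j hij
    simp only [Sym2.eq_iff, Fin.ext_iff, Fin.val_castSucc, Fin.val_succ] at hij
    ext
    omega
  rw [hset, Nat.card_range_of_injective hinj]
  simp

/-- `Path_n`, the path with `n` vertices. -/
def pathTree (n : ℕ) [NeZero n] : Tree n := ⟦⟨SimpleGraph.pathGraph n, isTree_pathGraph n⟩⟧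

/-- `K_{1,n-1}`, the star with `n` vertices. -/
def starTree (n : ℕ) [NeZero n] : Tree n :=
  ⟦⟨SimpleGraph.starGraph (0 : Fin n), SimpleGraph.isTree_starGraph 0⟩⟧

end GraphAssoc

namespace GraphAssoc

open Polynomial

/-! ### A family of Meixner polynomials -/

/-! Write `s` for the variable of the coefficient ring, `M_k` for `meixner k`, `Λ` for
`bottomCoeff`, `J` for `edgeOp`, `S` for `shiftHom`, and `f(0)` for `evalZero f`, the value at `m =
0`.

The h-polynomial of the graph associahedron of a tree is computed by a transfer calculus along a
rooted decomposition. A rooted tree gets a polynomial `f`: a single vertex has `f = 1`, and grafting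
a tree with polynomial `g` onto the root by an edge multiplies by `J g`. Then `h = Λ f`
(`IsRemovalInvariant.eq_bottomCoeff`). Indeed, a face maximizing a functional on a connected set `U`
is determined by the nonempty set `A` of maximizers in `U` and a face for `U \ A`. After
substituting `s - 1` this reads `∑ (s-1)^|U \ A| H(A) = s H(U)`, summed over all `A ⊆ U`. Splitting
according to whether the root lies in `A` turns the recursion into `s Λ(f) = (s-1) f(0) + Λ(S f)`
(`smul_bottomCoeff`).

Positivity comes from the `M_k`: their products expand in the basis `M_k` with coefficients that are
γ-nonnegative (`meixner_mul_succ`), and so do their images under `J`. Hence `Λ f` is γ-nonnegative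
and the γ-polynomial exists.

In a tree shift along a path with `k` edges, let `f` belong to `F ∪ {c}` and `g` to the remaining
part at `c`. The polynomial at `c` is `f g J^k 1` before the shift and `g J^k f` after it. The `M_k`
are orthogonal for `Λ` and `J` is self-adjoint, so `Λ(M_j J^k M_i) = Λ((M_i ∘ M_j) J^k 1)`, where
`∘` is the Chebyshev product, the one commuting with `J`. The loss is therefore `Λ((M_i M_j - M_i ∘
M_j) J^k 1)`, and the ordinary product dominates `∘` (`bottomCoeff_sub_mem_gammaCone`).

For the order, a shift strictly lowers the number of leaves, which gives antisymmetry. A tree with a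
vertex of degree at least three admits a shift, and a tree with an edge joining two non-leaves
arises from one; the only trees without these features are the path and the star. -/

/-- The Meixner polynomials with generating function `(1 + sτ) ^ m / (1 + τ) ^ (m + 1)`, as
polynomials in `(s - 1) m - 1` over `ℚ[s]`. -/
noncomputable def meixner : ℕ → ℚ[X][X]
  | 0 => 1
  | 1 => X
  | k + 2 => C (C (((k : ℚ) + 2)⁻¹)) * ((X - ((k : ℚ[X][X]) + 1) * C (1 + X)) * meixner (k + 1)
      - C X * ((k : ℚ[X][X]) + 1) * meixner k)

theorem meixner_rec (k : ℕ) : ((k : ℚ[X][X]) + 2) * meixner (k + 2) =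
    (X - ((k : ℚ[X][X]) + 1) * C (1 + X)) * meixner (k + 1)
      - C X * ((k : ℚ[X][X]) + 1) * meixner k := by
  have h : ((k : ℚ[X][X]) + 2) * C (C (((k : ℚ) + 2)⁻¹)) = 1 := by
    have h1 : ((k : ℚ[X][X]) + 2) = C (C ((k : ℚ) + 2)) := by
      rw [C_add, C_add, map_natCast, map_natCast]; rfl
    rw [h1, ← C_mul, ← C_mul, mul_inv_cancel₀ (by positivity), C_1, C_1]
  rw [meixner, ← mul_assoc, h, one_mul]

/-- The leading coefficient `1/k!` is a unit of `ℚ[X]`, which makes the `M_k` a basis over `ℚ[X]`.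
Rational coefficients are used for this reason. -/
theorem natDegree_meixner_le (k : ℕ) : (meixner k).natDegree ≤ k ∧
    (meixner k).coeff k = C ((k.factorial : ℚ)⁻¹) := by
  induction k using Nat.strong_induction_on with
  | _ k ih =>
    match k with
    | 0 => simp [meixner]
    | 1 => simp [meixner]
    | k + 2 =>
      obtain ⟨h1, h1'⟩ := ih (k + 1) (by omega)
      obtain ⟨h0, -⟩ := ih k (by omega)
      have e : (X - ((k : ℚ[X][X]) + 1) * C (1 + X)) * meixner (k + 1)
          - C X * ((k : ℚ[X][X]) + 1) * meixner k
          = X * meixner (k + 1) - (C (((k : ℚ[X]) + 1) * (1 + X)) * meixner (k + 1)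
            + C (X * ((k : ℚ[X]) + 1)) * meixner k) := by
        simp only [map_mul, map_add, map_natCast, map_one]; ring
      rw [meixner, e]
      constructor
      · refine (natDegree_C_mul_le _ _).trans ((natDegree_sub_le _ _).trans (max_le ?_ ?_))
        · exact natDegree_mul_le.trans (by rw [natDegree_X]; omega)
        · refine (natDegree_add_le _ _).trans (max_le ?_ ?_)
          · exact (natDegree_C_mul_le _ _).trans (by omega)
          · exact (natDegree_C_mul_le _ _).trans (by omega)
      · rw [coeff_C_mul, coeff_sub, coeff_X_mul, h1', coeff_add, coeff_C_mul, coeff_C_mul,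
          coeff_eq_zero_of_natDegree_lt (by omega : (meixner (k + 1)).natDegree < k + 2),
          coeff_eq_zero_of_natDegree_lt (by omega : (meixner k).natDegree < k + 2), mul_zero,
          mul_zero, add_zero, sub_zero, ← C_mul, ← mul_inv, Nat.factorial_succ (k + 1)]
        push_cast
        ring_nf

theorem C_inv_factorial_ne_zero (k : ℕ) : (C ((k.factorial : ℚ)⁻¹) : ℚ[X]) ≠ 0 := by
  rw [Ne, C_eq_zero, inv_eq_zero]
  exact_mod_cast k.factorial_ne_zero

theorem natDegree_meixner (k : ℕ) : (meixner k).natDegree = k :=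
  natDegree_eq_of_le_of_coeff_ne_zero (natDegree_meixner_le k).1
    (by rw [(natDegree_meixner_le k).2]; exact C_inv_factorial_ne_zero k)

/-- The Meixner polynomials as a polynomial sequence. -/
noncomputable def meixnerSequence : Polynomial.Sequence ℚ[X] where
  elems' := meixner
  degree_eq' k := by
    have h : meixner k ≠ 0 := fun h => by
      have := (natDegree_meixner_le k).2
      rw [h, coeff_zero] at this
      exact C_inv_factorial_ne_zero k this.symm
    rw [degree_eq_natDegree h, natDegree_meixner]

/-- The Meixner polynomials as a basis. -/
noncomputable def meixnerBasis : Module.Basis ℕ ℚ[X] ℚ[X][X] :=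
  meixnerSequence.basis fun k => by
    have h : (meixnerSequence k).leadingCoeff = C ((k.factorial : ℚ)⁻¹) := by
      change (meixner k).coeff (meixner k).natDegree = _
      rw [natDegree_meixner]
      exact (natDegree_meixner_le k).2
    rw [h]
    exact (isUnit_C).2 (isUnit_iff_ne_zero.2 (by
      rw [Ne, inv_eq_zero]; exact_mod_cast k.factorial_ne_zero))

@[simp]
theorem meixnerBasis_apply (k : ℕ) : meixnerBasis k = meixner k :=
  Polynomial.Sequence.basis_eq_self _ _ _

/-- The translation of the argument `m` by one. -/
noncomputable def shiftHom : ℚ[X][X] →ₐ[ℚ[X]] ℚ[X][X] := aeval (X + C (X - 1))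

/-- The evaluation at `m = 0`. -/
noncomputable def evalZero : ℚ[X][X] →ₐ[ℚ[X]] ℚ[X] := aeval (-1)

/-- The coefficient of the constant Meixner polynomial. -/
noncomputable def bottomCoeff : ℚ[X][X] →ₗ[ℚ[X]] ℚ[X] :=
  meixnerBasis.constr ℚ[X] fun k => if k = 0 then 1 else 0

/-- The operator raising the index of the Meixner polynomials. -/
noncomputable def raise : ℚ[X][X] →ₗ[ℚ[X]] ℚ[X][X] :=
  meixnerBasis.constr ℚ[X] fun k => meixner (k + 1)

/-- The Jacobi operator describing the attachment of a new root by an edge. -/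
noncomputable def edgeOp : ℚ[X][X] →ₗ[ℚ[X]] ℚ[X][X] :=
  meixnerBasis.constr ℚ[X] fun k =>
    meixner (k + 1) + (1 + X : ℚ[X]) • meixner k
      + (if k = 0 then 0 else (X : ℚ[X]) • meixner (k - 1))

theorem bottomCoeff_meixner (k : ℕ) : bottomCoeff (meixner k) = if k = 0 then 1 else 0 := by
  rw [← meixnerBasis_apply, bottomCoeff, Module.Basis.constr_basis]

@[simp]
theorem bottomCoeff_meixner_zero : bottomCoeff (meixner 0) = 1 := by
  simp [bottomCoeff_meixner]

@[simp]
theorem bottomCoeff_meixner_succ (k : ℕ) : bottomCoeff (meixner (k + 1)) = 0 := by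
  simp [bottomCoeff_meixner]

@[simp]
theorem raise_meixner (k : ℕ) : raise (meixner k) = meixner (k + 1) := by
  rw [← meixnerBasis_apply, raise, Module.Basis.constr_basis]

theorem edgeOp_meixner_zero :
    edgeOp (meixner 0) = meixner 1 + (1 + X : ℚ[X]) • meixner 0 := by
  rw [← meixnerBasis_apply, edgeOp, Module.Basis.constr_basis]
  simp

theorem edgeOp_meixner_succ (k : ℕ) : edgeOp (meixner (k + 1)) =
    meixner (k + 2) + (1 + X : ℚ[X]) • meixner (k + 1) + (X : ℚ[X]) • meixner k := by
  rw [← meixnerBasis_apply, edgeOp, Module.Basis.constr_basis]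
  simp

theorem meixner_zero : meixner 0 = 1 := rfl

theorem linearMap_ext_meixner {M : Type*} [AddCommGroup M] [Module ℚ[X] M]
    {f g : ℚ[X][X] →ₗ[ℚ[X]] M} (h : ∀ k, f (meixner k) = g (meixner k)) : f = g :=
  meixnerBasis.ext fun k => by rw [meixnerBasis_apply]; exact h k

theorem shiftHom_C (a : ℚ[X]) : shiftHom (C a) = C a := by
  rw [shiftHom, aeval_C]; rfl

theorem shiftHom_X : shiftHom X = X + C (X - 1) := by
  rw [shiftHom, aeval_X]

/-- Replacing `m` by `m + 1` multiplies the generating function by `(1+sτ)/(1+τ)`, which is the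
first identity. The second, in which `X + C X = (s-1)(m+1)`, is carried along because translating
the three-term recurrence produces the product of `X` with the translate of `meixner (k + 1)`. -/
theorem shiftHom_meixner (k : ℕ) :
    shiftHom (meixner (k + 1)) + shiftHom (meixner k) = meixner (k + 1) + C X * meixner k ∧
    (X + C X) * shiftHom (meixner (k + 1)) = (X + C X + ((k : ℚ[X][X]) + 1) * C (X - 1)) * meixner (k + 1)
      + ((k : ℚ[X][X]) + 1) * C X * C (X - 1) * meixner k := by
  induction k with
  | zero =>
    have h0 : meixner 0 = 1 := rfl
    have h1 : meixner 1 = X := rfl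
    simp only [zero_add, h0, h1, map_one, shiftHom_X, map_sub, Nat.cast_zero]
    constructor <;> ring
  | succ k ih =>
    obtain ⟨ih1, ih2⟩ := ih
    have hr := meixner_rec k
    have hr' := congrArg shiftHom hr
    simp only [map_mul, map_sub, map_add, map_natCast, map_ofNat, map_one, shiftHom_C,
      shiftHom_X] at hr'
    simp only [map_sub, map_add, map_one] at hr ih2 hr'
    have hk : ((k : ℚ[X][X]) + 2) ≠ 0 := by
      have : ((k + 2 : ℕ) : ℚ[X][X]) ≠ 0 := Nat.cast_ne_zero.2 (by omega)
      exact_mod_cast this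
    have first : shiftHom (meixner (k + 2)) + shiftHom (meixner (k + 1)) =
        meixner (k + 2) + C X * meixner (k + 1) := by
      apply mul_left_cancel₀ hk
      linear_combination hr' - hr + ih2 - C X * ((k : ℚ[X][X]) + 1) * ih1
    refine ⟨first, ?_⟩
    simp only [map_sub, map_one]
    push_cast
    linear_combination (X + C X) * first - ih2 - (C X - 1) * hr

theorem shiftHom_meixner_succ (k : ℕ) : shiftHom (meixner (k + 1)) =
    meixner (k + 1) + C X * meixner k - shiftHom (meixner k) := by
  rw [← (shiftHom_meixner k).1]; ring

/-- At `m = 0` the generating function is `1/(1+τ)`. -/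
theorem evalZero_meixner (k : ℕ) : evalZero (meixner k) = (-1) ^ k := by
  induction k using Nat.strong_induction_on with
  | _ k ih =>
    match k with
    | 0 => simp [meixner]
    | 1 => simp [meixner, evalZero]
    | k + 2 =>
      have hr := congrArg evalZero (meixner_rec k)
      have hC : ∀ a : ℚ[X], evalZero (C a) = a := fun a => by rw [evalZero, aeval_C]; rfl
      have hX : evalZero X = -1 := by rw [evalZero, aeval_X]
      simp only [map_mul, map_sub, map_add, map_natCast, map_ofNat, map_one, hC, hX,
        ih (k + 1) (by omega), ih k (by omega)] at hr
      have hk : (k : ℚ[X]) + 2 ≠ 0 := by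
        have : ((k + 2 : ℕ) : ℚ[X]) ≠ 0 := Nat.cast_ne_zero.2 (by omega)
        exact_mod_cast this
      apply mul_left_cancel₀ hk
      rw [hr]
      have := hC (1 + X)
      rw [map_add, map_add, map_one, map_one, hC] at *
      ring

/-- On the generating function of the `M_k` this is `s = (s-1)/(1+τ) + (1+sτ)/(1+τ)`. It is the
algebraic form of splitting a sum over vertex subsets by whether the root is removed or kept. -/
theorem smul_bottomCoeff (f : ℚ[X][X]) :
    X * bottomCoeff f = (X - 1) * evalZero f + bottomCoeff (shiftHom f) := by
  have h : (X : ℚ[X]) • bottomCoeff =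
      (X - 1 : ℚ[X]) • evalZero.toLinearMap + bottomCoeff ∘ₗ shiftHom.toLinearMap := by
    refine linearMap_ext_meixner fun k => ?_
    simp only [LinearMap.smul_apply, LinearMap.add_apply, LinearMap.comp_apply,
      AlgHom.toLinearMap_apply, smul_eq_mul, evalZero_meixner]
    induction k with
    | zero =>
      have h0 : shiftHom (meixner 0) = meixner 0 := map_one shiftHom
      rw [h0, bottomCoeff_meixner_zero]
      ring
    | succ k ih =>
      rw [shiftHom_meixner_succ, map_sub, map_add, ← smul_eq_C_mul, map_smul, smul_eq_mul, ih,
        bottomCoeff_meixner_succ]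
      ring
  have := LinearMap.congr_fun h f
  simpa using this

/-- `J` sends the generating function `G` to `((1+τ)(1+sτ) G - 1)/τ`. Only the boundary term `-1/τ`
fails to commute with translation; it leaves `(s-1)/(1+τ)`, the generating function of `(s-1)
M_k(0)`. -/
theorem shiftHom_edgeOp (f : ℚ[X][X]) :
    shiftHom (edgeOp f) = C ((X - 1) * evalZero f) + edgeOp (shiftHom f) := by
  have h : shiftHom.toLinearMap ∘ₗ edgeOp =
      (X - 1 : ℚ[X]) • (Algebra.linearMap ℚ[X] ℚ[X][X] ∘ₗ evalZero.toLinearMap)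
        + edgeOp ∘ₗ shiftHom.toLinearMap := by
    refine linearMap_ext_meixner fun k => ?_
    simp only [LinearMap.smul_apply, LinearMap.add_apply, LinearMap.comp_apply,
      AlgHom.toLinearMap_apply, evalZero_meixner, Algebra.linearMap_apply, algebraMap_eq]
    have h0 : shiftHom (meixner 0) = meixner 0 := map_one _
    have s0 := shiftHom_meixner_succ 0
    induction k with
    | zero =>
      rw [h0] at s0 ⊢
      rw [edgeOp_meixner_zero, map_add, map_smul, h0, s0]
      simp only [smul_eq_C_mul, meixner_zero, map_sub, map_add, map_one, pow_zero]
      ring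
    | succ k ih =>
      have hC : edgeOp (C X * meixner k) = C X * edgeOp (meixner k) := by
        rw [← smul_eq_C_mul, map_smul, smul_eq_C_mul]
      have hk : edgeOp (shiftHom (meixner k)) = shiftHom (edgeOp (meixner k))
          - (X - 1 : ℚ[X]) • C ((-1) ^ k) := by rw [ih]; ring
      rw [shiftHom_meixner_succ, map_sub, map_add, hC, hk]
      cases k with
      | zero =>
        have s1 : shiftHom (meixner (0 + 2)) = _ := shiftHom_meixner_succ 1
        rw [edgeOp_meixner_succ, edgeOp_meixner_zero]
        simp only [map_add shiftHom, map_smul, s1, s0, h0]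
        simp only [smul_eq_C_mul, map_add, map_pow, map_neg, map_sub, map_one, zero_add,
          meixner_zero]
        ring
      | succ k =>
        have s1 := shiftHom_meixner_succ (k + 2)
        have s2 := shiftHom_meixner_succ (k + 1)
        have s3 := shiftHom_meixner_succ k
        simp only [edgeOp_meixner_succ, map_add shiftHom, map_smul, s1, s2, s3]
        simp only [smul_eq_C_mul, map_add, map_pow, map_neg, map_sub, map_one]
        ring
  have := LinearMap.congr_fun h f
  simp only [LinearMap.smul_apply, LinearMap.add_apply, LinearMap.comp_apply,
      AlgHom.toLinearMap_apply, Algebra.linearMap_apply, algebraMap_eq, smul_eq_C_mul,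
      ← C_mul] at this
  exact this

/-- At `m = 0` the generating function becomes `((1+sτ) - 1)/τ = s`, so only the coefficient of
`M_0` survives. -/
theorem evalZero_edgeOp (f : ℚ[X][X]) : evalZero (edgeOp f) = X * bottomCoeff f := by
  have h : evalZero.toLinearMap ∘ₗ edgeOp = (X : ℚ[X]) • bottomCoeff := by
    refine linearMap_ext_meixner fun k => ?_
    simp only [LinearMap.smul_apply, LinearMap.comp_apply, AlgHom.toLinearMap_apply, smul_eq_mul]
    cases k with
    | zero =>
      rw [edgeOp_meixner_zero, map_add, map_smul, evalZero_meixner, evalZero_meixner]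
      simp
    | succ k =>
      rw [edgeOp_meixner_succ, map_add, map_add, map_smul, map_smul]
      simp only [evalZero_meixner, bottomCoeff_meixner_succ, smul_eq_mul]
      ring
  have := LinearMap.congr_fun h f
  simpa using this

/-! ### The linearisation of products -/

/-- Translation invariance propagates the zero at `m = 0` to all `m = k`, that is to the infinitely
many points `-1 + k(s-1)`. -/
theorem eq_zero_of_shiftHom_eq {x : ℚ[X][X]} (h : shiftHom x = x) (h0 : evalZero x = 0) :
    x = 0 := by
  have hroot : ∀ k : ℕ, x.eval (-1 + (k : ℚ[X]) * (X - 1)) = 0 := by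
    intro k
    induction k with
    | zero =>
      rw [evalZero, coe_aeval_eq_eval] at h0
      rw [Nat.cast_zero, zero_mul, add_zero, h0]
    | succ k ih =>
      rw [← h, shiftHom, ← comp_eq_aeval, eval_comp] at ih
      have e : (X + C (X - 1 : ℚ[X])).eval (-1 + (k : ℚ[X]) * (X - 1)) =
          -1 + ((k + 1 : ℕ) : ℚ[X]) * (X - 1) := by
        rw [eval_add, eval_X, eval_C]; push_cast; ring
      rwa [e] at ih
  refine eq_zero_of_infinite_isRoot x (Set.infinite_of_injective_forall_mem
    (f := fun k : ℕ => -1 + (k : ℚ[X]) * (X - 1)) ?_ hroot)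
  intro k l hkl
  have h1 : (X - 1 : ℚ[X]) ≠ 0 := by
    simpa using X_sub_C_ne_zero (1 : ℚ)
  have := mul_right_cancel₀ h1 (add_left_cancel hkl)
  exact_mod_cast this

theorem shiftHom_raise (w : ℚ[X][X]) :
    shiftHom (raise w) + shiftHom w = raise w + C X * w := by
  have h : shiftHom.toLinearMap ∘ₗ raise + shiftHom.toLinearMap =
      raise + (X : ℚ[X]) • LinearMap.id := by
    refine linearMap_ext_meixner fun k => ?_
    simp only [LinearMap.smul_apply, LinearMap.add_apply, LinearMap.comp_apply,
      AlgHom.toLinearMap_apply, raise_meixner, LinearMap.id_apply, smul_eq_C_mul]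
    exact (shiftHom_meixner k).1
  have := LinearMap.congr_fun h w
  simpa [smul_eq_C_mul] using this

theorem evalZero_raise (w : ℚ[X][X]) : evalZero (raise w) = - evalZero w := by
  have h : evalZero.toLinearMap ∘ₗ raise = - evalZero.toLinearMap := by
    refine linearMap_ext_meixner fun k => ?_
    simp only [LinearMap.neg_apply, LinearMap.comp_apply,
      AlgHom.toLinearMap_apply, raise_meixner, evalZero_meixner]
    ring
  exact LinearMap.congr_fun h w

theorem bottomCoeff_raise (w : ℚ[X][X]) : bottomCoeff (raise w) = 0 := by
  have h : bottomCoeff ∘ₗ raise = 0 := by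
    refine linearMap_ext_meixner fun k => ?_
    simp
  exact LinearMap.congr_fun h w

/-- Linearization without signs: iterating it expands products of Meixner polynomials using only
`raise`, `1 + s` and `s`. The difference of the two sides is invariant under translation and
vanishes at `m = 0`. -/
theorem meixner_mul_succ (i j : ℕ) : meixner (i + 1) * meixner (j + 1) =
    raise (meixner i * meixner (j + 1) + meixner (i + 1) * meixner j
      + (1 + X : ℚ[X]) • (meixner i * meixner j)) + (X : ℚ[X]) • (meixner i * meixner j) := by
  set w := meixner i * meixner (j + 1) + meixner (i + 1) * meixner j
      + (1 + X : ℚ[X]) • (meixner i * meixner j) with hw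
  simp only [smul_eq_C_mul, map_add, map_one] at hw ⊢
  rw [← sub_eq_zero]
  have hr := shiftHom_raise w
  have h1 := (shiftHom_meixner i).1
  have h2 := (shiftHom_meixner j).1
  apply eq_zero_of_shiftHom_eq
  · have hS : shiftHom w = shiftHom (meixner i) * shiftHom (meixner (j + 1))
        + shiftHom (meixner (i + 1)) * shiftHom (meixner j)
        + (1 + C X) * (shiftHom (meixner i) * shiftHom (meixner j)) := by
      rw [hw]; simp only [map_add, map_mul, map_one, shiftHom_C]
    simp only [map_sub, map_add, map_mul, shiftHom_C]
    rw [hS] at hr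
    nth_rw 3 [hw] at hr
    linear_combination (shiftHom (meixner (j + 1)) + shiftHom (meixner j)) * h1
      + (meixner (i + 1) + C X * meixner i) * h2 - hr
  · have hE : evalZero w = evalZero (meixner i) * evalZero (meixner (j + 1))
        + evalZero (meixner (i + 1)) * evalZero (meixner j)
        + (1 + X) * (evalZero (meixner i) * evalZero (meixner j)) := by
      rw [hw]
      simp only [map_add, map_mul, map_one, evalZero, aeval_C, Algebra.algebraMap_self,
        RingHom.id_apply]
    have hC : evalZero (C X) = X := by rw [evalZero, aeval_C]; rfl
    simp only [map_sub, map_add, map_mul, evalZero_raise, hE, hC, evalZero_meixner]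
    ring


/-! ### Cones of polynomials with nonnegative `γ`-coefficients -/

/-- The palindromic polynomials of degree `d` whose `γ`-coefficients are natural numbers. -/
noncomputable def gammaCone (d : ℕ) : AddSubmonoid ℚ[X] :=
  AddSubmonoid.closure {x | ∃ i j, 2 * i + j = d ∧ x = X ^ i * (1 + X) ^ j}

/-- The polynomials of weight `d` whose coefficients in the Meixner basis have natural numbers as
`γ`-coefficients. -/
noncomputable def meixnerCone (d : ℕ) : AddSubmonoid ℚ[X][X] :=
  AddSubmonoid.closure
    {x | ∃ i j k, 2 * i + j + k = d ∧ x = (X ^ i * (1 + X) ^ j : ℚ[X]) • meixner k}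

theorem map_mem_of_mem_gammaCone {N : Type*} [AddCommMonoid N] {d : ℕ} (L : ℚ[X] →+ N)
    (T : AddSubmonoid N) (h : ∀ i j, 2 * i + j = d → L (X ^ i * (1 + X) ^ j) ∈ T)
    {f : ℚ[X]} (hf : f ∈ gammaCone d) : L f ∈ T := by
  have : gammaCone d ≤ T.comap L := by
    refine AddSubmonoid.closure_le.2 ?_
    rintro x ⟨i, j, hij, rfl⟩
    exact h i j hij
  exact this hf

theorem map_mem_of_mem_meixnerCone {N : Type*} [AddCommMonoid N] {d : ℕ} (L : ℚ[X][X] →+ N)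
    (T : AddSubmonoid N)
    (h : ∀ i j k, 2 * i + j + k = d → L ((X ^ i * (1 + X) ^ j : ℚ[X]) • meixner k) ∈ T)
    {f : ℚ[X][X]} (hf : f ∈ meixnerCone d) : L f ∈ T := by
  have : meixnerCone d ≤ T.comap L := by
    refine AddSubmonoid.closure_le.2 ?_
    rintro x ⟨i, j, k, hij, rfl⟩
    exact h i j k hij
  exact this hf

theorem X_pow_mul_mem_gammaCone {i j d : ℕ} (h : 2 * i + j = d) :
    (X ^ i * (1 + X) ^ j : ℚ[X]) ∈ gammaCone d :=
  AddSubmonoid.subset_closure ⟨i, j, h, rfl⟩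

theorem X_mem_gammaCone : (X : ℚ[X]) ∈ gammaCone 2 := by
  simpa using X_pow_mul_mem_gammaCone (i := 1) (j := 0) (d := 2) rfl

theorem one_add_X_mem_gammaCone : (1 + X : ℚ[X]) ∈ gammaCone 1 := by
  simpa using X_pow_mul_mem_gammaCone (i := 0) (j := 1) (d := 1) rfl

theorem mul_mem_gammaCone {d e : ℕ} {a b : ℚ[X]} (ha : a ∈ gammaCone d) (hb : b ∈ gammaCone e) :
    a * b ∈ gammaCone (d + e) := by
  suffices h : AddMonoidHom.mulRight b a ∈ gammaCone (d + e) from h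
  refine map_mem_of_mem_gammaCone _ _ (fun i j hij => ?_) ha
  suffices h : AddMonoidHom.mulLeft (X ^ i * (1 + X) ^ j) b ∈ gammaCone (d + e) from h
  refine map_mem_of_mem_gammaCone _ _ (fun i' j' h => ?_) hb
  rw [AddMonoidHom.coe_mulLeft, show (X ^ i * (1 + X) ^ j * (X ^ i' * (1 + X) ^ j') : ℚ[X]) =
    X ^ (i + i') * (1 + X) ^ (j + j') by ring]
  exact X_pow_mul_mem_gammaCone (by omega)

theorem smul_mem_meixnerCone {d e : ℕ} {a : ℚ[X]} {f : ℚ[X][X]} (ha : a ∈ gammaCone d)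
    (hf : f ∈ meixnerCone e) : a • f ∈ meixnerCone (d + e) := by
  refine map_mem_of_mem_gammaCone ((AddMonoidHom.flip (smulAddHom ℚ[X] ℚ[X][X])) f) _
    (fun i j hij => ?_) ha
  refine map_mem_of_mem_meixnerCone (smulAddHom ℚ[X] ℚ[X][X] (X ^ i * (1 + X) ^ j)) _
    (fun i' j' k h => ?_) hf
  refine AddSubmonoid.subset_closure ⟨i + i', j + j', k, by omega, ?_⟩
  rw [smulAddHom_apply, smul_smul]
  congr 1
  ring

theorem meixner_mem_meixnerCone (k : ℕ) : meixner k ∈ meixnerCone k :=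
  AddSubmonoid.subset_closure ⟨0, 0, k, by omega, by simp⟩

theorem one_mem_meixnerCone : (1 : ℚ[X][X]) ∈ meixnerCone 0 :=
  meixner_mem_meixnerCone 0

theorem bottomCoeff_mem_gammaCone {d : ℕ} {f : ℚ[X][X]} (hf : f ∈ meixnerCone d) :
    bottomCoeff f ∈ gammaCone d := by
  refine map_mem_of_mem_meixnerCone bottomCoeff.toAddMonoidHom _ (fun i j k h => ?_) hf
  simp only [LinearMap.toAddMonoidHom_coe, map_smul, smul_eq_mul]
  cases k with
  | zero => rw [bottomCoeff_meixner_zero, mul_one]; exact X_pow_mul_mem_gammaCone h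
  | succ k => rw [bottomCoeff_meixner_succ, mul_zero]; exact zero_mem _

theorem linearMap_mem_meixnerCone {c d e : ℕ} (L : ℚ[X][X] →ₗ[ℚ[X]] ℚ[X][X])
    (h : ∀ k ≤ d, L (meixner k) ∈ meixnerCone (c + k)) (he : c + d = e) {f : ℚ[X][X]}
    (hf : f ∈ meixnerCone d) : L f ∈ meixnerCone e := by
  refine map_mem_of_mem_meixnerCone L.toAddMonoidHom _ (fun i j k hd => ?_) hf
  simp only [LinearMap.toAddMonoidHom_coe, map_smul]
  have := smul_mem_meixnerCone (X_pow_mul_mem_gammaCone (i := i) (j := j) rfl) (h k (by omega))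
  rwa [show 2 * i + j + (c + k) = e by omega] at this

theorem raise_mem_meixnerCone {d : ℕ} {f : ℚ[X][X]} (hf : f ∈ meixnerCone d) :
    raise f ∈ meixnerCone (d + 1) := by
  refine linearMap_mem_meixnerCone (c := 1) raise (fun k _ => ?_) (by omega) hf
  rw [raise_meixner, add_comm]
  exact meixner_mem_meixnerCone _

theorem edgeOp_mem_meixnerCone {d : ℕ} {f : ℚ[X][X]} (hf : f ∈ meixnerCone d) :
    edgeOp f ∈ meixnerCone (d + 1) := by
  refine linearMap_mem_meixnerCone (c := 1) edgeOp (fun k _ => ?_) (by omega) hf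
  cases k with
  | zero =>
    rw [edgeOp_meixner_zero]
    exact add_mem (meixner_mem_meixnerCone 1)
      (smul_mem_meixnerCone one_add_X_mem_gammaCone (meixner_mem_meixnerCone 0))
  | succ k =>
    rw [edgeOp_meixner_succ, show 1 + (k + 1) = k + 2 by omega]
    refine add_mem (add_mem (meixner_mem_meixnerCone _) ?_) ?_
    · have := smul_mem_meixnerCone one_add_X_mem_gammaCone (meixner_mem_meixnerCone (k + 1))
      rwa [show 1 + (k + 1) = k + 2 by omega] at this
    · have := smul_mem_meixnerCone X_mem_gammaCone (meixner_mem_meixnerCone k)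
      rwa [add_comm] at this

theorem edgeOp_pow_mem_meixnerCone {d : ℕ} {f : ℚ[X][X]} (hf : f ∈ meixnerCone d) (k : ℕ) :
    (edgeOp ^ k) f ∈ meixnerCone (d + k) := by
  induction k with
  | zero => simpa using hf
  | succ k ih =>
    rw [pow_succ', Module.End.mul_apply]
    exact edgeOp_mem_meixnerCone ih

/-- In the linearization formula `raise` and `1 + s` have weight one and `s` has weight two, so
every term on the right has total weight `i + j`. -/
theorem meixner_mul_meixner_mem (i j : ℕ) : meixner i * meixner j ∈ meixnerCone (i + j) := by
  induction i generalizing j with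
  | zero => rw [meixner_zero, one_mul, zero_add]; exact meixner_mem_meixnerCone j
  | succ i ihi =>
    induction j with
    | zero => rw [meixner_zero, mul_one]; exact meixner_mem_meixnerCone _
    | succ j ihj =>
      rw [meixner_mul_succ]
      refine add_mem (raise_mem_meixnerCone (d := i + 1 + j) (add_mem (add_mem ?_ ihj) ?_)) ?_
      · have := ihi (j + 1)
        rwa [show i + (j + 1) = i + 1 + j by omega] at this
      · have := smul_mem_meixnerCone one_add_X_mem_gammaCone (ihi j)
        rwa [show 1 + (i + j) = i + 1 + j by omega] at this
      · have := smul_mem_meixnerCone X_mem_gammaCone (ihi j)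
        rwa [show 2 + (i + j) = i + 1 + (j + 1) by omega] at this

theorem mul_mem_meixnerCone {d e : ℕ} {f g : ℚ[X][X]} (hf : f ∈ meixnerCone d)
    (hg : g ∈ meixnerCone e) : f * g ∈ meixnerCone (d + e) := by
  refine linearMap_mem_meixnerCone (c := d) (LinearMap.mulLeft ℚ[X] f) (fun k _ => ?_) rfl hg
  rw [LinearMap.mulLeft_apply, mul_comm, ← LinearMap.mulLeft_apply ℚ[X]]
  refine linearMap_mem_meixnerCone (c := k) (LinearMap.mulLeft ℚ[X] (meixner k))
    (fun l _ => ?_) (by omega) hf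
  rw [LinearMap.mulLeft_apply]
  exact meixner_mul_meixner_mem k l

/-! ### The comparison of products -/

/-- The `γ`-minimal part of the product of two Meixner polynomials: the product for which the
Jacobi operator is a multiplication operator. -/
noncomputable def chebyshevMul : ℕ → ℕ → ℚ[X][X]
  | 0, j => meixner j
  | i + 1, 0 => meixner (i + 1)
  | i + 1, j + 1 => meixner (i + j + 2) + (X : ℚ[X]) • chebyshevMul i j

theorem chebyshevMul_succ_succ (i j : ℕ) : chebyshevMul (i + 1) (j + 1) =
    meixner (i + j + 2) + (X : ℚ[X]) • chebyshevMul i j := by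
  rw [chebyshevMul]

/-- The top term of the product is split off because, raised once, it supplies the leading term of
`chebyshevMul` in the comparison below. -/
theorem meixner_mul_sub_top_mem (i j : ℕ) :
    meixner i * meixner j - meixner (i + j) ∈ meixnerCone (i + j) := by
  induction i generalizing j with
  | zero => rw [meixner_zero, one_mul, zero_add, sub_self]; exact zero_mem _
  | succ i ihi =>
    cases j with
    | zero => rw [meixner_zero, mul_one, add_zero, sub_self]; exact zero_mem _
    | succ j =>
      have e : meixner (i + 1) * meixner (j + 1) - meixner (i + 1 + (j + 1)) =
          raise ((meixner i * meixner (j + 1) - meixner (i + (j + 1)))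
            + meixner (i + 1) * meixner j + (1 + X : ℚ[X]) • (meixner i * meixner j))
            + (X : ℚ[X]) • (meixner i * meixner j) := by
        rw [meixner_mul_succ]
        simp only [map_add, map_sub, raise_meixner]
        rw [show i + (j + 1) + 1 = i + 1 + (j + 1) by omega]
        ring
      rw [e]
      refine add_mem (raise_mem_meixnerCone (d := i + 1 + j) (add_mem (add_mem ?_ ?_) ?_)) ?_
      · have := ihi (j + 1)
        rwa [show i + (j + 1) = i + 1 + j by omega] at this ⊢
      · exact meixner_mul_meixner_mem _ _
      · have := smul_mem_meixnerCone one_add_X_mem_gammaCone (meixner_mul_meixner_mem i j)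
        rwa [show 1 + (i + j) = i + 1 + j by omega] at this
      · have := smul_mem_meixnerCone X_mem_gammaCone (meixner_mul_meixner_mem i j)
        rwa [show 2 + (i + j) = i + 1 + (j + 1) by omega] at this

/-- The Chebyshev product keeps only two pieces of the linearization formula, the top Meixner
polynomial and the recursive term with factor `s`; everything discarded lies in the cone. -/
theorem meixner_mul_sub_chebyshevMul_mem (i j : ℕ) :
    meixner i * meixner j - chebyshevMul i j ∈ meixnerCone (i + j) := by
  induction i generalizing j with
  | zero => rw [chebyshevMul, meixner_zero, one_mul, sub_self]; exact zero_mem _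
  | succ i ihi =>
    cases j with
    | zero => rw [chebyshevMul, meixner_zero, mul_one, sub_self]; exact zero_mem _
    | succ j =>
      have e : meixner (i + 1) * meixner (j + 1) - chebyshevMul (i + 1) (j + 1) =
          raise ((meixner i * meixner (j + 1) - meixner (i + (j + 1)))
            + meixner (i + 1) * meixner j + (1 + X : ℚ[X]) • (meixner i * meixner j))
            + (X : ℚ[X]) • (meixner i * meixner j - chebyshevMul i j) := by
        rw [meixner_mul_succ, chebyshevMul]
        simp only [map_add, map_sub, raise_meixner, smul_sub]
        rw [show i + (j + 1) + 1 = i + j + 2 by omega]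
        ring
      rw [e]
      refine add_mem (raise_mem_meixnerCone (d := i + 1 + j) (add_mem (add_mem ?_ ?_) ?_)) ?_
      · have := meixner_mul_sub_top_mem i (j + 1)
        rwa [show i + (j + 1) = i + 1 + j by omega] at this ⊢
      · exact meixner_mul_meixner_mem _ _
      · have := smul_mem_meixnerCone one_add_X_mem_gammaCone (meixner_mul_meixner_mem i j)
        rwa [show 1 + (i + j) = i + 1 + j by omega] at this
      · have := smul_mem_meixnerCone X_mem_gammaCone (ihi j)
        rwa [show 2 + (i + j) = i + 1 + (j + 1) by omega] at this

/-- Orthogonality for `Λ`: a raised polynomial has no bottom coefficient, so only the term with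
factor `s` survives each step of the linearization. -/
theorem bottomCoeff_meixner_mul (i j : ℕ) :
    bottomCoeff (meixner i * meixner j) = if i = j then X ^ i else 0 := by
  induction i generalizing j with
  | zero => rw [meixner_zero, one_mul, bottomCoeff_meixner]; simp [eq_comm]
  | succ i ih =>
    cases j with
    | zero => rw [meixner_zero, mul_one, bottomCoeff_meixner_succ]; simp
    | succ j =>
      rw [meixner_mul_succ, map_add, bottomCoeff_raise, map_smul, ih]
      simp [pow_succ']

theorem bottomCoeff_chebyshevMul (i j : ℕ) :
    bottomCoeff (chebyshevMul i j) = if i = j then X ^ i else 0 := by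
  induction i generalizing j with
  | zero => rw [chebyshevMul, bottomCoeff_meixner]; simp [eq_comm]
  | succ i ih =>
    cases j with
    | zero => rw [chebyshevMul, bottomCoeff_meixner_succ]; simp
    | succ j =>
      rw [chebyshevMul, map_add, bottomCoeff_meixner_succ, map_smul, ih]
      simp [pow_succ']

/-- `J` is tridiagonal in an orthogonal basis with norms `s^k`. The entry `1` upwards from `M_k` and
the entry `s` downwards from `M_{k+1}` balance: `1 · s^(k+1) = s · s^k`. -/
theorem bottomCoeff_mul_edgeOp (f g : ℚ[X][X]) :
    bottomCoeff (f * edgeOp g) = bottomCoeff (edgeOp f * g) := by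
  obtain ⟨B, hB⟩ : ∃ B : ℚ[X][X] →ₗ[ℚ[X]] ℚ[X][X] →ₗ[ℚ[X]] ℚ[X],
      ∀ f g, B f g = bottomCoeff (f * g) :=
    ⟨(LinearMap.mul ℚ[X] ℚ[X][X]).compr₂ bottomCoeff, fun _ _ => rfl⟩
  have h : B.compl₂ edgeOp = B ∘ₗ edgeOp := by
    refine linearMap_ext_meixner fun i => linearMap_ext_meixner fun j => ?_
    simp only [LinearMap.compl₂_apply, LinearMap.comp_apply]
    obtain _ | i := i <;> obtain _ | j := j
    · simp only [edgeOp_meixner_zero, map_add, map_smul, LinearMap.add_apply,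
        LinearMap.smul_apply, smul_eq_mul]
      simp only [hB, bottomCoeff_meixner_mul]
      simp
    · simp only [edgeOp_meixner_zero, edgeOp_meixner_succ, map_add, map_smul, LinearMap.add_apply,
        LinearMap.smul_apply, smul_eq_mul]
      simp only [hB, bottomCoeff_meixner_mul]
      obtain _ | j := j <;> simp
    · simp only [edgeOp_meixner_zero, edgeOp_meixner_succ, map_add, map_smul, LinearMap.add_apply,
        LinearMap.smul_apply, smul_eq_mul]
      simp only [hB, bottomCoeff_meixner_mul]
      obtain _ | i := i <;> simp
    · simp only [edgeOp_meixner_succ, map_add, map_smul, LinearMap.add_apply,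
        LinearMap.smul_apply, smul_eq_mul]
      simp only [hB, bottomCoeff_meixner_mul]
      rcases lt_trichotomy i j with hij | rfl | hij
      · rcases eq_or_ne (i + 1) j with rfl | h2
        · simp [pow_succ', show i ≠ i + 1 + 1 by omega]
        · simp [hij.ne, h2, show i ≠ j + 1 by omega,
            show i + 2 ≠ j + 1 by omega]
      · simp
      · rcases eq_or_ne (j + 1) i with rfl | h2
        · simp [pow_succ', show j + 1 + 1 ≠ j by omega]
        · simp [hij.ne', h2.symm, show i + 1 ≠ j by omega,
            show i + 2 ≠ j + 1 by omega]
  have := LinearMap.congr_fun (LinearMap.congr_fun h f) g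
  simpa only [LinearMap.compl₂_apply, LinearMap.comp_apply, hB] using this

theorem edgeOp_chebyshevMul_zero (j : ℕ) : edgeOp (chebyshevMul 0 j) =
    chebyshevMul 1 j + (1 + X : ℚ[X]) • chebyshevMul 0 j := by
  cases j with
  | zero => rw [chebyshevMul, chebyshevMul, edgeOp_meixner_zero]
  | succ j =>
    simp only [chebyshevMul, edgeOp_meixner_succ]
    rw [show 0 + j + 2 = j + 2 by omega]
    ring

/-- With the preceding lemma this says that `J` acts on the left factor of `∘`. Explicitly, `M_i ∘
M_j` is the sum of `s^t M_{i+j-2t}` over `t ≤ min(i, j)`. -/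
theorem edgeOp_chebyshevMul_succ (i j : ℕ) : edgeOp (chebyshevMul (i + 1) j) =
    chebyshevMul (i + 2) j + (1 + X : ℚ[X]) • chebyshevMul (i + 1) j
      + (X : ℚ[X]) • chebyshevMul i j := by
  induction i generalizing j with
  | zero =>
    cases j with
    | zero => simp only [chebyshevMul]; exact edgeOp_meixner_succ 0
    | succ j =>
      have e : edgeOp (chebyshevMul (0 + 1) (j + 1)) = edgeOp (meixner (j + 1 + 1))
          + (X : ℚ[X]) • edgeOp (chebyshevMul 0 j) := by
        rw [zero_add, chebyshevMul_succ_succ, map_add, map_smul, zero_add]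
      rw [e, edgeOp_chebyshevMul_zero, edgeOp_meixner_succ]
      simp only [chebyshevMul, zero_add, smul_add]
      rw [show 1 + j + 2 = j + 1 + 2 by omega, smul_comm (X : ℚ[X]) (1 + X : ℚ[X])]
      abel
  | succ i ih =>
    cases j with
    | zero => simp only [chebyshevMul]; exact edgeOp_meixner_succ (i + 1)
    | succ j =>
      rw [chebyshevMul, map_add, map_smul, ih, show i + 1 + j + 2 = (i + j + 2) + 1 by omega,
        edgeOp_meixner_succ]
      simp only [chebyshevMul, smul_add]
      rw [show i + 1 + 1 + j + 2 = i + j + 2 + 2 by omega,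
        smul_comm (X : ℚ[X]) (1 + X : ℚ[X])]
      abel

/-- For `k = 0` both products have the same bottom coefficient; for larger `k`, applying `J` to
`M_i` obeys the same three-term rule inside both products. -/
theorem bottomCoeff_meixner_mul_edgeOp_pow (k i j : ℕ) :
    bottomCoeff (meixner j * (edgeOp ^ k) (meixner i)) =
      bottomCoeff ((edgeOp ^ k) (chebyshevMul i j)) := by
  induction k generalizing i with
  | zero =>
    simp only [pow_zero, Module.End.one_apply]
    rw [bottomCoeff_chebyshevMul, mul_comm, bottomCoeff_meixner_mul]
  | succ k ih =>
    rw [pow_succ, Module.End.mul_apply, Module.End.mul_apply]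
    cases i with
    | zero =>
      rw [edgeOp_meixner_zero, edgeOp_chebyshevMul_zero]
      simp only [map_add, map_smul, mul_add, mul_smul_comm, ih]
    | succ i =>
      rw [edgeOp_meixner_succ, edgeOp_chebyshevMul_succ]
      simp only [map_add, map_smul, mul_add, mul_smul_comm, ih]

theorem bottomCoeff_mul_edgeOp_pow (k : ℕ) (f g : ℚ[X][X]) :
    bottomCoeff (f * (edgeOp ^ k) g) = bottomCoeff ((edgeOp ^ k) f * g) := by
  induction k generalizing f with
  | zero => simp
  | succ k ih =>
    rw [pow_succ', Module.End.mul_apply, bottomCoeff_mul_edgeOp, ih, ← Module.End.mul_apply,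
      ← pow_succ, pow_succ']

/-- The inequality behind a tree shift: `f` and `g` belong to trees attached to one end of a path
with `k` edges, or to the two ends of it. -/
theorem bottomCoeff_sub_mem_gammaCone {d e : ℕ} {f g : ℚ[X][X]} (hf : f ∈ meixnerCone d)
    (hg : g ∈ meixnerCone e) (k : ℕ) :
    bottomCoeff (f * g * (edgeOp ^ k) 1) - bottomCoeff (g * (edgeOp ^ k) f) ∈
      gammaCone (d + e + k) := by
  obtain ⟨L, hL⟩ : ∃ L : ℚ[X][X] →ₗ[ℚ[X]] ℚ[X][X] →ₗ[ℚ[X]] ℚ[X], ∀ f g, L f g =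
      bottomCoeff (f * g * (edgeOp ^ k) 1) - bottomCoeff (g * (edgeOp ^ k) f) :=
    ⟨(LinearMap.mul ℚ[X] ℚ[X][X]).compr₂ (bottomCoeff ∘ₗ LinearMap.mulRight ℚ[X] ((edgeOp ^ k) 1))
      - (LinearMap.mul ℚ[X] ℚ[X][X]).flip.compr₂ bottomCoeff ∘ₗ (edgeOp ^ k), fun _ _ => rfl⟩
  rw [← hL]
  have key : ∀ i j, L (meixner i) (meixner j) ∈ gammaCone (i + j + k) := by
    intro i j
    -- Self-adjointness moves `J^k` onto `1`, so the difference becomes `Λ` of a product of two cone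
    -- elements.
    have e1 : bottomCoeff ((edgeOp ^ k) (chebyshevMul i j)) =
        bottomCoeff (chebyshevMul i j * (edgeOp ^ k) 1) := by
      rw [bottomCoeff_mul_edgeOp_pow, mul_one]
    rw [hL, bottomCoeff_meixner_mul_edgeOp_pow, e1, ← map_sub, ← sub_mul]
    refine bottomCoeff_mem_gammaCone (mul_mem_meixnerCone (meixner_mul_sub_chebyshevMul_mem i j) ?_)
    have := edgeOp_pow_mem_meixnerCone one_mem_meixnerCone k
    rwa [zero_add] at this
  refine map_mem_of_mem_meixnerCone (L.flip g).toAddMonoidHom _ (fun i j l h => ?_) hf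
  simp only [LinearMap.toAddMonoidHom_coe, map_smul, LinearMap.flip_apply]
  have hl : L (meixner l) g ∈ gammaCone (l + e + k) := by
    refine map_mem_of_mem_meixnerCone (L (meixner l)).toAddMonoidHom _ (fun i j m h => ?_) hg
    simp only [LinearMap.toAddMonoidHom_coe, map_smul]
    have := mul_mem_gammaCone (X_pow_mul_mem_gammaCone (i := i) (j := j) rfl) (key l m)
    rwa [show 2 * i + j + (l + m + k) = l + e + k by omega] at this
  have := mul_mem_gammaCone (X_pow_mul_mem_gammaCone (i := i) (j := j) rfl) hl
  rwa [show 2 * i + j + (l + e + k) = d + e + k by omega] at this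


/-! ### Rooted subtrees and their polynomials -/

section

variable {V : Type*} [DecidableEq V]

/-- `Rooted G U r f`: the vertex set `U` induces a subtree of `G`, and `f` is the polynomial of this
tree with root `r`. It is `1` for a single vertex, and attaching a tree with polynomial `g` to the
root by an edge multiplies it by `edgeOp g`. -/
inductive Rooted (G : SimpleGraph V) : Finset V → V → ℚ[X][X] → Prop
  | single (r : V) : Rooted G {r} r 1
  | graft {U W : Finset V} {r w : V} {f g : ℚ[X][X]} : Rooted G U r f → Rooted G W w g →
      Disjoint U W → G.Adj r w → (∀ x ∈ U, ∀ y ∈ W, G.Adj x y → x = r ∧ y = w) →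
      Rooted G (U ∪ W) r (f * edgeOp g)

theorem edgeOp_C_mul (a : ℚ[X]) (f : ℚ[X][X]) : edgeOp (C a * f) = C a * edgeOp f := by
  rw [← smul_eq_C_mul, map_smul, smul_eq_C_mul]

theorem connected_induce_union_of_adj {V : Type*} {G : SimpleGraph V} {S T : Set V} {r w : V}
    (hS : (G.induce S).Connected) (hT : (G.induce T).Connected) (hr : r ∈ S) (hw : w ∈ T)
    (h : G.Adj r w) : (G.induce (S ∪ T)).Connected := by
  have h1 := SimpleGraph.induce_union_connected hS.preconnected
    (SimpleGraph.induce_pair_connected_of_adj h).preconnected ⟨r, hr, by simp⟩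
  have h2 := SimpleGraph.induce_union_connected h1.preconnected hT.preconnected
    ⟨w, by simp, hw⟩
  have e : S ∪ {r, w} ∪ T = S ∪ T := by
    ext x
    simp only [Set.mem_union, Set.mem_insert_iff, Set.mem_singleton_iff]
    constructor
    · rintro ((hx | rfl | rfl) | hx) <;> simp_all
    · rintro (hx | hx) <;> simp_all
  rwa [e] at h2

namespace Rooted

variable {G : SimpleGraph V} {U W : Finset V} {r w : V} {f g : ℚ[X][X]}

theorem root_mem (h : Rooted G U r f) : r ∈ U := by
  induction h with
  | single r => exact Finset.mem_singleton_self r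
  | graft _ _ _ _ _ ih _ => exact Finset.mem_union_left _ ih

theorem connected (h : Rooted G U r f) : (G.induce (U : Set V)).Connected := by
  induction h with
  | single r =>
    rw [Finset.coe_singleton]
    exact SimpleGraph.Connected.of_subsingleton
  | graft hU hW _ hadj _ ih1 ih2 =>
    rw [Finset.coe_union]
    exact connected_induce_union_of_adj ih1 ih2 hU.root_mem hW.root_mem hadj

/-- The weight counts edges: a graft adds those of both parts and the connecting edge. -/
theorem mem_meixnerCone (h : Rooted G U r f) : f ∈ meixnerCone (U.card - 1) := by
  induction h with
  | single r => simpa using one_mem_meixnerCone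
  | @graft U W r w f g hU hW hd _ _ ih1 ih2 =>
    have h1 : 0 < U.card := Finset.card_pos.2 ⟨r, hU.root_mem⟩
    have h2 : 0 < W.card := Finset.card_pos.2 ⟨w, hW.root_mem⟩
    have := mul_mem_meixnerCone ih1 (edgeOp_mem_meixnerCone ih2)
    rw [Finset.card_union_of_disjoint hd]
    rwa [show U.card - 1 + (W.card - 1 + 1) = U.card + W.card - 1 by omega] at this

end Rooted

theorem sum_powerset_union_of_disjoint {M : Type*} [AddCommMonoid M] {U W : Finset V}
    (h : Disjoint U W) (φ : Finset V → M) :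
    ∑ A ∈ (U ∪ W).powerset, φ A = ∑ A ∈ U.powerset, ∑ B ∈ W.powerset, φ (A ∪ B) := by
  rw [← Finset.sum_product']
  refine Finset.sum_nbij' (fun A => (A ∩ U, A ∩ W)) (fun p => p.1 ∪ p.2) ?_ ?_ ?_ ?_ ?_
  · intro A _
    simp
  · rintro ⟨A, B⟩ hAB
    simp only [Finset.mem_product, Finset.mem_powerset] at hAB ⊢
    exact Finset.union_subset_union hAB.1 hAB.2
  · intro A hA
    rw [Finset.mem_powerset] at hA
    rw [← Finset.inter_union_distrib_left, Finset.inter_eq_left.2 hA]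
  · rintro ⟨A, B⟩ hAB
    simp only [Finset.mem_product, Finset.mem_powerset] at hAB
    rw [Finset.disjoint_left] at h
    ext x <;> simp only [Finset.mem_inter, Finset.mem_union] <;> grind
  · intro A hA
    rw [Finset.mem_powerset] at hA
    rw [← Finset.inter_union_distrib_left, Finset.inter_eq_left.2 hA]

/-! ### The h-polynomials of subtrees as removal invariants -/

/-- The properties which determine the `h`-polynomials of the graph associahedra of the induced
subgraphs of `G`. -/
structure IsRemovalInvariant (G : SimpleGraph V) (H : Finset V → ℚ[X]) : Prop where
  empty : H ∅ = 1
  union : ∀ U W : Finset V, Disjoint U W → (∀ x ∈ U, ∀ y ∈ W, ¬ G.Adj x y) → H (U ∪ W) = H U * H W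
  connected : ∀ U : Finset V, (G.induce (U : Set V)).Connected →
    ∑ A ∈ U.powerset, (X - 1) ^ (U \ A).card * H A = X * H U

namespace IsRemovalInvariant

variable {G : SimpleGraph V} {H : Finset V → ℚ[X]}

theorem card_union_sdiff_union {U W A B : Finset V} (h : Disjoint U W) (hA : A ⊆ U) (hB : B ⊆ W) :
    ((U ∪ W) \ (A ∪ B)).card = (U \ A).card + (W \ B).card := by
  rw [← Finset.card_union_of_disjoint
    (h.mono Finset.sdiff_subset Finset.sdiff_subset)]
  congr 1
  rw [Finset.disjoint_left] at h
  ext x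
  simp only [Finset.mem_sdiff, Finset.mem_union]
  have := @hA x
  have := @hB x
  have := @h x
  tauto

theorem sdiff_union_eq {U W A D E : Finset V} (h : Disjoint U W) (hA : A ⊆ U ∪ W) (hD : D ⊆ U)
    (hE : E ⊆ W) : A \ (D ∪ E) = (A ∩ U) \ D ∪ (A ∩ W) \ E := by
  rw [Finset.disjoint_left] at h
  ext x
  simp only [Finset.mem_union, Finset.mem_sdiff, Finset.mem_inter]
  constructor
  · rintro ⟨hx, hn⟩
    rcases Finset.mem_union.1 (hA hx) with hU | hW
    · exact Or.inl ⟨⟨hx, hU⟩, fun hd => hn (Or.inl hd)⟩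
    · exact Or.inr ⟨⟨hx, hW⟩, fun he => hn (Or.inr he)⟩
  · rintro (⟨⟨hx, hU⟩, hn⟩ | ⟨⟨hx, hW⟩, hn⟩)
    · exact ⟨hx, fun h' => h'.elim hn fun he => h hU (hE he)⟩
    · exact ⟨hx, fun h' => h'.elim (fun hd => h (hD hd) hW) hn⟩

/-- Once the root is removed the branches become independent. A branch `W` contributes `s H(W)` by
the removal identity, which is the value of `J g` at `m = 0`; the factor `s - 1` accounts for the
removed root. -/
theorem sum_notMem (hH : IsRemovalInvariant G H) {n : ℕ}
    (ih : ∀ U r f, Rooted G U r f → U.card < n → H U = bottomCoeff f)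
    {U : Finset V} {r : V} {f : ℚ[X][X]} (h : Rooted G U r f) (hn : U.card ≤ n) :
    ∑ A ∈ U.powerset, (if r ∈ A then 0 else (X - 1) ^ (U \ A).card * H A) =
      (X - 1) * evalZero f := by
  induction h with
  | single r =>
    rw [← insert_empty_eq, Finset.sum_powerset_insert (Finset.notMem_empty r)]
    simp [hH.empty]
  | @graft U W r w f g hU hW hd hadj hedge ih1 _ =>
    have hUr : 0 < U.card := Finset.card_pos.2 ⟨r, hU.root_mem⟩
    rw [Finset.card_union_of_disjoint hd] at hn
    have hrW : r ∉ W := Finset.disjoint_left.1 hd hU.root_mem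
    rw [sum_powerset_union_of_disjoint hd, map_mul, evalZero_edgeOp,
      ← ih W w g hW (by omega), ← mul_assoc, ← ih1 (by omega),
      ← hH.connected W hW.connected, Finset.sum_mul_sum]
    refine Finset.sum_congr rfl fun A hA => Finset.sum_congr rfl fun B hB => ?_
    rw [Finset.mem_powerset] at hA hB
    have hrB : r ∉ B := fun h => hrW (hB h)
    by_cases hrA : r ∈ A
    · simp [hrA]
    · have hH' : H (A ∪ B) = H A * H B := by
        refine hH.union A B (hd.mono hA hB) fun x hx y hy hxy => ?_
        exact hrA ((hedge x (hA hx) y (hB hy) hxy).1 ▸ hx)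
      simp only [Finset.mem_union, hrA, hrB, or_self, if_false]
      rw [card_union_sdiff_union hd hA hB, hH', pow_add]
      ring

/-- Here `D` is the component of the root in `A`, and `θ A` is its polynomial times the invariant of
the rest. A branch whose root `w` is kept contributes `J` of its own `θ`, and one whose root is
removed contributes a constant; these are the two terms of `shiftHom_edgeOp`. -/
theorem exists_component (hH : IsRemovalInvariant G H) {n : ℕ}
    (ih : ∀ U r f, Rooted G U r f → U.card < n → H U = bottomCoeff f)
    {U : Finset V} {r : V} {f : ℚ[X][X]} (h : Rooted G U r f) (hn : U.card ≤ n) :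
    ∃ θ : Finset V → ℚ[X][X], θ U = f ∧
      (∀ A ⊆ U, r ∈ A → ∃ D ⊆ A, ∃ fD, Rooted G D r fD ∧ (∀ x ∈ D, ∀ y ∈ A \ D, ¬ G.Adj x y) ∧
        θ A = C (H (A \ D)) * fD) ∧
      ∑ A ∈ U.powerset, (if r ∈ A then C ((X - 1) ^ (U \ A).card) * θ A else 0) = shiftHom f := by
  induction h with
  | single r =>
    refine ⟨fun _ => 1, rfl, fun A hA hr => ?_, ?_⟩
    · have : A = {r} := Finset.Subset.antisymm hA (by simpa using hr)
      subst this
      exact ⟨{r}, subset_rfl, 1, Rooted.single r, by simp, by simp [hH.empty]⟩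
    · rw [← insert_empty_eq, Finset.sum_powerset_insert (Finset.notMem_empty r)]
      simp
  | @graft U W r w f g hU hW hd hadj hedge ih1 ih2 =>
    have hUr : 0 < U.card := Finset.card_pos.2 ⟨r, hU.root_mem⟩
    rw [Finset.card_union_of_disjoint hd] at hn
    have hrW : r ∉ W := Finset.disjoint_left.1 hd hU.root_mem
    have hwU : w ∉ U := Finset.disjoint_right.1 hd hW.root_mem
    obtain ⟨θ₁, h1, hc1, hs1⟩ := ih1 (by omega)
    obtain ⟨θ₂, h2, hc2, hs2⟩ := ih2 (by omega)
    have hs2' := hH.sum_notMem ih hW (by omega)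
    have interU : ∀ {A B : Finset V}, A ⊆ U → B ⊆ W → (A ∪ B) ∩ U = A := by
      intro A B hA hB
      rw [Finset.disjoint_left] at hd
      ext x; simp only [Finset.mem_inter, Finset.mem_union]; grind
    have interW : ∀ {A B : Finset V}, A ⊆ U → B ⊆ W → (A ∪ B) ∩ W = B := by
      intro A B hA hB
      rw [Finset.disjoint_left] at hd
      ext x; simp only [Finset.mem_inter, Finset.mem_union]; grind
    refine ⟨fun A => θ₁ (A ∩ U) * (if w ∈ A then edgeOp (θ₂ (A ∩ W)) else C (H (A ∩ W))),
      ?_, ?_, ?_⟩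
    · simp only [Finset.mem_union, hW.root_mem, or_true, if_true]
      rw [interU subset_rfl subset_rfl, interW subset_rfl subset_rfl, h1, h2]
    · intro A hA hr
      obtain ⟨D₁, hD₁, f₁, hR₁, hE₁, hθ₁⟩ := hc1 (A ∩ U) Finset.inter_subset_right
        (Finset.mem_inter.2 ⟨hr, hU.root_mem⟩)
      have hD₁U : D₁ ⊆ U := hD₁.trans Finset.inter_subset_right
      have hAx : ∀ x ∈ A, x ∈ U ∨ x ∈ W := fun x hx => Finset.mem_union.1 (hA hx)
      have hdx : ∀ x ∈ U, x ∉ W := fun x hx => Finset.disjoint_left.1 hd hx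
      have hrD₁ := hR₁.root_mem
      by_cases hw : w ∈ A
      · obtain ⟨D₂, hD₂, f₂, hR₂, hE₂, hθ₂⟩ := hc2 (A ∩ W) Finset.inter_subset_right
          (Finset.mem_inter.2 ⟨hw, hW.root_mem⟩)
        have hD₂W : D₂ ⊆ W := hD₂.trans Finset.inter_subset_right
        have hwD₂ := hR₂.root_mem
        refine ⟨D₁ ∪ D₂, Finset.union_subset (hD₁.trans Finset.inter_subset_left)
          (hD₂.trans Finset.inter_subset_left), f₁ * edgeOp f₂,
          Rooted.graft hR₁ hR₂ (hd.mono hD₁U hD₂W) hadj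
            (fun x hx y hy => hedge x (hD₁U hx) y (hD₂W hy)), ?_, ?_⟩
        · intro x hx y hy hxy
          simp only [Finset.mem_union, Finset.mem_sdiff, Finset.mem_inter] at hx hy hE₁ hE₂
          have hxy' := hxy.symm
          rcases hx with hx | hx <;> rcases hAx y hy.1 with hyU | hyW
          · exact hE₁ x hx y ⟨⟨hy.1, hyU⟩, fun h => hy.2 (Or.inl h)⟩ hxy
          · have := (hedge x (hD₁U hx) y hyW hxy).2
            subst this
            exact hy.2 (Or.inr hwD₂)
          · have := (hedge y hyU x (hD₂W hx) hxy').1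
            subst this
            exact hy.2 (Or.inl hrD₁)
          · exact hE₂ x hx y ⟨⟨hy.1, hyW⟩, fun h => hy.2 (Or.inr h)⟩ hxy
        · have e := sdiff_union_eq hd hA hD₁U hD₂W
          have hH' : H (A \ (D₁ ∪ D₂)) = H ((A ∩ U) \ D₁) * H ((A ∩ W) \ D₂) := by
            rw [e]
            refine hH.union _ _ (hd.mono (Finset.sdiff_subset.trans Finset.inter_subset_right)
              (Finset.sdiff_subset.trans Finset.inter_subset_right)) fun x hx y hy hxy => ?_
            simp only [Finset.mem_sdiff, Finset.mem_inter] at hx hy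
            have := (hedge x hx.1.2 y hy.1.2 hxy).1
            subst this
            exact hx.2 hrD₁
          beta_reduce
          rw [if_pos hw, hθ₁, hθ₂, hH', edgeOp_C_mul, C_mul]
          ring
      · refine ⟨D₁, hD₁.trans Finset.inter_subset_left, f₁, hR₁, ?_, ?_⟩
        · intro x hx y hy hxy
          simp only [Finset.mem_sdiff, Finset.mem_inter] at hy hE₁
          rcases hAx y hy.1 with hyU | hyW
          · exact hE₁ x hx y ⟨⟨hy.1, hyU⟩, hy.2⟩ hxy
          · have := (hedge x (hD₁U hx) y hyW hxy).2
            subst this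
            exact hw hy.1
        · have e : A \ D₁ = (A ∩ U) \ D₁ ∪ A ∩ W := by
            simpa using sdiff_union_eq hd hA hD₁U (Finset.empty_subset W)
          have hH' : H (A \ D₁) = H ((A ∩ U) \ D₁) * H (A ∩ W) := by
            rw [e]
            refine hH.union _ _ (hd.mono (Finset.sdiff_subset.trans Finset.inter_subset_right)
              Finset.inter_subset_right) fun x hx y hy hxy => ?_
            simp only [Finset.mem_sdiff, Finset.mem_inter] at hx hy
            have := (hedge x hx.1.2 y hy.2 hxy).1
            subst this
            exact hx.2 hrD₁
          beta_reduce
          rw [if_neg hw, hθ₁, hH', C_mul]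
          ring
    · rw [map_mul, shiftHom_edgeOp, ← hs2', ← hs2, ← hs1, sum_powerset_union_of_disjoint hd]
      have e2 : C (∑ A ∈ W.powerset, if w ∈ A then 0 else (X - 1) ^ (W \ A).card * H A) +
          edgeOp (∑ A ∈ W.powerset, if w ∈ A then C ((X - 1) ^ (W \ A).card) * θ₂ A else 0) =
          ∑ B ∈ W.powerset, C ((X - 1) ^ (W \ B).card) *
            (if w ∈ B then edgeOp (θ₂ B) else C (H B)) := by
        rw [map_sum, map_sum, ← Finset.sum_add_distrib]
        refine Finset.sum_congr rfl fun B _ => ?_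
        split_ifs
        · rw [C_0, zero_add, edgeOp_C_mul]
        · rw [map_zero, add_zero, C_mul]
      rw [e2, Finset.sum_mul_sum]
      refine Finset.sum_congr rfl fun A hA => Finset.sum_congr rfl fun B hB => ?_
      rw [Finset.mem_powerset] at hA hB
      have hrB : r ∉ B := fun h => hrW (hB h)
      have hwA : w ∉ A := fun h => hwU (hA h)
      simp only [Finset.mem_union, hrB, or_false, hwA, false_or]
      rw [interU hA hB, interW hA hB, card_union_sdiff_union hd hA hB, pow_add, C_mul]
      split_ifs <;> ring

/-- A removal invariant of a tree is the bottom coefficient of the polynomial of the tree. -/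
theorem eq_bottomCoeff (hH : IsRemovalInvariant G H) {U : Finset V} {r : V} {f : ℚ[X][X]}
    (h : Rooted G U r f) : H U = bottomCoeff f := by
  generalize hn : U.card = n
  induction n using Nat.strong_induction_on generalizing U r f with
  | _ n ih =>
    have ih' : ∀ U r f, Rooted G U r f → U.card < n → H U = bottomCoeff f :=
      fun U r f h hU => ih _ hU h rfl
    obtain ⟨θ, hθ, hcomp, hsum⟩ := hH.exists_component ih' h hn.le
    have hsum' := hH.sum_notMem ih' h hn.le
    have hconn := hH.connected U h.connected
    -- For `A ≠ U` containing the root, the root component is smaller than `U` and the induction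
    -- hypothesis applies. For `A = U` the equality is still unknown, so its defect is kept as a
    -- separate term.
    have hA : ∀ A ∈ U.powerset, (X - 1) ^ (U \ A).card * H A =
        (if r ∈ A then 0 else (X - 1) ^ (U \ A).card * H A)
        + bottomCoeff (if r ∈ A then C ((X - 1) ^ (U \ A).card) * θ A else 0)
        + (if A = U then H U - bottomCoeff f else 0) := by
      intro A hA
      rw [Finset.mem_powerset] at hA
      by_cases hAU : A = U
      · subst hAU
        simp [h.root_mem, hθ]
      by_cases hr : r ∈ A
      · obtain ⟨D, hD, fD, hR, hE, hθA⟩ := hcomp A hA hr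
        have hlt : D.card < n := by
          rw [← hn]
          exact Finset.card_lt_card (lt_of_le_of_lt hD (lt_of_le_of_ne hA hAU))
        have hHA : H A = H D * H (A \ D) := by
          rw [← hH.union D (A \ D) Finset.disjoint_sdiff hE, Finset.union_sdiff_of_subset hD]
        rw [if_pos hr, if_pos hr, if_neg hAU, ← smul_eq_C_mul, map_smul, hθA, ← smul_eq_C_mul,
          map_smul, hHA, ih' D r fD hR hlt]
        simp only [smul_eq_mul]
        ring
      · simp [hr, hAU]
    rw [Finset.sum_congr rfl hA, Finset.sum_add_distrib, Finset.sum_add_distrib, hsum', ← map_sum,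
      hsum, Finset.sum_ite_eq' , if_pos (Finset.mem_powerset_self U)] at hconn
    -- Comparison with this identity leaves `(s-1) H(U) = (s-1) Λ(f)`.
    have hΛ := smul_bottomCoeff f
    have h1 : (X - 1 : ℚ[X]) ≠ 0 := by simpa using X_sub_C_ne_zero (1 : ℚ)
    apply mul_left_cancel₀ h1
    linear_combination -hconn - hΛ

end IsRemovalInvariant

end


/-! ### The faces of a nestohedron -/

section Nestohedron

variable {V : Type*}

/-- The elements of `I` at which `w` is maximal. -/
noncomputable def argmax (w : V → ℝ) (I : Finset V) : Finset V :=
  {i ∈ I | ∀ j ∈ I, w j ≤ w i}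

theorem mem_argmax {w : V → ℝ} {I : Finset V} {i : V} :
    i ∈ argmax w I ↔ i ∈ I ∧ ∀ j ∈ I, w j ≤ w i := by
  simp [argmax]

theorem argmax_subset (w : V → ℝ) (I : Finset V) : argmax w I ⊆ I := Finset.filter_subset _ _

theorem argmax_nonempty (w : V → ℝ) {I : Finset V} (h : I.Nonempty) : (argmax w I).Nonempty := by
  obtain ⟨i, hi, h⟩ := I.exists_max_image w h
  exact ⟨i, mem_argmax.2 ⟨hi, h⟩⟩

variable [DecidableEq V]

theorem simplex_mono {I J : Finset V} (h : I ⊆ J) : simplex I ⊆ simplex J :=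
  convexHull_mono (Set.image_mono (Finset.coe_subset.2 h))

variable {B : BuildingSet V}

theorem exists_mem_argmax [Nonempty V] (B : BuildingSet V) (w : V → ℝ) :
    ∃ a : Finset V → V, ∀ I ∈ B.sets, a I ∈ argmax w I := by
  have : ∀ I : Finset V, ∃ a : V, I ∈ B.sets → a ∈ argmax w I := by
    intro I
    by_cases hI : I ∈ B.sets
    · obtain ⟨a, ha⟩ := argmax_nonempty w (B.nonempty_of_mem I hI)
      exact ⟨a, fun _ => ha⟩
    · exact ⟨Classical.arbitrary V, fun h => absurd h hI⟩
  choose a ha using this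
  exact ⟨a, ha⟩

open scoped Pointwise in
/-- The Minkowski sum of the simplices `Δ_{α I}`, `I ∈ B`. -/
def faceSum (B : BuildingSet V) (α : Finset V → Finset V) : Set (V → ℝ) :=
  ∑ I ∈ B.sets, simplex (α I)

open scoped Pointwise in
theorem mem_faceSum {α : Finset V → Finset V} {x : V → ℝ} : x ∈ faceSum B α ↔
    ∃ g : Finset V → V → ℝ, (∀ I ∈ B.sets, g I ∈ simplex (α I)) ∧ ∑ I ∈ B.sets, g I = x := by
  rw [faceSum, Set.mem_finsetSum]
  constructor
  · rintro ⟨g, hg, h⟩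
    exact ⟨g, fun I hI => hg hI, h⟩
  · rintro ⟨g, hg, h⟩
    exact ⟨g, fun {I} hI => hg I hI, h⟩

theorem mem_nestohedron {x : V → ℝ} : x ∈ nestohedron B ↔
    ∃ g : Finset V → V → ℝ, (∀ I ∈ B.sets, g I ∈ simplex I) ∧ ∑ I ∈ B.sets, g I = x :=
  mem_faceSum (α := id)

open scoped Pointwise in
theorem faceSum_congr {α β : Finset V → Finset V} (h : ∀ I ∈ B.sets, α I = β I) :
    faceSum B α = faceSum B β :=
  Finset.sum_congr rfl fun I hI => by rw [h I hI]

variable [Fintype V]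

theorem mem_simplex {I : Finset V} {x : V → ℝ} :
    x ∈ simplex I ↔ (∀ i, 0 ≤ x i) ∧ (∀ i ∉ I, x i = 0) ∧ ∑ i, x i = 1 := by
  constructor
  · intro hx
    have hc : Convex ℝ {x : V → ℝ | (∀ i, 0 ≤ x i) ∧ (∀ i ∉ I, x i = 0) ∧ ∑ i, x i = 1} := by
      rintro x ⟨hx0, hxI, hx1⟩ y ⟨hy0, hyI, hy1⟩ a b ha hb hab
      refine ⟨fun i => ?_, fun i hi => ?_, ?_⟩
      · simp only [Pi.add_apply, Pi.smul_apply, smul_eq_mul]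
        have := hx0 i; have := hy0 i
        positivity
      · simp [hxI i hi, hyI i hi]
      · simp only [Pi.add_apply, Pi.smul_apply, smul_eq_mul]
        rw [Finset.sum_add_distrib, ← Finset.mul_sum, ← Finset.mul_sum, hx1, hy1, mul_one, mul_one,
          hab]
    refine convexHull_min ?_ hc hx
    rintro _ ⟨i, hi, rfl⟩
    refine ⟨fun j => ?_, fun j hj => ?_, ?_⟩
    · by_cases h : j = i
      · subst h; simp
      · simp [h]
    · have : j ≠ i := fun h => hj (h ▸ hi)
      simp [this]
    · simp
  · rintro ⟨h0, hI, h1⟩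
    have hx : x = ∑ i ∈ I, x i • (Pi.single i 1 : V → ℝ) := by
      ext j
      rw [Finset.sum_apply]
      simp only [Pi.smul_apply, Pi.single_apply, smul_eq_mul, mul_ite, mul_one, mul_zero,
        Finset.sum_ite_eq]
      split_ifs with hj
      · rfl
      · exact hI j hj
    rw [hx]
    refine (convex_convexHull ℝ _).sum_mem (fun i _ => h0 i) ?_
      fun i hi => subset_convexHull ℝ _ ⟨i, hi, rfl⟩
    rw [← h1]
    exact Finset.sum_subset (Finset.subset_univ I) fun i _ hi => hI i hi

theorem single_mem_simplex {I : Finset V} {i : V} : (Pi.single i 1 : V → ℝ) ∈ simplex I ↔ i ∈ I := by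
  constructor
  · intro h
    by_contra hi
    have := (mem_simplex.1 h).2.1 i hi
    simp at this
  · intro h
    exact subset_convexHull ℝ _ ⟨i, h, rfl⟩

/-- The gap `w a - w ⬝ᵥ x` is the sum of the nonnegative terms `(w a - w i) x i`; it vanishes
exactly when `x` is supported where `w` is maximal. -/
theorem dotProduct_le_of_mem_simplex {w : V → ℝ} {I : Finset V} {a : V} (ha : a ∈ argmax w I)
    {x : V → ℝ} (hx : x ∈ simplex I) :
    w ⬝ᵥ x ≤ w a ∧ (w ⬝ᵥ x = w a ↔ x ∈ simplex (argmax w I)) := by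
  rw [mem_argmax] at ha
  obtain ⟨h0, hI, h1⟩ := mem_simplex.1 hx
  have hterm : ∀ i ∈ Finset.univ, 0 ≤ (w a - w i) * x i := by
    intro i _
    by_cases hi : i ∈ I
    · exact mul_nonneg (sub_nonneg.2 (ha.2 i hi)) (h0 i)
    · rw [hI i hi, mul_zero]
  have hsum : ∑ i, (w a - w i) * x i = w a - w ⬝ᵥ x := by
    simp only [sub_mul, Finset.sum_sub_distrib, ← Finset.mul_sum, h1, mul_one, dotProduct]
  refine ⟨by linarith [Finset.sum_nonneg hterm], ?_⟩
  rw [eq_comm, ← sub_eq_zero, ← hsum, Finset.sum_eq_zero_iff_of_nonneg hterm, mem_simplex]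
  constructor
  · intro h
    refine ⟨h0, fun i hi => ?_, h1⟩
    by_cases hiI : i ∈ I
    · rcases mul_eq_zero.1 (h i (Finset.mem_univ i)) with h | h
      · refine absurd (mem_argmax.2 ⟨hiI, fun j hj => ?_⟩) hi
        rw [← sub_eq_zero.1 h]
        exact ha.2 j hj
      · exact h
    · exact hI i hiI
  · rintro ⟨_, h, _⟩ i _
    by_cases hi : i ∈ argmax w I
    · rw [mem_argmax] at hi
      rw [le_antisymm (ha.2 i hi.1) (hi.2 a ha.1), sub_self, zero_mul]
    · rw [h i hi, mul_zero]

/-! ### Faces as maximizer sets of linear functionals -/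

section Maximum

variable {w : V → ℝ} {a : Finset V → V}

theorem dotProduct_sum_le (ha : ∀ I ∈ B.sets, a I ∈ argmax w I) {g : Finset V → V → ℝ}
    (hg : ∀ I ∈ B.sets, g I ∈ simplex I) :
    w ⬝ᵥ ∑ I ∈ B.sets, g I ≤ ∑ I ∈ B.sets, w (a I) ∧
    (w ⬝ᵥ ∑ I ∈ B.sets, g I = ∑ I ∈ B.sets, w (a I) ↔
      ∀ I ∈ B.sets, g I ∈ simplex (argmax w I)) := by
  have hle : ∀ I ∈ B.sets, w ⬝ᵥ g I ≤ w (a I) := fun I hI =>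
    (dotProduct_le_of_mem_simplex (ha I hI) (hg I hI)).1
  rw [dotProduct_sum]
  refine ⟨Finset.sum_le_sum hle, ?_⟩
  rw [Finset.sum_eq_sum_iff_of_le hle]
  exact forall₂_congr fun I hI => (dotProduct_le_of_mem_simplex (ha I hI) (hg I hI)).2

theorem sum_single_mem_faceSum (ha : ∀ I ∈ B.sets, a I ∈ argmax w I) :
    ∑ I ∈ B.sets, (Pi.single (a I) 1 : V → ℝ) ∈ faceSum B (argmax w) :=
  mem_faceSum.2 ⟨_, fun I hI => single_mem_simplex.2 (ha I hI), rfl⟩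

theorem maximizers_nestohedron [Nonempty V] (B : BuildingSet V) (w : V → ℝ) :
    {x ∈ nestohedron B | ∀ y ∈ nestohedron B, w ⬝ᵥ y ≤ w ⬝ᵥ x} = faceSum B (argmax w) := by
  obtain ⟨a, ha⟩ := exists_mem_argmax B w
  ext x
  constructor
  · rintro ⟨hx, hmax⟩
    obtain ⟨g, hg, rfl⟩ := mem_nestohedron.1 hx
    have h1 : ∀ I ∈ B.sets, (Pi.single (a I) 1 : V → ℝ) ∈ simplex (argmax w I) :=
      fun I hI => single_mem_simplex.2 (ha I hI)
    have h2 : ∀ I ∈ B.sets, (Pi.single (a I) 1 : V → ℝ) ∈ simplex I :=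
      fun I hI => simplex_mono (argmax_subset w I) (h1 I hI)
    have h3 := hmax _ (mem_nestohedron.2 ⟨_, h2, rfl⟩)
    rw [(dotProduct_sum_le ha h2).2.2 h1] at h3
    exact mem_faceSum.2 ⟨g, (dotProduct_sum_le ha hg).2.1
      (le_antisymm (dotProduct_sum_le ha hg).1 h3), rfl⟩
  · intro hx
    obtain ⟨g, hg, rfl⟩ := mem_faceSum.1 hx
    have hg' : ∀ I ∈ B.sets, g I ∈ simplex I :=
      fun I hI => simplex_mono (argmax_subset w I) (hg I hI)
    refine ⟨mem_nestohedron.2 ⟨g, hg', rfl⟩, fun y hy => ?_⟩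
    obtain ⟨g', hg'', rfl⟩ := mem_nestohedron.1 hy
    rw [(dotProduct_sum_le ha hg').2.2 hg]
    exact (dotProduct_sum_le ha hg'').1

theorem mem_simplex_argmax_of_sum_mem [Nonempty V] {g : Finset V → V → ℝ}
    (hg : ∀ I ∈ B.sets, g I ∈ simplex I) (h : ∑ I ∈ B.sets, g I ∈ faceSum B (argmax w)) :
    ∀ I ∈ B.sets, g I ∈ simplex (argmax w I) := by
  obtain ⟨a, ha⟩ := exists_mem_argmax B w
  obtain ⟨g', hg', e⟩ := mem_faceSum.1 h
  rw [← (dotProduct_sum_le ha hg).2, ← e]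
  exact (dotProduct_sum_le ha fun I hI => simplex_mono (argmax_subset w I) (hg' I hI)).2.2 hg'

/-- A face determines its summands: place `e_i` in the summand of `I` and any maximizing vertices
elsewhere. The total is optimal for `w'` only if every summand is. -/
theorem argmax_subset_of_faceSum_subset [Nonempty V] {w' : V → ℝ}
    (h : faceSum B (argmax w) ⊆ faceSum B (argmax w')) {I : Finset V} (hI : I ∈ B.sets) :
    argmax w I ⊆ argmax w' I := by
  obtain ⟨a, ha⟩ := exists_mem_argmax B w
  intro i hi
  have ha' : ∀ J ∈ B.sets, Function.update a I i J ∈ argmax w J := by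
    intro J hJ
    by_cases hIJ : J = I
    · subst hIJ; rwa [Function.update_self]
    · rw [Function.update_of_ne hIJ]; exact ha J hJ
  have := mem_simplex_argmax_of_sum_mem
    (fun J hJ => single_mem_simplex.2 (argmax_subset w J (ha' J hJ)))
    (h (sum_single_mem_faceSum ha')) I hI
  rwa [single_mem_simplex, Function.update_self] at this

theorem mem_faces_nestohedron [Nonempty V] {F : Set (V → ℝ)} :
    F ∈ faces (nestohedron B) ↔ ∃ w : V → ℝ, F = faceSum B (argmax w) := by
  constructor
  · rintro ⟨hF, hexp⟩
    obtain ⟨l, rfl⟩ := hexp hF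
    have hl : ∀ x, l x = (fun i => l (Pi.single i 1)) ⬝ᵥ x := by
      intro x
      conv_lhs => rw [← Finset.univ_sum_single x, map_sum]
      refine Finset.sum_congr rfl fun i _ => ?_
      rw [mul_comm, ← smul_eq_mul, ← map_smul, ← Pi.single_smul, smul_eq_mul, mul_one]
    refine ⟨fun i => l (Pi.single i 1), ?_⟩
    rw [← maximizers_nestohedron]
    simp only [← hl]
  · rintro ⟨w, rfl⟩
    obtain ⟨a, ha⟩ := exists_mem_argmax B w
    refine ⟨⟨_, sum_single_mem_faceSum ha⟩, fun _ => ?_⟩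
    refine ⟨LinearMap.toContinuousLinearMap (dotProductBilin ℝ ℝ w), ?_⟩
    rw [← maximizers_nestohedron]
    rfl

end Maximum

/-- The span of the differences of the coordinate vectors with indices in a common set `α I`. -/
def dirSpan (α : Finset V → Finset V) : Submodule ℝ (V → ℝ) :=
  Submodule.span ℝ
    {x | ∃ I, ∃ i ∈ α I, ∃ j ∈ α I, x = (Pi.single i 1 : V → ℝ) - Pi.single j 1}

/-- The coordinates of `x` and `y` are probability weights, and averaging `e_i - e_j` over the
product weights gives `x - y`. -/
theorem sub_mem_dirSpan {α : Finset V → Finset V} {I : Finset V} {x y : V → ℝ}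
    (hx : x ∈ simplex (α I)) (hy : y ∈ simplex (α I)) : x - y ∈ dirSpan α := by
  obtain ⟨hx0, hxI, hx1⟩ := mem_simplex.1 hx
  obtain ⟨hy0, hyI, hy1⟩ := mem_simplex.1 hy
  have e : x - y = ∑ i, ∑ j, (x i * y j) • ((Pi.single i 1 : V → ℝ) - Pi.single j 1) := by
    simp only [smul_sub, Finset.sum_sub_distrib]
    congr 1
    · simp only [← Finset.sum_smul, ← Finset.mul_sum, hy1, mul_one]
      ext i
      simp [Finset.sum_apply, Pi.single_apply]
    · rw [Finset.sum_comm]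
      simp only [← Finset.sum_smul, ← Finset.sum_mul, hx1, one_mul]
      ext i
      simp [Finset.sum_apply, Pi.single_apply]
  rw [e]
  refine Submodule.sum_mem _ fun i _ => Submodule.sum_mem _ fun j _ => ?_
  by_cases hi : i ∈ α I
  · by_cases hj : j ∈ α I
    · exact Submodule.smul_mem _ _ (Submodule.subset_span ⟨I, i, hi, j, hj, rfl⟩)
    · rw [hyI j hj, mul_zero, zero_smul]; exact zero_mem _
  · rw [hxI i hi, zero_mul, zero_smul]; exact zero_mem _

/-- Changing the vertex chosen in a single summand realizes each generator `e_i - e_j` as a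
difference of points. Since `dirSpan` ranges over all `I`, the map must be empty off the building
set. -/
theorem vectorSpan_faceSum {α : Finset V → Finset V} (h : ∀ I ∈ B.sets, (α I).Nonempty)
    (h' : ∀ I ∉ B.sets, α I = ∅) : vectorSpan ℝ (faceSum B α) = dirSpan α := by
  apply le_antisymm
  · rw [vectorSpan_def, Submodule.span_le]
    rintro _ ⟨x, hx, y, hy, rfl⟩
    obtain ⟨g, hg, rfl⟩ := mem_faceSum.1 hx
    obtain ⟨g', hg', rfl⟩ := mem_faceSum.1 hy
    simp only [vsub_eq_sub, ← Finset.sum_sub_distrib]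
    exact Submodule.sum_mem _ fun I hI => sub_mem_dirSpan (hg I hI) (hg' I hI)
  · rw [dirSpan, Submodule.span_le]
    rintro _ ⟨I, i, hi, j, hj, rfl⟩
    have hI : I ∈ B.sets := by
      by_contra hI
      rw [h' I hI] at hi
      exact Finset.notMem_empty i hi
    have : Nonempty V := ⟨i⟩
    have : ∀ J : Finset V, ∃ a : V, J ∈ B.sets → a ∈ α J := fun J => by
      by_cases hJ : J ∈ B.sets
      · exact ⟨(h J hJ).choose, fun _ => (h J hJ).choose_spec⟩
      · exact ⟨i, fun h => absurd h hJ⟩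
    choose a ha using this
    have hmem : ∀ k ∈ α I, ∑ J ∈ B.sets, (Pi.single (Function.update a I k J) 1 : V → ℝ) ∈
        faceSum B α := by
      intro k hk
      refine mem_faceSum.2 ⟨_, fun J hJ => single_mem_simplex.2 ?_, rfl⟩
      by_cases hIJ : J = I
      · subst hIJ; rwa [Function.update_self]
      · rw [Function.update_of_ne hIJ]; exact ha J hJ
    have := vsub_mem_vectorSpan ℝ (hmem i hi) (hmem j hj)
    rw [vsub_eq_sub, ← Finset.sum_sub_distrib, Finset.sum_eq_single I] at this
    · rwa [Function.update_self, Function.update_self] at this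
    · intro J _ hJ
      rw [Function.update_of_ne hJ, Function.update_of_ne hJ, sub_self]
    · exact fun h => absurd hI h

end Nestohedron


/-! ### Face polynomials of induced subgraphs -/

section FacePoly

variable {V : Type*}

theorem argmax_congr {w w' : V → ℝ} {I : Finset V} (h : ∀ i ∈ I, w i = w' i) :
    argmax w I = argmax w' I := by
  ext i
  simp only [mem_argmax]
  constructor
  · rintro ⟨hi, hm⟩
    exact ⟨hi, fun j hj => by rw [← h i hi, ← h j hj]; exact hm j hj⟩
  · rintro ⟨hi, hm⟩
    exact ⟨hi, fun j hj => by rw [h i hi, h j hj]; exact hm j hj⟩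

variable [DecidableEq V]

/-- The restriction of `argmax w` to the elements of `B` which are contained in `U`. -/
noncomputable def restrArgmax (B : BuildingSet V) (U : Finset V) (w : V → ℝ) (I : Finset V) :
    Finset V :=
  -- The default `∅` makes the map depend only on its relevant values, so that each face is counted
  -- once and contributes no spurious directions.
  if I ∈ B.sets ∧ I ⊆ U then argmax w I else ∅

variable {B : BuildingSet V}

theorem restrArgmax_of_mem {U I : Finset V} {w : V → ℝ} (hI : I ∈ B.sets) (hU : I ⊆ U) :
    restrArgmax B U w I = argmax w I := if_pos ⟨hI, hU⟩

theorem restrArgmax_of_not {U I : Finset V} {w : V → ℝ} (h : ¬ (I ∈ B.sets ∧ I ⊆ U)) :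
    restrArgmax B U w I = ∅ := if_neg h

theorem restrArgmax_subset (U I : Finset V) (w : V → ℝ) : restrArgmax B U w I ⊆ I ∩ U := by
  unfold restrArgmax
  split_ifs with h
  · exact Finset.subset_inter (argmax_subset w I) ((argmax_subset w I).trans h.2)
  · exact Finset.empty_subset _

theorem restrArgmax_congr {U : Finset V} {w w' : V → ℝ} (h : ∀ i ∈ U, w i = w' i) :
    restrArgmax B U w = restrArgmax B U w' := by
  funext I
  unfold restrArgmax
  split_ifs with hI
  · exact argmax_congr fun i hi => h i (hI.2 hi)
  · rfl

theorem eq_zero_of_mem_dirSpan {α : Finset V → Finset V} {U : Finset V} (h : ∀ I, α I ⊆ U)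
    {x : V → ℝ} (hx : x ∈ dirSpan α) {i : V} (hi : i ∉ U) : x i = 0 := by
  have : dirSpan α ≤ LinearMap.ker (LinearMap.proj i : (V → ℝ) →ₗ[ℝ] ℝ) := by
    refine Submodule.span_le.2 ?_
    rintro _ ⟨I, j, hj, k, hk, rfl⟩
    have h1 : i ≠ j := fun e => hi (e ▸ h I hj)
    have h2 : i ≠ k := fun e => hi (e ▸ h I hk)
    simp [h1, h2]
  exact this hx

variable [Fintype V]

open Classical in
/-- The restrictions of the maps `argmax w`, for all functionals `w`, to the elements of `B` which
are contained in `U`. -/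
noncomputable def faceMaps (B : BuildingSet V) (U : Finset V) :
    Finset (Finset V → Finset V) :=
  {α | ∃ w : V → ℝ, α = restrArgmax B U w}

theorem mem_faceMaps {U : Finset V} {α : Finset V → Finset V} :
    α ∈ faceMaps B U ↔ ∃ w : V → ℝ, α = restrArgmax B U w := by
  simp [faceMaps]

theorem subset_of_mem_faceMaps {U : Finset V} {α : Finset V → Finset V} (h : α ∈ faceMaps B U)
    (I : Finset V) : α I ⊆ I ∩ U := by
  obtain ⟨w, rfl⟩ := mem_faceMaps.1 h
  exact restrArgmax_subset U I w

theorem eq_empty_of_mem_faceMaps {U : Finset V} {α : Finset V → Finset V} (h : α ∈ faceMaps B U)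
    {I : Finset V} (hI : ¬ (I ∈ B.sets ∧ I ⊆ U)) : α I = ∅ := by
  obtain ⟨w, rfl⟩ := mem_faceMaps.1 h
  exact restrArgmax_of_not hI

/-- The dimension of the face described by `α`. -/
noncomputable def faceDim (α : Finset V → Finset V) : ℕ := Module.finrank ℝ (dirSpan α)

/-- The face polynomial of the restriction of `B` to `U`. -/
noncomputable def facePoly (B : BuildingSet V) (U : Finset V) : ℤ[X] :=
  ∑ α ∈ faceMaps B U, X ^ faceDim α

theorem dim_faceSum {α : Finset V → Finset V} (h : α ∈ faceMaps B Finset.univ) :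
    dim (faceSum B α) = faceDim α := by
  obtain ⟨w, rfl⟩ := mem_faceMaps.1 h
  rw [dim, vectorSpan_faceSum, faceDim]
  · intro I hI
    rw [restrArgmax_of_mem hI (Finset.subset_univ I)]
    exact argmax_nonempty w (B.nonempty_of_mem I hI)
  · intro I hI
    exact restrArgmax_of_not fun h => hI h.1

theorem faceSum_restrArgmax_univ (w : V → ℝ) :
    faceSum B (restrArgmax B Finset.univ w) = faceSum B (argmax w) :=
  faceSum_congr fun I hI => restrArgmax_of_mem hI (Finset.subset_univ I)

theorem faces_nestohedron [Nonempty V] :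
    faces (nestohedron B) = faceSum B '' (faceMaps B Finset.univ : Set _) := by
  ext F
  rw [mem_faces_nestohedron]
  constructor
  · rintro ⟨w, rfl⟩
    exact ⟨_, mem_faceMaps.2 ⟨w, rfl⟩, faceSum_restrArgmax_univ w⟩
  · rintro ⟨α, hα, rfl⟩
    obtain ⟨w, rfl⟩ := mem_faceMaps.1 hα
    exact ⟨w, faceSum_restrArgmax_univ w⟩

theorem faceSum_injOn [Nonempty V] :
    Set.InjOn (faceSum B) (faceMaps B Finset.univ : Set (Finset V → Finset V)) := by
  intro α hα β hβ h
  obtain ⟨w, rfl⟩ := mem_faceMaps.1 hα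
  obtain ⟨w', rfl⟩ := mem_faceMaps.1 hβ
  rw [faceSum_restrArgmax_univ, faceSum_restrArgmax_univ] at h
  funext I
  unfold restrArgmax
  split_ifs with hI
  · exact (argmax_subset_of_faceSum_subset h.subset hI.1).antisymm
      (argmax_subset_of_faceSum_subset h.superset hI.1)
  · rfl

theorem faceDim_le_dim [Nonempty V] {α : Finset V → Finset V}
    (h : α ∈ faceMaps B Finset.univ) : faceDim α ≤ dim (nestohedron B) := by
  rw [← dim_faceSum h]
  have hF : faceSum B α ∈ faces (nestohedron B) := by
    rw [faces_nestohedron]; exact ⟨α, h, rfl⟩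
  exact Submodule.finrank_mono (vectorSpan_mono ℝ (hF.2.subset))

theorem fPolynomial_nestohedron [Nonempty V] (B : BuildingSet V) :
    fPolynomial (nestohedron B) = facePoly B Finset.univ := by
  classical
  rw [fPolynomial, facePoly, ← Finset.sum_fiberwise_of_maps_to (g := faceDim)
    (t := Finset.range (dim (nestohedron B) + 1))
    fun α hα => Finset.mem_range.2 (Nat.lt_succ_of_le (faceDim_le_dim hα))]
  refine Finset.sum_congr rfl fun i _ => ?_
  have e : {F ∈ faces (nestohedron B) | dim F = i} =
      faceSum B '' ((faceMaps B Finset.univ).filter fun α => faceDim α = i : Finset _) := by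
    rw [faces_nestohedron]
    ext F
    constructor
    · rintro ⟨⟨α, hα, rfl⟩, hF⟩
      exact ⟨α, Finset.mem_coe.2 (Finset.mem_filter.2 ⟨hα, (dim_faceSum hα).symm.trans hF⟩), rfl⟩
    · rintro ⟨α, hα, rfl⟩
      obtain ⟨hα, hF⟩ := Finset.mem_filter.1 (Finset.mem_coe.1 hα)
      exact ⟨⟨α, hα, rfl⟩, (dim_faceSum hα).trans hF⟩
  rw [e, Set.InjOn.ncard_image (faceSum_injOn.mono (Finset.coe_subset.2
    (Finset.filter_subset _ _))), Set.ncard_coe_finset, Finset.sum_congr rfl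
    fun α hα => by rw [(Finset.mem_filter.1 hα).2], Finset.sum_const, nsmul_eq_mul]
  simp

/-! ### Dimensions of spans of differences -/

theorem finrank_sup_of_disjoint_supports {S T : Submodule ℝ (V → ℝ)} {U W : Finset V}
    (h : Disjoint U W) (hS : ∀ x ∈ S, ∀ i ∉ U, x i = 0) (hT : ∀ x ∈ T, ∀ i ∉ W, x i = 0) :
    Module.finrank ℝ (S ⊔ T : Submodule ℝ (V → ℝ)) =
      Module.finrank ℝ S + Module.finrank ℝ T := by
  rw [← Submodule.finrank_sup_add_finrank_inf_eq, (Submodule.eq_bot_iff (S ⊓ T)).2, finrank_bot,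
    add_zero]
  intro x hx
  ext i
  by_cases hi : i ∈ U
  · exact hT x hx.2 i (Finset.disjoint_left.1 h hi)
  · exact hS x hx.1 i hi

theorem finrank_dirSpan_const {A : Finset V} (hA : A.Nonempty) :
    Module.finrank ℝ (dirSpan fun _ => A) + 1 = A.card := by
  have e : dirSpan (fun _ => A) =
      vectorSpan ℝ (A.image (fun i => (Pi.single i 1 : V → ℝ)) : Set (V → ℝ)) := by
    rw [dirSpan, vectorSpan_def]
    congr 1
    ext x
    simp only [Set.mem_ofPred_eq, Finset.coe_image, Set.mem_vsub, Set.mem_image, Finset.mem_coe]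
    constructor
    · rintro ⟨_, i, hi, j, hj, rfl⟩
      exact ⟨_, ⟨i, hi, rfl⟩, _, ⟨j, hj, rfl⟩, rfl⟩
    · rintro ⟨_, ⟨i, hi, rfl⟩, _, ⟨j, hj, rfl⟩, rfl⟩
      exact ⟨∅, i, hi, j, hj, rfl⟩
  have hind : AffineIndependent ℝ fun i : V => (Pi.single i 1 : V → ℝ) := by
    rw [affineIndependent_iff]
    intro s w _ h i hi
    have := congrFun h i
    rw [Finset.sum_apply] at this
    simpa [Pi.single_apply, hi] using this
  obtain ⟨n, hn⟩ := Nat.exists_eq_succ_of_ne_zero (Finset.card_pos.2 hA).ne'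
  rw [e, hind.finrank_vectorSpan_image_finset (n := n) hn, hn]

end FacePoly

/-! ### The recursion for the face polynomials of graph associahedra -/

section Recursion

variable {V : Type*} [DecidableEq V] {G : SimpleGraph V}

theorem subset_or_subset_of_connected {I U W : Finset V} (hI : (G.induce (I : Set V)).Connected)
    (h : I ⊆ U ∪ W) (hUW : ∀ x ∈ U, ∀ y ∈ W, ¬ G.Adj x y) :
    I ⊆ U ∨ I ⊆ W := by
  by_contra! hc
  obtain ⟨⟨x, hx, hxU⟩, ⟨y, hy, hyW⟩⟩ :=
    And.intro (Finset.not_subset.1 hc.1) (Finset.not_subset.1 hc.2)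
  obtain ⟨p⟩ := hI.preconnected ⟨y, hy⟩ ⟨x, hx⟩
  obtain ⟨d, _, h1, h2⟩ := p.exists_boundary_dart {z | (z : V) ∈ U}
    ((Finset.mem_union.1 (h hy)).resolve_right hyW) hxU
  exact hUW _ h1 _ ((Finset.mem_union.1 (h d.snd.2)).resolve_left h2) d.adj

/-- The face map of the connected set `U` with the value `A` at `U` and the face map `β` on
`U \ A`. -/
noncomputable def glue (B : BuildingSet V) (U A : Finset V) (β : Finset V → Finset V)
    (I : Finset V) : Finset V :=
  if I ∈ B.sets ∧ I ⊆ U then (if (I ∩ A).Nonempty then I ∩ A else β I) else ∅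

variable {B : BuildingSet V}

/-- A set meeting the top level `argmax w U` attains its maximum exactly there; a set avoiding it
lies in the complement, where the restricted map takes over. -/
theorem restrArgmax_eq_glue (U : Finset V) (w : V → ℝ) : restrArgmax B U w =
    glue B U (argmax w U) (restrArgmax B (U \ argmax w U) w) := by
  funext I
  unfold glue
  split_ifs with hI hA
  · rw [restrArgmax_of_mem hI.1 hI.2]
    obtain ⟨a, ha⟩ := hA
    rw [Finset.mem_inter, mem_argmax] at ha
    ext i
    simp only [Finset.mem_inter, mem_argmax]
    constructor
    · rintro ⟨hi, hm⟩
      exact ⟨hi, hI.2 hi, fun j hj => (ha.2.2 j hj).trans (hm a ha.1)⟩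
    · rintro ⟨hi, _, hm⟩
      exact ⟨hi, fun j hj => hm j (hI.2 hj)⟩
  · rw [restrArgmax_of_mem hI.1 hI.2, restrArgmax_of_mem hI.1]
    intro i hi
    exact Finset.mem_sdiff.2 ⟨hI.2 hi, fun hA' => hA ⟨i, Finset.mem_inter.2 ⟨hi, hA'⟩⟩⟩
  · exact restrArgmax_of_not hI

theorem glue_self {U A : Finset V} {β : Finset V → Finset V} (hU : U ∈ B.sets) (hA : A ⊆ U)
    (hne : A.Nonempty) : glue B U A β U = A := by
  rw [glue, if_pos ⟨hU, subset_rfl⟩, Finset.inter_eq_right.2 hA, if_pos hne]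

theorem glue_of_subset {U A I : Finset V} {β : Finset V → Finset V} (hI : I ∈ B.sets)
    (h : I ⊆ U \ A) : glue B U A β I = β I := by
  rw [glue, if_pos ⟨hI, h.trans Finset.sdiff_subset⟩, if_neg]
  rintro ⟨i, hi⟩
  rw [Finset.mem_inter] at hi
  exact (Finset.mem_sdiff.1 (h hi.1)).2 hi.2

variable [Fintype V]

theorem mem_graphical {I : Finset V} :
    I ∈ (graphical G).sets ↔ (G.induce (I : Set V)).Connected := by
  simp [graphical]

theorem facePoly_empty (B : BuildingSet V) : facePoly B ∅ = 1 := by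
  have h : faceMaps B ∅ = {fun _ => ∅} := by
    ext α
    rw [mem_faceMaps, Finset.mem_singleton]
    have : ∀ w, restrArgmax B ∅ w = fun _ => ∅ := fun w => by
      funext I
      exact Finset.subset_empty.1 ((restrArgmax_subset ∅ I w).trans Finset.inter_subset_right)
    simp [this]
  have h0 : dirSpan (fun _ : Finset V => (∅ : Finset V)) = ⊥ := by
    rw [dirSpan, Submodule.span_eq_bot]
    rintro _ ⟨_, i, hi, _⟩
    exact absurd hi (Finset.notMem_empty i)
  rw [facePoly, h, Finset.sum_singleton, faceDim, h0, finrank_bot, pow_zero]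

/-- Every connected subset of the union lies in exactly one part. Functionals on the two parts can
be chosen independently, and their direction spaces have disjoint supports, so dimensions add. -/
theorem facePoly_union {U W : Finset V} (hd : Disjoint U W)
    (hUW : ∀ x ∈ U, ∀ y ∈ W, ¬ G.Adj x y) :
    facePoly (graphical G) (U ∪ W) = facePoly (graphical G) U * facePoly (graphical G) W := by
  have hne : ∀ I ∈ (graphical G).sets, I ⊆ U → ¬ I ⊆ W := fun I hI hU hW => by
    obtain ⟨i, hi⟩ := (graphical G).nonempty_of_mem I hI
    exact Finset.disjoint_left.1 hd (hU hi) (hW hi)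
  have hglue : ∀ w, restrArgmax (graphical G) (U ∪ W) w =
      fun I => restrArgmax (graphical G) U w I ∪ restrArgmax (graphical G) W w I := by
    intro w
    funext I
    by_cases hI : I ∈ (graphical G).sets
    · by_cases hU : I ⊆ U
      · rw [restrArgmax_of_mem hI (hU.trans Finset.subset_union_left), restrArgmax_of_mem hI hU,
          restrArgmax_of_not fun h => hne I hI hU h.2, Finset.union_empty]
      · by_cases hW : I ⊆ W
        · rw [restrArgmax_of_mem hI (hW.trans Finset.subset_union_right), restrArgmax_of_mem hI hW,
            restrArgmax_of_not fun h => hU h.2, Finset.empty_union]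
        · rw [restrArgmax_of_not, restrArgmax_of_not fun h => hU h.2,
            restrArgmax_of_not fun h => hW h.2, Finset.empty_union]
          exact fun h => (subset_or_subset_of_connected (mem_graphical.1 hI) h.2 hUW).elim hU hW
    · rw [restrArgmax_of_not fun h => hI h.1, restrArgmax_of_not fun h => hI h.1,
        restrArgmax_of_not fun h => hI h.1, Finset.empty_union]
  rw [facePoly, facePoly, facePoly, Finset.sum_mul_sum, ← Finset.sum_product']
  symm
  refine Finset.sum_nbij (fun p I => p.1 I ∪ p.2 I) ?_ ?_ ?_ ?_
  · rintro ⟨α, β⟩ h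
    rw [Finset.mem_product] at h
    obtain ⟨w, hw⟩ := mem_faceMaps.1 h.1
    obtain ⟨w', hw'⟩ := mem_faceMaps.1 h.2
    dsimp only at hw hw' ⊢
    refine mem_faceMaps.2 ⟨fun i => if i ∈ U then w i else w' i, ?_⟩
    rw [hglue, hw, hw']
    funext I
    rw [restrArgmax_congr (w := fun i => if i ∈ U then w i else w' i) (w' := w)
      fun i hi => if_pos hi, restrArgmax_congr (w := fun i => if i ∈ U then w i else w' i) (w' := w')
      fun i hi => if_neg (Finset.disjoint_right.1 hd hi)]
  · rintro ⟨α, β⟩ h ⟨α', β'⟩ h' e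
    simp only [Finset.coe_product, Set.mem_prod, Finset.mem_coe] at h h'
    have e' : ∀ I, α I ∪ β I = α' I ∪ β' I := fun I => congrFun e I
    have hempty : ∀ {S : Finset V} {γ}, γ ∈ faceMaps (graphical G) S → ∀ I,
        ¬ (I ∈ (graphical G).sets ∧ I ⊆ S) → γ I = ∅ :=
      fun h I hI => eq_empty_of_mem_faceMaps h hI
    refine Prod.ext (funext fun I => ?_) (funext fun I => ?_)
    · by_cases hI : I ∈ (graphical G).sets ∧ I ⊆ U
      · have := e' I
        rwa [hempty h.2 I fun h => hne I hI.1 hI.2 h.2,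
          hempty h'.2 I fun h => hne I hI.1 hI.2 h.2, Finset.union_empty,
          Finset.union_empty] at this
      · exact (hempty h.1 I hI).trans (hempty h'.1 I hI).symm
    · by_cases hI : I ∈ (graphical G).sets ∧ I ⊆ W
      · have := e' I
        rwa [hempty h.1 I fun h => hne I hI.1 h.2 hI.2,
          hempty h'.1 I fun h => hne I hI.1 h.2 hI.2, Finset.empty_union,
          Finset.empty_union] at this
      · exact (hempty h.2 I hI).trans (hempty h'.2 I hI).symm
  · intro α hα
    obtain ⟨w, rfl⟩ := mem_faceMaps.1 (Finset.mem_coe.1 hα)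
    exact ⟨(_, _), Finset.mem_coe.2 (Finset.mem_product.2 ⟨mem_faceMaps.2 ⟨w, rfl⟩,
      mem_faceMaps.2 ⟨w, rfl⟩⟩), (hglue w).symm⟩
  · rintro ⟨α, β⟩ h
    rw [Finset.mem_product] at h
    dsimp only at h
    rw [← pow_add]
    congr 1
    have hsup : dirSpan (fun I => α I ∪ β I) = dirSpan α ⊔ dirSpan β := by
      rw [dirSpan, dirSpan, dirSpan, ← Submodule.span_union]
      congr 1
      ext x
      constructor
      · rintro ⟨I, i, hi, j, hj, rfl⟩
        by_cases hI : I ∈ (graphical G).sets ∧ I ⊆ U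
        · rw [eq_empty_of_mem_faceMaps h.2 fun h => hne I hI.1 hI.2 h.2,
            Finset.union_empty] at hi hj
          exact Or.inl ⟨I, i, hi, j, hj, rfl⟩
        · rw [eq_empty_of_mem_faceMaps h.1 hI, Finset.empty_union] at hi hj
          exact Or.inr ⟨I, i, hi, j, hj, rfl⟩
      · rintro (⟨I, i, hi, j, hj, rfl⟩ | ⟨I, i, hi, j, hj, rfl⟩)
        · exact ⟨I, i, Finset.mem_union_left _ hi, j, Finset.mem_union_left _ hj, rfl⟩
        · exact ⟨I, i, Finset.mem_union_right _ hi, j, Finset.mem_union_right _ hj, rfl⟩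
    rw [faceDim, faceDim, faceDim, hsup]
    refine (finrank_sup_of_disjoint_supports hd ?_ ?_).symm
    · exact fun x hx i hi => eq_zero_of_mem_dirSpan
        (fun I => (subset_of_mem_faceMaps h.1 I).trans Finset.inter_subset_right) hx hi
    · exact fun x hx i hi => eq_zero_of_mem_dirSpan
        (fun I => (subset_of_mem_faceMaps h.2 I).trans Finset.inter_subset_right) hx hi

theorem glue_mem_faceMaps {U A : Finset V} {β : Finset V → Finset V} (hA : A ⊆ U)
    (hne : A.Nonempty) (hβ : β ∈ faceMaps B (U \ A)) : glue B U A β ∈ faceMaps B U := by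
  obtain ⟨w, rfl⟩ := mem_faceMaps.1 hβ
  -- Raising the functional on `A` to a value above its whole range makes `A` the maximizer set and
  -- leaves the functional unchanged on `U \ A`.
  obtain ⟨M, hM⟩ : ∃ M : ℝ, ∀ i, w i < M := by
    obtain ⟨M, hM⟩ := (Set.finite_range w).bddAbove
    exact ⟨M + 1, fun i => lt_of_le_of_lt (hM ⟨i, rfl⟩) (lt_add_one M)⟩
  have h1 : argmax (fun i => if i ∈ A then M else w i) U = A := by
    obtain ⟨a, ha⟩ := hne
    ext i
    rw [mem_argmax]
    constructor
    · rintro ⟨_, hm⟩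
      by_contra hi
      have := hm a (hA ha)
      rw [if_pos ha, if_neg hi] at this
      exact absurd (hM i) (not_lt.2 this)
    · intro hi
      refine ⟨hA hi, fun j _ => ?_⟩
      rw [if_pos hi]
      split_ifs
      · exact le_rfl
      · exact (hM j).le
  refine mem_faceMaps.2 ⟨fun i => if i ∈ A then M else w i, ?_⟩
  rw [restrArgmax_eq_glue U, h1, restrArgmax_congr (w := fun i => if i ∈ A then M else w i) (w' := w)]
  exact fun i hi => if_neg (Finset.mem_sdiff.1 hi).2

/-- The differences within `A` span a space of dimension `|A| - 1`, independent of the directions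
supported in `U \ A`. -/
theorem faceDim_glue {U A : Finset V} {β : Finset V → Finset V} (hU : U ∈ B.sets) (hA : A ⊆ U)
    (hne : A.Nonempty) (hβ : β ∈ faceMaps B (U \ A)) :
    faceDim (glue B U A β) + 1 = A.card + faceDim β := by
  have hsup : dirSpan (glue B U A β) = dirSpan (fun _ => A) ⊔ dirSpan β := by
    apply le_antisymm
    · refine Submodule.span_le.2 ?_
      rintro _ ⟨I, i, hi, j, hj, rfl⟩
      unfold glue at hi hj
      split_ifs at hi hj with hI hIA
      · exact Submodule.mem_sup_left (Submodule.subset_span ⟨I, i, Finset.inter_subset_right hi, j,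
          Finset.inter_subset_right hj, rfl⟩)
      · exact Submodule.mem_sup_right (Submodule.subset_span ⟨I, i, hi, j, hj, rfl⟩)
      · exact absurd hi (Finset.notMem_empty i)
    · refine sup_le (Submodule.span_le.2 ?_) (Submodule.span_le.2 ?_)
      · rintro _ ⟨_, i, hi, j, hj, rfl⟩
        rw [← glue_self (β := β) hU hA hne] at hi hj
        exact Submodule.subset_span ⟨U, i, hi, j, hj, rfl⟩
      · rintro _ ⟨I, i, hi, j, hj, rfl⟩
        have hI : I ∈ B.sets ∧ I ⊆ U \ A := by
          by_contra hI
          rw [eq_empty_of_mem_faceMaps hβ hI] at hi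
          exact Finset.notMem_empty i hi
        rw [← glue_of_subset (β := β) hI.1 hI.2] at hi hj
        exact Submodule.subset_span ⟨I, i, hi, j, hj, rfl⟩
  rw [faceDim, hsup, finrank_sup_of_disjoint_supports (Finset.disjoint_sdiff (s := A) (t := U)),
    ← finrank_dirSpan_const hne, faceDim]
  · omega
  · exact fun x hx i hi => eq_zero_of_mem_dirSpan (fun _ => subset_rfl) hx hi
  · exact fun x hx i hi => eq_zero_of_mem_dirSpan
      (fun I => (subset_of_mem_faceMaps hβ I).trans Finset.inter_subset_right) hx hi

/-- Face maps on `U` are sorted by their value `A` at `U` itself; the factor `X` absorbs the shift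
by one in the dimension formula. -/
theorem X_mul_facePoly {U : Finset V} (hU : U ∈ B.sets) :
    X * facePoly B U =
      ∑ A ∈ U.powerset.filter Finset.Nonempty, X ^ A.card * facePoly B (U \ A) := by
  simp only [facePoly, Finset.mul_sum]
  rw [Finset.sum_sigma']
  symm
  refine Finset.sum_nbij (fun p => glue B U p.1 p.2) ?_ ?_ ?_ ?_
  · rintro ⟨A, β⟩ h
    simp only [Finset.mem_sigma, Finset.mem_filter, Finset.mem_powerset] at h
    exact glue_mem_faceMaps h.1.1 h.1.2 h.2
  · rintro ⟨A, β⟩ h ⟨A', β'⟩ h' e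
    simp only [Finset.coe_sigma, Set.mem_sigma_iff, Finset.mem_coe, Finset.mem_filter,
      Finset.mem_powerset] at h h'
    dsimp only at e
    have hA : A = A' := by
      rw [← glue_self (β := β) hU h.1.1 h.1.2, e, glue_self hU h'.1.1 h'.1.2]
    subst hA
    congr 1
    funext I
    by_cases hI : I ∈ B.sets ∧ I ⊆ U \ A
    · rw [← glue_of_subset (β := β) hI.1 hI.2, e, glue_of_subset hI.1 hI.2]
    · rw [eq_empty_of_mem_faceMaps h.2 hI, eq_empty_of_mem_faceMaps h'.2 hI]
  · intro α hα
    obtain ⟨w, rfl⟩ := mem_faceMaps.1 (Finset.mem_coe.1 hα)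
    refine ⟨⟨argmax w U, restrArgmax B (U \ argmax w U) w⟩, ?_, (restrArgmax_eq_glue U w).symm⟩
    simp only [Finset.coe_sigma, Set.mem_sigma_iff, Finset.mem_coe, Finset.mem_filter,
      Finset.mem_powerset]
    exact ⟨⟨argmax_subset w U, argmax_nonempty w (B.nonempty_of_mem U hU)⟩,
      mem_faceMaps.2 ⟨w, rfl⟩⟩
  · rintro ⟨A, β⟩ h
    simp only [Finset.mem_sigma, Finset.mem_filter, Finset.mem_powerset] at h
    rw [← pow_add, ← faceDim_glue hU h.1.1 h.1.2 h.2, pow_succ']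

theorem dim_nestohedron [Nonempty V] (h : Finset.univ ∈ B.sets) :
    dim (nestohedron B) = Fintype.card V - 1 := by
  -- The zero functional cuts out the whole polytope, whose dimension is then read off from the
  -- gluing formula with `A` the full vertex set.
  have h0 : restrArgmax B Finset.univ 0 = glue B Finset.univ Finset.univ (restrArgmax B ∅ 0) := by
    have : argmax (0 : V → ℝ) Finset.univ = Finset.univ := by
      ext i; simp [mem_argmax]
    rw [restrArgmax_eq_glue, this, Finset.sdiff_self]
  have hn : nestohedron B = faceSum B (restrArgmax B Finset.univ 0) := by
    refine faceSum_congr (α := id) fun I hI => ?_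
    rw [restrArgmax_of_mem hI (Finset.subset_univ I)]
    ext i; simp [mem_argmax]
  have hm : restrArgmax B ∅ 0 ∈ faceMaps B (Finset.univ \ Finset.univ) :=
    mem_faceMaps.2 ⟨0, by rw [Finset.sdiff_self]⟩
  have h1 := faceDim_glue h subset_rfl Finset.univ_nonempty hm
  have h2 : faceDim (restrArgmax B ∅ 0) = 0 := by
    rw [faceDim, Submodule.finrank_eq_zero, Submodule.eq_bot_iff]
    intro x hx
    ext i
    exact eq_zero_of_mem_dirSpan
      (fun I => (restrArgmax_subset ∅ I 0).trans Finset.inter_subset_right) hx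
      (Finset.notMem_empty i)
  rw [hn, dim_faceSum (mem_faceMaps.2 ⟨0, rfl⟩), h0]
  rw [h2, Finset.card_univ] at h1
  omega

/-- After the substitution and passing to complements, the face recursion misses only the summand in
which nothing is removed. Adding it turns `(X - 1) H(U)` into `X H(U)`. -/
theorem isRemovalInvariant_facePoly (G : SimpleGraph V) : IsRemovalInvariant G fun U =>
    (((facePoly (graphical G) U).comp (X - 1)).map (Int.castRingHom ℚ)) where
  empty := by simp [facePoly_empty]
  union U W hd h := by simp [facePoly_union hd h]
  connected U hU := by
    obtain ⟨φ, hφ⟩ : ∃ φ : ℤ[X] →+* ℚ[X], ∀ p, φ p = (p.comp (X - 1)).map (Int.castRingHom ℚ) :=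
      ⟨(mapRingHom (Int.castRingHom ℚ)).comp (compRingHom (X - 1)), fun _ => rfl⟩
    have hX : φ X = X - 1 := by simp [hφ]
    have h := congrArg φ (X_mul_facePoly (mem_graphical.2 hU))
    simp only [map_mul, map_sum, map_pow, hX] at h
    simp only [← hφ]
    have hsum : ∑ A ∈ U.powerset, (X - 1) ^ (U \ A).card *
        φ (facePoly (graphical G) A) =
        ∑ A ∈ U.powerset, (X - 1) ^ A.card *
        φ (facePoly (graphical G) (U \ A)) := by
      refine Finset.sum_nbij' (fun A => U \ A) (fun A => U \ A) ?_ ?_ ?_ ?_ ?_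
      · exact fun A _ => Finset.mem_powerset.2 Finset.sdiff_subset
      · exact fun A _ => Finset.mem_powerset.2 Finset.sdiff_subset
      · exact fun A hA => Finset.sdiff_sdiff_eq_self (Finset.mem_powerset.1 hA)
      · exact fun A hA => Finset.sdiff_sdiff_eq_self (Finset.mem_powerset.1 hA)
      · intro A hA
        rw [Finset.sdiff_sdiff_eq_self (Finset.mem_powerset.1 hA)]
    have hfilter : U.powerset.filter (fun A => ¬ A.Nonempty) = {∅} := by
      ext A
      simp only [Finset.mem_filter, Finset.mem_powerset, Finset.not_nonempty_iff_eq_empty,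
        Finset.mem_singleton]
      exact ⟨fun h => h.2, fun h => ⟨h ▸ Finset.empty_subset U, h⟩⟩
    rw [hsum, ← Finset.sum_filter_add_sum_filter_not U.powerset Finset.Nonempty, ← h, hfilter,
      Finset.sum_singleton, Finset.card_empty, pow_zero, Finset.sdiff_empty]
    ring

end Recursion


/-! ### Rooted subtrees of trees -/

section

variable {V : Type*} {G : SimpleGraph V} {S : Set V}

/-- Two distinct neighbours of `x` in `S`, joined by a path inside `S`, would close a cycle through
`x`. -/
theorem eq_of_adj_of_connected_induce (hG : G.IsAcyclic) (hS : (G.induce S).Connected)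
    {x y z : V} (hx : x ∉ S) (hy : y ∈ S) (hz : z ∈ S) (hxy : G.Adj x y) (hxz : G.Adj x z) :
    y = z := by
  obtain ⟨q, hq⟩ := hS.exists_isPath ⟨y, hy⟩ ⟨z, hz⟩
  let e := (SimpleGraph.Embedding.induce (G := G) S).toHom
  let q' : G.Walk y z := q.map e
  have hq' : q'.IsPath := hq.map Subtype.val_injective
  have hxq : x ∉ q'.support := by
    intro h
    rw [show q'.support = q.support.map e from SimpleGraph.Walk.support_map _ _,
      List.mem_map] at h
    obtain ⟨a, -, rfl⟩ := h
    exact hx a.2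
  have := hG.eq_snd_of_adj_start (p := .cons hxy q') (by simp [hq', hxq]) hxz (by simp)
  simpa using this.symm

/-- A walk towards `r` can leave `S` only through `r` itself. -/
theorem connected_induce_of_forall_adj_mem (hG : G.Connected) {r : V} (hr : r ∈ S)
    (h : ∀ x ∈ S, x ≠ r → ∀ y, G.Adj x y → y ∈ S) : (G.induce S).Connected := by
  have key : ∀ {x : V} (_ : G.Walk x r) (hx : x ∈ S),
      (G.induce S).Reachable ⟨x, hx⟩ ⟨r, hr⟩ := by
    intro x p hx
    induction p with
    | nil => exact .refl _
    | @cons x y z hxy p ih =>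
      by_cases hxr : x = z
      · subst hxr; exact .refl _
      · have hy := h x hx hxr y hxy
        exact SimpleGraph.Reachable.trans
          (SimpleGraph.Adj.reachable (u := (⟨x, hx⟩ : S)) (v := ⟨y, hy⟩) hxy) (ih hr h hy)
  have : Nonempty S := ⟨⟨r, hr⟩⟩
  refine ⟨fun a b => ?_⟩
  obtain ⟨p⟩ := hG.preconnected a.1 r
  obtain ⟨q⟩ := hG.preconnected b.1 r
  exact (key p a.2).trans (key q b.2).symm

end

section

variable {V : Type*} [DecidableEq V]

namespace Rooted

variable {G G' : SimpleGraph V} {U W : Finset V} {r w : V} {f g : ℚ[X][X]}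

theorem exists_insert (h : Rooted G U r f) {x y : V} (hx : x ∉ U) (hy : y ∈ U) (hxy : G.Adj y x)
    (hu : ∀ z ∈ U, G.Adj z x → z = y) : ∃ f', Rooted G (insert x U) r f' := by
  induction h generalizing y with
  | single r =>
    obtain rfl := Finset.mem_singleton.1 hy
    refine ⟨_, by
      rw [Finset.insert_eq, Finset.union_comm]
      exact graft (single y) (single x) (by simpa [eq_comm] using hx) hxy (by simp)⟩
  | @graft U W r w f g hU hW hd hadj hc ih1 ih2 =>
    rw [Finset.mem_union, not_or] at hx
    rcases Finset.mem_union.1 hy with hy | hy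
    · obtain ⟨f', hf'⟩ := ih1 hx.1 hy hxy fun z hz => hu z (Finset.mem_union_left _ hz)
      rw [← Finset.insert_union]
      refine ⟨_, hf'.graft hW (Finset.disjoint_insert_left.2 ⟨hx.2, hd⟩) hadj ?_⟩
      intro a ha b hb hab
      rcases Finset.mem_insert.1 ha with rfl | ha
      · obtain rfl := hu b (Finset.mem_union_right _ hb) hab.symm
        exact absurd hb (Finset.disjoint_left.1 hd hy)
      · exact hc a ha b hb hab
    · obtain ⟨f', hf'⟩ := ih2 hx.2 hy hxy fun z hz => hu z (Finset.mem_union_right _ hz)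
      rw [← Finset.union_insert]
      refine ⟨_, hU.graft hf' (Finset.disjoint_insert_right.2 ⟨hx.1, hd⟩) hadj ?_⟩
      intro a ha b hb hab
      rcases Finset.mem_insert.1 hb with rfl | hb
      · obtain rfl := hu a (Finset.mem_union_left _ ha) hab
        exact absurd hy (Finset.disjoint_left.1 hd ha)
      · exact hc a ha b hb hab

theorem exists_of_connected (hG : G.IsAcyclic) (hU : (G.induce (U : Set V)).Connected)
    (hr : r ∈ U) : ∃ f, Rooted G U r f := by
  classical
  -- A largest rooted subtree inside `U` is all of `U`: otherwise an edge crosses its boundary, and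
  -- acyclicity makes that edge unique at the new vertex, which can then be added.
  obtain ⟨S, hS, hmax⟩ : ∃ S ∈ U.powerset.filter fun S => ∃ f, Rooted G S r f,
      ∀ T ∈ U.powerset.filter fun S => ∃ f, Rooted G S r f, T.card ≤ S.card :=
    Finset.exists_max_image _ _ ⟨{r}, by simpa using ⟨hr, _, single r⟩⟩
  rw [Finset.mem_filter, Finset.mem_powerset] at hS
  obtain ⟨hSU, f, hf⟩ := hS
  by_cases hne : S = U
  · exact ⟨f, hne ▸ hf⟩
  obtain ⟨v, hvU, hvS⟩ := Finset.exists_of_ssubset (hSU.ssubset_of_ne hne)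
  obtain ⟨p⟩ := hU.preconnected ⟨r, hr⟩ ⟨v, hvU⟩
  obtain ⟨d, -, hd1, hd2⟩ := p.exists_boundary_dart (Subtype.val ⁻¹' (S : Set V))
    hf.root_mem hvS
  have hadj : G.Adj d.fst.1 d.snd.1 := d.adj
  obtain ⟨f', hf'⟩ := hf.exists_insert (x := d.snd.1) (y := d.fst.1) hd2 hd1 hadj
    fun z hz hzx => eq_of_adj_of_connected_induce hG hf.connected hd2 hz hd1 hzx.symm hadj.symm
  have := hmax (insert d.snd.1 S) (Finset.mem_filter.2
    ⟨Finset.mem_powerset.2 (Finset.insert_subset d.snd.2 hSU), f', hf'⟩)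
  rw [Finset.card_insert_of_notMem hd2] at this
  omega

/-- The polynomial is a product over the branches at the root, so identifying the roots of two trees
multiplies their polynomials. -/
theorem wedge (hU : Rooted G U r f) (hW : Rooted G W r g) (hd : ∀ x ∈ U, x ∈ W → x = r)
    (hadj : ∀ x ∈ U, ∀ y ∈ W, G.Adj x y → x = r ∨ y = r) : Rooted G (U ∪ W) r (f * g) := by
  induction hW with
  | single r =>
    rw [mul_one, Finset.union_eq_left.2 (Finset.singleton_subset_iff.2 hU.root_mem)]
    exact hU
  | @graft W₁ W₂ r w f₁ f₂ h₁ h₂ hd' hadj' hc ih1 _ =>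
    have hr₂ : r ∉ W₂ := Finset.disjoint_left.1 hd' h₁.root_mem
    have hU₂ : Disjoint U W₂ := Finset.disjoint_left.2 fun x hx hx' =>
      hr₂ (hd x hx (Finset.mem_union_right _ hx') ▸ hx')
    rw [← Finset.union_assoc, ← mul_assoc]
    refine (ih1 hU (fun x hx hx' => hd x hx (Finset.mem_union_left _ hx')) fun x hx y hy =>
      hadj x hx y (Finset.mem_union_left _ hy)).graft h₂
        (Finset.disjoint_union_left.2 ⟨hU₂, hd'⟩) hadj' ?_
    intro x hx y hy hxy
    rcases Finset.mem_union.1 hx with hx | hx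
    · rcases hadj x hx y (Finset.mem_union_right _ hy) hxy with rfl | rfl
      · exact hc _ h₁.root_mem y hy hxy
      · exact absurd hy hr₂
    · exact hc x hx y hy hxy

theorem image {V' : Type*} [DecidableEq V'] {G' : SimpleGraph V'} (h : Rooted G U r f) (σ : V → V')
    (hσ : Set.InjOn σ U) (hadj : ∀ x ∈ U, ∀ y ∈ U, G.Adj x y ↔ G'.Adj (σ x) (σ y)) :
    Rooted G' (U.image σ) (σ r) f := by
  induction h with
  | single r => rw [Finset.image_singleton]; exact single _
  | @graft U W r w f g hU hW hd hrw hc ih1 ih2 =>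
    have hr := hU.root_mem
    have hw := hW.root_mem
    rw [Finset.image_union]
    simp only [Finset.mem_union] at hadj
    refine (ih1 (hσ.mono (by simp)) fun x hx y hy => hadj x (.inl hx) y (.inl hy)).graft
      (ih2 (hσ.mono (by simp)) fun x hx y hy => hadj x (.inr hx) y (.inr hy)) ?_
      ((hadj r (.inl hr) w (.inr hw)).1 hrw) ?_
    · refine Finset.disjoint_left.2 fun z hz hz' => ?_
      obtain ⟨x, hx, rfl⟩ := Finset.mem_image.1 hz
      obtain ⟨y, hy, hxy⟩ := Finset.mem_image.1 hz'
      rw [hσ (by simp [hy]) (by simp [hx]) hxy] at hy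
      exact Finset.disjoint_left.1 hd hx hy
    · intro a ha b hb hab
      obtain ⟨x, hx, rfl⟩ := Finset.mem_image.1 ha
      obtain ⟨y, hy, rfl⟩ := Finset.mem_image.1 hb
      obtain ⟨rfl, rfl⟩ := hc x hx y hy ((hadj x (.inl hx) y (.inr hy)).2 hab)
      exact ⟨rfl, rfl⟩

/-- Attaching a rooted tree to the end of a path. -/
theorem path (hG : G.IsAcyclic) {c l : V} {p : G.Walk c l} (hp : p.IsPath) (h : Rooted G' W l f)
    (hGG' : ∀ x ∈ p.support, ∀ y ∈ p.support, G.Adj x y ↔ G'.Adj x y)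
    (hd : ∀ x ∈ p.support, x ∈ W → x = l)
    (hadj : ∀ x ∈ p.support, ∀ y ∈ W, G'.Adj x y → x = l ∨ y = l) :
    Rooted G' (p.support.toFinset ∪ W) c ((edgeOp ^ p.length) f) := by
  induction p with
  | nil =>
    rw [SimpleGraph.Walk.support_nil, Finset.union_eq_right.2 (by simpa using h.root_mem)]
    simpa using h
  | @cons c c' l hcc' p ih =>
    obtain ⟨hp', hc⟩ := (SimpleGraph.Walk.cons_isPath_iff _ _).1 hp
    rw [SimpleGraph.Walk.support_cons] at *
    simp only [List.mem_cons, forall_eq_or_imp] at hGG' hd hadj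
    have hcl : c ≠ l := fun e => hc (e ▸ p.end_mem_support)
    have ih' := ih hp' h (fun x hx y hy => (hGG'.2 x hx).2 y hy) hd.2 hadj.2
    have := (single (G := G') c).graft ih' (by
        simp only [Finset.disjoint_singleton_left, Finset.mem_union, List.mem_toFinset, not_or]
        exact ⟨hc, fun hcW => hcl (hd.1 hcW)⟩)
      ((hGG'.1.2 c' p.start_mem_support).1 hcc') (by
        intro x hx y hy hxy
        obtain rfl := Finset.mem_singleton.1 hx
        refine ⟨rfl, ?_⟩
        have hy' : y ∈ p.support := by
          rcases Finset.mem_union.1 hy with hy | hy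
          · exact List.mem_toFinset.1 hy
          · rcases hadj.1 y hy hxy with e | rfl
            · exact absurd e hcl
            · exact p.end_mem_support
        have := hG.eq_snd_of_adj_start hp ((hGG'.1.2 y hy').2 hxy) (by simp [hy'])
        simpa using this)
    rw [one_mul] at this
    rw [SimpleGraph.Walk.length_cons, pow_succ', Module.End.mul_apply]
    convert this using 1
    ext; simp

open Classical in
-- Counts ordered adjacent pairs: a graft creates one edge between the parts, seen twice. This
-- yields the edge count needed in `isTree`.
theorem sum_adj (h : Rooted G U r f) :
    ∑ a ∈ U, ∑ b ∈ U, (if G.Adj a b then 1 else 0) + 2 = 2 * U.card := by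
  induction h with
  | single r => simp
  | @graft U W r w f g hU hW hd hrw hc ih1 ih2 =>
    have cross : ∑ a ∈ U, ∑ b ∈ W, (if G.Adj a b then 1 else 0) = 1 := by
      rw [Finset.sum_eq_single r, Finset.sum_eq_single w, if_pos hrw]
      · intro b hb hne
        exact if_neg fun hab => hne (hc r hU.root_mem b hb hab).2
      · exact fun hw => absurd hW.root_mem hw
      · intro a ha hne
        exact Finset.sum_eq_zero fun b hb => if_neg fun hab => hne (hc a ha b hb hab).1
      · exact fun hr => absurd hU.root_mem hr
    have cross' : ∑ a ∈ W, ∑ b ∈ U, (if G.Adj a b then 1 else 0) = 1 := by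
      rw [Finset.sum_comm]
      simpa only [G.adj_comm] using cross
    rw [Finset.sum_union hd, Finset.card_union_of_disjoint hd]
    simp only [Finset.sum_union hd, Finset.sum_add_distrib]
    omega

theorem isTree [Fintype V] (h : Rooted G Finset.univ r f) : G.IsTree := by
  classical
  have hc := h.connected
  rw [Finset.coe_univ] at hc
  refine SimpleGraph.isTree_iff_connected_and_card.2
    ⟨(SimpleGraph.induceUnivIso G).connected_iff.1 hc, ?_⟩
  have h1 := h.sum_adj
  have h2 := G.sum_degrees_eq_twice_card_edges
  have h3 : ∑ a, ∑ b, (if G.Adj a b then 1 else 0) = ∑ v, G.degree v := by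
    refine Finset.sum_congr rfl fun a _ => ?_
    rw [← SimpleGraph.card_neighborFinset_eq_degree, SimpleGraph.neighborFinset_eq_filter,
      Finset.card_filter]
  rw [h3, h2, Finset.card_univ] at h1
  rw [Nat.card_eq_fintype_card, Nat.card_eq_fintype_card, ← SimpleGraph.edgeFinset_card]
  omega

end Rooted

end


/-! ### Tree shifts and rooted polynomials -/

section

variable {V : Type*} {G : SimpleGraph V} {c l : V} {F : Set V}

theorem reattach_adj {a b : V} : (reattach G c l F).Adj a b ↔
    (G.Adj a b ∧ ∀ v ∈ F, G.Adj v c → s(a, b) ≠ s(v, c)) ∨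
      a ≠ b ∧ ∃ v ∈ F, G.Adj v c ∧ s(a, b) = s(v, l) := by
  rw [reattach, SimpleGraph.sup_adj, SimpleGraph.deleteEdges_adj,
    SimpleGraph.fromEdgeSet_adj]
  simp only [Set.mem_ofPred_eq, not_exists, not_and, ne_eq]
  tauto

theorem reattach_adj_of_notMem {a b : V} (ha : a ∉ F) (hb : b ∉ F) :
    (reattach G c l F).Adj a b ↔ G.Adj a b := by
  rw [reattach_adj]
  constructor
  · rintro (h | ⟨-, v, hv, -, h⟩)
    · exact h.1
    · rcases Sym2.eq_iff.1 h with ⟨rfl, rfl⟩ | ⟨rfl, rfl⟩ <;> contradiction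
  · refine fun h => .inl ⟨h, fun v hv _ h => ?_⟩
    rcases Sym2.eq_iff.1 h with ⟨rfl, rfl⟩ | ⟨rfl, rfl⟩ <;> contradiction

theorem reattach_adj_of_mem {a b : V} (hc : c ∉ F) (hl : l ∉ F) (ha : a ∈ F) (hb : b ∈ F) :
    (reattach G c l F).Adj a b ↔ G.Adj a b := by
  rw [reattach_adj]
  constructor
  · rintro (h | ⟨-, v, hv, -, h⟩)
    · exact h.1
    · rcases Sym2.eq_iff.1 h with ⟨rfl, rfl⟩ | ⟨rfl, rfl⟩ <;> contradiction
  · refine fun h => .inl ⟨h, fun v hv _ h => ?_⟩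
    rcases Sym2.eq_iff.1 h with ⟨rfl, rfl⟩ | ⟨rfl, rfl⟩ <;> contradiction

theorem reattach_adj_of_mem_of_notMem {a b : V} (hF : ∀ u, u ∉ insert c F → ∀ v ∈ F, ¬ G.Adj u v)
    (ha : a ∈ F) (hb : b ∉ F) :
    (reattach G c l F).Adj a b ↔ G.Adj a c ∧ b = l := by
  rw [reattach_adj]
  constructor
  · rintro (⟨h, h'⟩ | ⟨-, v, hv, h, h'⟩)
    · have hbc : b = c := by
        by_contra hne
        exact hF b (by simp [hne, hb]) a ha h.symm
      subst hbc
      exact absurd rfl (h' a ha h)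
    · rcases Sym2.eq_iff.1 h' with ⟨rfl, rfl⟩ | ⟨rfl, rfl⟩
      · exact ⟨h, rfl⟩
      · contradiction
  · rintro ⟨h, rfl⟩
    exact .inr ⟨fun e => hb (e ▸ ha), a, ha, h, rfl⟩

/-- The polynomials of a tree and of its tree shift, rooted at the vertex where the two differ. -/
theorem exists_rooted_reattach [Fintype V] [DecidableEq V] (hG : G.IsTree) {p : G.Walk c l} (hp : p.IsPath)
    (hcl : c ≠ l)
    (hpadj : ∀ y ∈ p.support, y ≠ c → ∀ x, G.Adj y x → x ∈ p.support)
    (hFp : ∀ v ∈ F, v ∉ p.support) (hFc : (G.induce (insert c F)).Connected)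
    (hF : ∀ u, u ∉ insert c F → ∀ v ∈ F, ¬ G.Adj u v) :
    ∃ (d e : ℕ) (f g : ℚ[X][X]), f ∈ meixnerCone d ∧ g ∈ meixnerCone e ∧
      d + e + p.length = Fintype.card V - 1 ∧
      Rooted G Finset.univ c (f * g * (edgeOp ^ p.length) 1) ∧
      Rooted (reattach G c l F) Finset.univ c (g * (edgeOp ^ p.length) f) := by
  classical
  have hcF : c ∉ F := fun h => hFp c h p.start_mem_support
  have hlF : l ∉ F := fun h => hFp l h p.end_mem_support
  -- The sets `A`, `R` and the path meet pairwise only in `c` and cover the tree; `A` carries `f`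
  -- and `R` carries `g`.
  set A : Finset V := insert c F.toFinset with hA
  set R : Finset V := Finset.univ.filter fun x => x ∉ F ∧ (x ∈ p.support → x = c) with hR
  have mA : ∀ x, x ∈ A ↔ x = c ∨ x ∈ F := fun x => by simp [hA]
  have mR : ∀ x, x ∈ R ↔ x ∉ F ∧ (x ∈ p.support → x = c) := fun x => by simp [hR]
  have hcA : c ∈ A := by simp [mA]
  have hcR : c ∈ R := by simp [mR, hcF]
  obtain ⟨f, hf⟩ := Rooted.exists_of_connected (U := A) hG.isAcyclic
    (by rwa [hA, Finset.coe_insert, Set.coe_toFinset]) hcA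
  obtain ⟨g, hg⟩ := Rooted.exists_of_connected (U := R) hG.isAcyclic
    (connected_induce_of_forall_adj_mem hG.connected (r := c) hcR (by
      intro x hx hxc y hxy
      rw [Finset.mem_coe, mR] at hx ⊢
      refine ⟨fun hy => hF x (by simp [hxc, hx.1]) y hy hxy, fun hy => ?_⟩
      by_contra hyc
      exact hxc (hx.2 (hpadj y hy hyc x hxy.symm)))) hcR
  -- The excess `2` arises because `c` is counted three times.
  have hcard : A.card + R.card + p.support.toFinset.card = Fintype.card V + 2 := by
    have h1 : A.card + R.card = (A ∪ R).card + 1 := by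
      rw [← Finset.card_union_add_card_inter]
      congr 1
      rw [Finset.card_eq_one]
      exact ⟨c, by ext x; simp only [Finset.mem_inter, mA, mR, Finset.mem_singleton]; aesop⟩
    have h2 : (A ∪ R).card + p.support.toFinset.card = Fintype.card V + 1 := by
      rw [← Finset.card_union_add_card_inter, ← Finset.card_univ]
      congr 1
      · congr 1
        ext x
        simp only [Finset.mem_union, mA, mR, List.mem_toFinset, Finset.mem_univ]
        tauto
      · rw [Finset.card_eq_one]
        refine ⟨c, ?_⟩
        ext x
        simp only [Finset.mem_inter, Finset.mem_union, mA, mR, Finset.mem_singleton,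
          List.mem_toFinset]
        constructor
        · rintro ⟨(h | h) | h, h'⟩
          · exact h
          · exact absurd h' (hFp x h)
          · exact h.2 h'
        · rintro rfl
          simp
    omega
  rw [List.toFinset_card_of_nodup hp.support_nodup, SimpleGraph.Walk.length_support] at hcard
  have hA0 : 0 < A.card := Finset.card_pos.2 ⟨c, hcA⟩
  have hR0 : 0 < R.card := Finset.card_pos.2 ⟨c, hcR⟩
  refine ⟨A.card - 1, R.card - 1, f, g, hf.mem_meixnerCone, hg.mem_meixnerCone, by omega, ?_, ?_⟩
  · have hP := Rooted.path hG.isAcyclic hp (Rooted.single (G := G) l) (fun _ _ _ _ => Iff.rfl)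
      (by simp) (by simp)
    rw [Finset.union_eq_left.2 (by simp)] at hP
    have hAR := hf.wedge hg (fun x hx hx' => by rw [mA] at hx; rw [mR] at hx'; tauto) (by
      intro x hx y hy hxy
      by_contra! h
      rw [mA] at hx; rw [mR] at hy
      exact hF y (by simp [h.2, hy.1]) x (by tauto) hxy.symm)
    have := hAR.wedge hP (by
        intro x hx hx'
        rw [Finset.mem_union, mA, mR] at hx
        rw [List.mem_toFinset] at hx'
        rcases hx with (h | h) | h
        · exact h
        · exact absurd hx' (hFp x h)
        · exact h.2 hx') (by
        intro x hx y hy hxy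
        by_contra! h
        rw [Finset.mem_union, mA, mR] at hx
        rw [List.mem_toFinset] at hy
        have hxp := hpadj y hy h.2 x hxy.symm
        rcases hx with (h' | h') | h'
        · exact h.1 h'
        · exact hFp x h' hxp
        · exact h.1 (h'.2 hxp))
    convert this using 1
    ext x
    simp only [Finset.mem_union, mA, mR, List.mem_toFinset, Finset.mem_univ]
    tauto
  · have hne : ∀ x ∈ F, x ≠ c := fun x hx e => hcF (e ▸ hx)
    have hnl : ∀ x ∈ F, x ≠ l := fun x hx e => hlF (e ▸ hx)
    have hcl' : ∀ x ∈ F, ¬ G.Adj l x := fun x hx => hF l (by simp [hlF, hcl.symm]) x hx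
    -- Renaming `c` to `l` carries the tree on `F ∪ {c}` rooted at `c` to the reattached tree on `F
    -- ∪ {l}` rooted at `l`, with the same polynomial.
    set σ : V → V := fun x => if x = c then l else x with hσ
    have σF : ∀ x ∈ F, σ x = x := fun x hx => if_neg (hne x hx)
    have σc : σ c = l := if_pos rfl
    have hfl := hf.image (G' := reattach G c l F) σ (by
        intro x hx y hy hxy
        rw [Finset.mem_coe, mA] at hx hy
        rcases hx with rfl | hx <;> rcases hy with rfl | hy
        · rfl
        · rw [σc, σF y hy] at hxy; exact absurd hxy.symm (hnl y hy)
        · rw [σc, σF x hx] at hxy; exact absurd hxy (hnl x hx)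
        · rwa [σF x hx, σF y hy] at hxy) (by
        intro x hx y hy
        rw [mA] at hx hy
        rcases hx with rfl | hx <;> rcases hy with rfl | hy
        · simp
        · rw [σc, σF y hy, SimpleGraph.adj_comm _ l, reattach_adj_of_mem_of_notMem hF hy hlF,
            G.adj_comm]
          simp
        · rw [σc, σF x hx, reattach_adj_of_mem_of_notMem hF hx hlF]
          simp
        · rw [σF x hx, σF y hy, reattach_adj_of_mem hcF hlF hx hy])
    rw [σc] at hfl
    have mσ : ∀ x, x ∈ A.image σ ↔ x = l ∨ x ∈ F := by
      intro x
      rw [hA, Finset.image_insert, σc, Finset.mem_insert, Finset.mem_image]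
      refine or_congr_right ⟨?_, fun hx => ⟨x, by simpa using hx, σF x hx⟩⟩
      rintro ⟨y, hy, rfl⟩
      have hy' : y ∈ F := by simpa using hy
      rwa [σF y hy']
    have hP := Rooted.path hG.isAcyclic hp hfl
      (fun x hx y hy => (reattach_adj_of_notMem (fun h => hFp x h hx) fun h => hFp y h hy).symm)
      (fun x hx hx' => ((mσ x).1 hx').resolve_right fun h => hFp x h hx)
      (fun x hx y hy hxy => by
        rcases (mσ y).1 hy with h | h
        · exact .inr h
        · exact .inl ((reattach_adj_of_mem_of_notMem hF h fun h => hFp x h hx).1 hxy.symm).2)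
    have hg' := hg.image (G' := reattach G c l F) id (Set.injOn_id _) (fun x hx y hy =>
      (reattach_adj_of_notMem ((mR x).1 hx).1 ((mR y).1 hy).1).symm)
    rw [Finset.image_id, id] at hg'
    have := hg'.wedge hP (by
        intro x hx hx'
        rw [mR] at hx
        rw [Finset.mem_union, mσ, List.mem_toFinset] at hx'
        rcases hx' with h | rfl | h
        · exact hx.2 h
        · exact hx.2 p.end_mem_support
        · exact absurd h hx.1) (by
        intro x hx y hy hxy
        rw [mR] at hx
        rw [Finset.mem_union, mσ, List.mem_toFinset] at hy
        by_contra! h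
        have hxp : x ∉ p.support := fun h' => h.1 (hx.2 h')
        have : y ∈ p.support ∨ y ∈ F := by
          rcases hy with h | rfl | h
          · exact .inl h
          · exact .inl p.end_mem_support
          · exact .inr h
        rcases this with hy | hy
        · exact hxp (hpadj y hy h.2 x
            ((reattach_adj_of_notMem hx.1 fun h => hFp y h hy).1 hxy).symm)
        · obtain rfl := ((reattach_adj_of_mem_of_notMem hF hy hx.1).1 hxy.symm).2
          exact hxp p.end_mem_support)
    convert this using 1
    ext x
    simp only [Finset.mem_union, mσ, mR, List.mem_toFinset, Finset.mem_univ]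
    tauto

/-- The vertices after the branch vertex `c` on the path of a tree shift have no neighbours off the
path. -/
theorem mem_support_of_adj_of_nearest [Finite V] (hG : G.IsTree) {p : G.Walk c l} (hp : p.IsPath)
    (hl : (G.neighborSet l).ncard = 1)
    (hc : ∀ v, 2 < (G.neighborSet v).ncard → G.dist l c ≤ G.dist l v) {y : V} (hy : y ∈ p.support)
    (hyc : y ≠ c) {x : V} (hyx : G.Adj y x) : x ∈ p.support := by
  classical
  by_contra hx
  obtain ⟨i, rfl, hi⟩ := SimpleGraph.Walk.mem_support_iff_exists_getVert.1 hy
  obtain ⟨j, rfl⟩ : ∃ j, i = j + 1 := Nat.exists_eq_succ_of_ne_zero (by rintro rfl; simp at hyc)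
  have hprev : G.Adj (p.getVert (j + 1)) (p.getVert j) := (p.adj_getVert_succ (by omega)).symm
  have hne : ∀ i, x ≠ p.getVert i := fun i e => hx (e ▸ p.getVert_mem_support i)
  rcases hi.eq_or_lt with hi | hi
  · rw [hi, p.getVert_length] at hyx hprev
    obtain ⟨a, ha⟩ := Set.ncard_eq_one.1 hl
    have h1 : x ∈ G.neighborSet l := hyx
    have h2 : p.getVert j ∈ G.neighborSet l := hprev
    rw [ha] at h1 h2
    exact hne j (h1.trans h2.symm)
  · have hnext := p.adj_getVert_succ hi
    -- An interior path vertex with a neighbour off the path has degree at least three and lies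
    -- nearer to `l` than `c`, against the choice of `c`.
    have h3 : 2 < (G.neighborSet (p.getVert (j + 1))).ncard := by
      rw [Set.two_lt_ncard_iff (Set.toFinite _)]
      refine ⟨x, p.getVert j, p.getVert (j + 2), hyx, hprev, hnext, hne _, hne _, fun e => ?_⟩
      have := hp.getVert_injOn (by simp; omega) (by simp; omega) e
      omega
    have h4 := hc _ h3
    have h5 : G.dist l (p.getVert (j + 1)) ≤ p.length - (j + 1) := by
      rw [SimpleGraph.dist_comm, ← SimpleGraph.Walk.drop_length]
      exact SimpleGraph.dist_le _
    obtain ⟨q, hq, hq'⟩ := hG.connected.exists_path_of_dist c l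
    -- Uniqueness of paths in a tree makes `p` a geodesic, so its length is the distance.
    have h6 : q = p := congrArg Subtype.val
      ((hG.isAcyclic.subsingleton_path c l).elim ⟨q, hq⟩ ⟨p, hp⟩)
    rw [SimpleGraph.dist_comm, ← hq', h6] at h4
    omega

theorem IsTreeShift.exists_path [Finite V] {G' : SimpleGraph V} (h : IsTreeShift G G') (hG : G.IsTree) :
    ∃ (c l : V) (p : G.Walk c l) (F : Set V), p.IsPath ∧ c ≠ l ∧
      (∀ y ∈ p.support, y ≠ c → ∀ x, G.Adj y x → x ∈ p.support) ∧
      (∀ v ∈ F, v ∉ p.support) ∧ (G.induce (insert c F)).Connected ∧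
      (∀ u, u ∉ insert c F → ∀ v ∈ F, ¬ G.Adj u v) ∧ G' = reattach G c l F := by
  obtain ⟨-, c, l, p, F, hl, hc, hn, hp, -, hFp, hFt, hF, -, h⟩ := h
  exact ⟨c, l, p, F, hp, by rintro rfl; omega,
    fun y hy hyc x hyx => mem_support_of_adj_of_nearest hG hp hl hn hy hyc hyx,
    hFp, hFt.connected, hF, h⟩

end


/-! ### The `γ`-polynomials of trees -/

section

theorem exists_gamma_expansion {d : ℕ} {q : ℚ[X]} (hq : q ∈ gammaCone d) :
    ∃ g : ℤ[X], (∀ i, 0 ≤ g.coeff i) ∧ g.natDegree ≤ d / 2 ∧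
      q = (∑ i ∈ Finset.range (d / 2 + 1), C (g.coeff i) * X ^ i * (1 + X) ^ (d - 2 * i)).map
        (Int.castRingHom ℚ) := by
  induction hq using AddSubmonoid.closure_induction with
  | mem q hq =>
    obtain ⟨i, j, hij, rfl⟩ := hq
    refine ⟨X ^ i, fun k => ?_, by rw [natDegree_X_pow]; omega, ?_⟩
    · rw [coeff_X_pow]; split_ifs <;> simp
    · rw [Finset.sum_eq_single i]
      · simp [show d - 2 * i = j by omega]
      · intro k _ hk
        simp [coeff_X_pow, hk]
      · intro hi
        exact absurd (Finset.mem_range.2 (by omega)) hi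
  | zero => exact ⟨0, by simp, by simp, by simp⟩
  | add q q' _ _ ih ih' =>
    obtain ⟨g, hg, hd, rfl⟩ := ih
    obtain ⟨g', hg', hd', rfl⟩ := ih'
    refine ⟨g + g', fun i => ?_, (natDegree_add_le _ _).trans (max_le hd hd'), ?_⟩
    · rw [coeff_add]; exact add_nonneg (hg i) (hg' i)
    · rw [← Polynomial.map_add, ← Finset.sum_add_distrib]
      congr 1
      refine Finset.sum_congr rfl fun i _ => ?_
      rw [coeff_add, C_add]
      ring

variable {V : Type*} [Fintype V] [DecidableEq V] {G G' : SimpleGraph V} {r r' : V}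
  {f f' : ℚ[X][X]}

namespace Rooted

theorem dim_nestohedron_graphical (h : Rooted G Finset.univ r f) :
    dim (nestohedron (graphical G)) = Fintype.card V - 1 :=
  have : Nonempty V := ⟨r⟩
  dim_nestohedron (mem_graphical.2 h.connected)

theorem map_hPolynomial (h : Rooted G Finset.univ r f) :
    (hPolynomial (nestohedron (graphical G))).map (Int.castRingHom ℚ) = bottomCoeff f := by
  have : Nonempty V := ⟨r⟩
  rw [hPolynomial, fPolynomial_nestohedron]
  exact (isRemovalInvariant_facePoly G).eq_bottomCoeff h

theorem isGammaPolynomial_gamma (h : Rooted G Finset.univ r f) :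
    IsGammaPolynomial (nestohedron (graphical G)) (gamma (graphical G)) := by
  have hex : ∃ g, IsGammaPolynomial (nestohedron (graphical G)) g := by
    obtain ⟨g, -, hd, hg⟩ := exists_gamma_expansion
      (bottomCoeff_mem_gammaCone h.mem_meixnerCone)
    refine ⟨g, ?_⟩
    rw [IsGammaPolynomial, h.dim_nestohedron_graphical]
    refine ⟨hd, Polynomial.map_injective _ (Int.castRingHom ℚ).injective_int ?_⟩
    rw [h.map_hPolynomial, hg, Finset.card_univ]
  rw [gamma, gammaPolynomial, dif_pos hex]
  exact hex.choose_spec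

/-- Adding the nonnegative expansion of the difference to the γ-polynomial of `G'` gives a
γ-polynomial of `G`; uniqueness identifies it. -/
theorem coeff_gamma_le (h : Rooted G Finset.univ r f) (h' : Rooted G' Finset.univ r' f')
    (hd : bottomCoeff f - bottomCoeff f' ∈ gammaCone (Fintype.card V - 1)) (i : ℕ) :
    (gamma (graphical G')).coeff i ≤ (gamma (graphical G)).coeff i := by
  obtain ⟨g, hg0, hgd, hg⟩ := exists_gamma_expansion hd
  have h1 := h'.isGammaPolynomial_gamma
  have key : IsGammaPolynomial (nestohedron (graphical G)) (gamma (graphical G') + g) := by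
    rw [IsGammaPolynomial, h'.dim_nestohedron_graphical] at h1
    rw [IsGammaPolynomial, h.dim_nestohedron_graphical]
    refine ⟨(natDegree_add_le _ _).trans (max_le h1.1 hgd),
      Polynomial.map_injective _ (Int.castRingHom ℚ).injective_int ?_⟩
    simp only [coeff_add, C_add, add_mul, Finset.sum_add_distrib]
    rw [Polynomial.map_add, ← h1.2, ← hg, h.map_hPolynomial, h'.map_hPolynomial]
    ring
  rw [h.isGammaPolynomial_gamma.unique key, coeff_add]
  exact le_add_of_nonneg_right (hg0 i)

end Rooted

theorem _root_.SimpleGraph.IsTree.exists_rooted (hG : G.IsTree) (r : V) :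
    ∃ f, Rooted G Finset.univ r f := by
  refine Rooted.exists_of_connected hG.isAcyclic ?_ (Finset.mem_univ r)
  rw [Finset.coe_univ]
  exact (SimpleGraph.induceUnivIso G).connected_iff.2 hG.connected

theorem coeff_gamma_le_of_iso (hG : G.IsTree) (e : G ≃g G') (i : ℕ) :
    (gamma (graphical G')).coeff i ≤ (gamma (graphical G)).coeff i := by
  have := hG.connected.nonempty
  obtain ⟨f, hf⟩ := hG.exists_rooted (Classical.arbitrary V)
  have h' := hf.image e e.injective.injOn fun _ _ _ _ => e.map_adj_iff.symm
  rw [Finset.image_univ_of_surjective e.surjective] at h'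
  refine hf.coeff_gamma_le h' ?_ i
  rw [sub_self]
  exact zero_mem _

theorem IsTreeShift.coeff_gamma_le (h : IsTreeShift G G') (hG : G.IsTree) (i : ℕ) :
    (gamma (graphical G')).coeff i ≤ (gamma (graphical G)).coeff i := by
  obtain ⟨c, l, p, F, hp, hcl, hpadj, hFp, hFc, hF, rfl⟩ := h.exists_path hG
  obtain ⟨d, e, f, g, hf, hg, hde, h1, h2⟩ :=
    exists_rooted_reattach hG hp hcl hpadj hFp hFc hF
  refine h1.coeff_gamma_le h2 ?_ i
  rw [← hde]
  exact bottomCoeff_sub_mem_gammaCone hf hg p.length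

end


/-! ### Tree shifts and leaves -/

section

/-- The set of leaves of a graph. -/
def leaves {V : Type*} (G : SimpleGraph V) : Set V := {v | (G.neighborSet v).ncard = 1}

variable {V : Type*} {G G' : SimpleGraph V} {c l : V} {F : Set V}

theorem mem_leaves {v : V} : v ∈ leaves G ↔ ∃ a, ∀ x, G.Adj v x ↔ x = a := by
  simp only [leaves, Set.mem_ofPred_eq, Set.ncard_eq_one, Set.ext_iff, SimpleGraph.mem_neighborSet,
    Set.mem_singleton_iff]

theorem eq_of_mem_leaves {v x y : V} (hv : v ∈ leaves G) (hx : G.Adj v x) (hy : G.Adj v y) :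
    x = y := by
  obtain ⟨a, ha⟩ := mem_leaves.1 hv
  exact ((ha x).1 hx).trans ((ha y).1 hy).symm

theorem mem_leaves_of_forall_adj (hG : G.Connected) [Nontrivial V] {v a : V}
    (h : ∀ x, G.Adj v x → x = a) : v ∈ leaves G := by
  obtain ⟨x, hx⟩ := hG.preconnected.exists_adj_of_nontrivial v
  exact mem_leaves.2 ⟨a, fun y => ⟨h y, by rintro rfl; exact h x hx ▸ hx⟩⟩

theorem ncard_leaves_of_iso {V' : Type*} {G' : SimpleGraph V'} (e : G ≃g G') :
    (leaves G').ncard = (leaves G).ncard := by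
  rw [← Set.ncard_image_of_injective (leaves G) e.injective]
  congr 1
  ext v
  obtain ⟨v, rfl⟩ := e.surjective v
  rw [e.injective.mem_set_image, leaves, leaves, Set.mem_ofPred_eq, Set.mem_ofPred_eq,
    ← Set.ncard_image_of_injective (G.neighborSet v) e.injective]
  have : G'.neighborSet (e v) = e '' G.neighborSet v := by
    ext w
    obtain ⟨w, rfl⟩ := e.surjective w
    rw [e.injective.mem_set_image, SimpleGraph.mem_neighborSet, SimpleGraph.mem_neighborSet,
      e.map_adj_iff]
  rw [this]

/-- The leaf `l` keeps its path neighbour and gains one in `F`, so it is no longer a leaf. The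
vertex `c` keeps its path neighbour and one outside both `F` and the path, and no other vertex
becomes a leaf. -/
theorem IsTreeShift.ncard_leaves_lt [Finite V] (h : IsTreeShift G G') (hG : G.IsTree) :
    (leaves G').ncard < (leaves G).ncard := by
  obtain ⟨hconn, c, l, p, F, hl, hc, hn, hp, ⟨v₀, hv₀⟩, hFp, hFt, hF, ⟨e, heF, hep⟩, rfl⟩ := h
  have hpadj : ∀ y ∈ p.support, y ≠ c → ∀ x, G.Adj y x → x ∈ p.support :=
    fun y hy hyc x hyx => mem_support_of_adj_of_nearest hG hp hl hn hy hyc hyx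
  have hcl : c ≠ l := by rintro rfl; omega
  have hcF : c ∉ F := fun h => hFp c h p.start_mem_support
  have hlF : l ∉ F := fun h => hFp l h p.end_mem_support
  have hlN : ∀ v ∈ F, ¬ G.Adj l v := hF l (by simp [hlF, hcl.symm])
  have hnil : ¬ p.Nil := SimpleGraph.Walk.not_nil_of_ne hcl
  -- the root `c` keeps two neighbours
  have hc' : c ∉ leaves (reattach G c l F) := by
    intro hc'
    obtain ⟨q⟩ := hconn.preconnected e c
    obtain ⟨d, -, hd1, hd2⟩ := q.exists_boundary_dart {x | x ∉ F ∧ x ∉ p.support} ⟨heF, hep⟩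
      (fun h => h.2 p.start_mem_support)
    have hadj := d.adj
    obtain ⟨hd1F, hd1p⟩ := hd1
    have hdc : d.fst ≠ c := fun h => hd1p (h ▸ p.start_mem_support)
    have hd2F : d.snd ∉ F := fun h => hF d.fst (by simp [hdc, hd1F]) _ h hadj
    have hd2p : d.snd ∈ p.support := by
      by_contra h
      exact hd2 ⟨hd2F, h⟩
    have hd2c : d.snd = c := by
      by_contra h
      exact hd1p (hpadj _ hd2p h _ hadj.symm)
    rw [hd2c] at hadj
    have hsnd : p.snd ∉ F := fun h => hFp _ h (p.getVert_mem_support 1)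
    have := eq_of_mem_leaves hc' ((reattach_adj_of_notMem hcF hd1F).2 hadj.symm)
      ((reattach_adj_of_notMem hcF hsnd).2 (p.adj_snd hnil))
    exact hd1p (this ▸ p.getVert_mem_support 1)
  have hl' : l ∉ leaves (reattach G c l F) := by
    intro hl'
    obtain ⟨q⟩ := hconn.preconnected v₀ c
    obtain ⟨d, -, hd1, hd2⟩ := q.exists_boundary_dart F hv₀ hcF
    have hdc : d.snd = c := by
      by_contra h
      exact hF d.snd (by simp [h, hd2]) _ hd1 d.adj.symm
    have hadj : G.Adj d.fst c := hdc ▸ d.adj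
    have hpen : p.penultimate ∉ F := fun h => hFp _ h (p.getVert_mem_support (p.length - 1))
    have := eq_of_mem_leaves hl'
      ((reattach_adj_of_mem_of_notMem hF hd1 hlF).2 ⟨hadj, rfl⟩).symm
      ((reattach_adj_of_notMem hlF hpen).2 (p.adj_penultimate hnil).symm)
    exact hpen (this ▸ hd1)
  refine Set.ncard_lt_ncard ⟨fun v hv => ?_, fun h => hl' (h hl)⟩ (Set.toFinite _)
  have hvc : v ≠ c := fun h => hc' (h ▸ hv)
  have hvl : v ≠ l := fun h => hl' (h ▸ hv)
  obtain ⟨a, ha⟩ := mem_leaves.1 hv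
  by_cases hvF : v ∈ F
  · have hout : ∀ x, x ∉ F → x ≠ c → ¬ G.Adj v x := fun x hx hxc hvx =>
      hF x (by simp [hx, hxc]) v hvF hvx.symm
    by_cases hvc' : G.Adj v c
    · have hal : l = a := (ha l).1 ((reattach_adj_of_mem_of_notMem hF hvF hlF).2 ⟨hvc', rfl⟩)
      refine mem_leaves.2 ⟨c, fun x => ⟨fun hx => ?_, by rintro rfl; exact hvc'⟩⟩
      by_contra hxc
      by_cases hxF : x ∈ F
      · have := (ha x).1 ((reattach_adj_of_mem hcF hlF hvF hxF).2 hx)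
        exact hlF (hal ▸ this ▸ hxF)
      · exact hout x hxF hxc hx
    · refine mem_leaves.2 ⟨a, fun x => ?_⟩
      rw [← ha]
      by_cases hxF : x ∈ F
      · rw [reattach_adj_of_mem hcF hlF hvF hxF]
      · rw [reattach_adj_of_mem_of_notMem hF hvF hxF]
        refine ⟨fun h => ?_, fun h => absurd h.1 hvc'⟩
        by_cases hxc : x = c
        · exact absurd (hxc ▸ h) hvc'
        · exact absurd h (hout x hxF hxc)
  · refine mem_leaves.2 ⟨a, fun x => ?_⟩
    rw [← ha]
    by_cases hxF : x ∈ F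
    · rw [SimpleGraph.adj_comm, SimpleGraph.adj_comm _ v,
        reattach_adj_of_mem_of_notMem hF hxF hvF]
      exact ⟨fun h => absurd h.symm (hF v (by simp [hvc, hvF]) x hxF), fun h => absurd h.2 hvl⟩
    · rw [reattach_adj_of_notMem hvF hxF]

/-! ### Trees that admit a shift -/

/-- The side of `x` after the edge `cx` has been cut. -/
theorem exists_side (hG : G.IsAcyclic) {c x : V} (hcx : G.Adj c x) :
    ∃ B : Set V, x ∈ B ∧ c ∉ B ∧ ∀ y ∈ B, ∀ z ∉ B, G.Adj y z → y = x ∧ z = c := by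
  refine ⟨{y | (G.deleteEdges {s(c, x)}).Reachable x y}, .refl _, fun h => ?_, ?_⟩
  · exact SimpleGraph.isBridge_iff.1 (SimpleGraph.isAcyclic_iff_forall_adj_isBridge.1 hG hcx) h.symm
  · intro y hy z hz hyz
    have hc : ¬ (G.deleteEdges {s(c, x)}).Reachable x c := fun h =>
      SimpleGraph.isBridge_iff.1 (SimpleGraph.isAcyclic_iff_forall_adj_isBridge.1 hG hcx) h.symm
    by_contra hne
    refine hz (SimpleGraph.Reachable.trans hy (SimpleGraph.Adj.reachable ?_))
    rw [SimpleGraph.deleteEdges_adj]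
    refine ⟨hyz, fun h => ?_⟩
    rcases Sym2.eq_iff.1 (Set.mem_singleton_iff.1 h) with ⟨rfl, rfl⟩ | ⟨rfl, rfl⟩
    · exact hc hy
    · exact hne ⟨rfl, rfl⟩

theorem exists_isTreeShift_from [Finite V] (hG : G.IsTree)
    (h : ∃ v, 2 < (G.neighborSet v).ncard) : ∃ G', G'.IsTree ∧ IsTreeShift G G' := by
  classical
  have := Fintype.ofFinite V
  obtain ⟨l, hl⟩ : ∃ l, (G.neighborSet l).ncard = 1 := by
    obtain ⟨v, hv⟩ := h
    obtain ⟨a, b, -, -, -, -, hab, -, -⟩ := (Set.two_lt_ncard_iff (Set.toFinite _)).1 hv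
    have : Nontrivial V := ⟨a, b, hab⟩
    obtain ⟨l, hl⟩ := hG.exists_vert_degree_one_of_nontrivial
    refine ⟨l, ?_⟩
    rw [← hl, ← SimpleGraph.card_neighborSet_eq_degree, ← Nat.card_coe_set_eq,
      Nat.card_eq_fintype_card]
  obtain ⟨c, hc, hn⟩ := Set.exists_min_image {v | 2 < (G.neighborSet v).ncard} (G.dist l)
    (Set.toFinite _) h
  rw [Set.mem_ofPred_eq] at hc
  obtain ⟨p, hp⟩ := hG.connected.exists_isPath c l
  have hcl : c ≠ l := by rintro rfl; omega
  have hpadj : ∀ y ∈ p.support, y ≠ c → ∀ x, G.Adj y x → x ∈ p.support :=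
    fun y hy hyc x hyx => mem_support_of_adj_of_nearest hG hp hl hn hy hyc hyx
  -- Only one neighbour of `c` lies on the path, so degree at least three leaves two others: the
  -- branch of `x` is moved and that of `e` stays.
  obtain ⟨x, e, hcx, hce, hxe, hxp, hep⟩ : ∃ x e, G.Adj c x ∧ G.Adj c e ∧ x ≠ e ∧
      x ∉ p.support ∧ e ∉ p.support := by
    have hs : ∀ y, G.Adj c y → y ∈ p.support → y = p.snd := fun y hy hyp =>
      hG.isAcyclic.eq_snd_of_adj_start hp hy hyp
    obtain ⟨x, y, z, hx, hy, hz, hxy, hxz, hyz⟩ :=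
      (Set.two_lt_ncard_iff (Set.toFinite _)).1 hc
    by_cases hxp : x ∈ p.support
    · exact ⟨y, z, hy, hz, hyz, fun h => hxy ((hs x hx hxp).trans (hs y hy h).symm),
        fun h => hxz ((hs x hx hxp).trans (hs z hz h).symm)⟩
    · by_cases hyp : y ∈ p.support
      · exact ⟨x, z, hx, hz, hxz, hxp, fun h => hyz ((hs y hy hyp).trans (hs z hz h).symm)⟩
      · exact ⟨x, y, hx, hy, hxy, hxp, hyp⟩
  obtain ⟨F, hxF, hcF, hFadj⟩ := exists_side hG.isAcyclic hcx
  have hFp : ∀ v ∈ F, v ∉ p.support := by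
    intro v hv hvp
    obtain ⟨d, hd, hd1, hd2⟩ := (p.takeUntil v hvp).exists_boundary_dart Fᶜ hcF (by simpa using hv)
    rw [Set.notMem_compl_iff] at hd2
    have := (hFadj _ hd2 _ hd1 d.adj.symm).1
    exact hxp (this ▸ p.support_takeUntil_subset_support hvp
      (SimpleGraph.Walk.dart_snd_mem_support_of_mem_darts _ hd))
  have hF : ∀ u, u ∉ insert c F → ∀ v ∈ F, ¬ G.Adj u v := by
    intro u hu v hv huv
    rw [Set.mem_insert_iff, not_or] at hu
    exact hu.1 (hFadj v hv u hu.2 huv.symm).2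
  have hFc : (G.induce (insert c F)).Connected := by
    refine connected_induce_of_forall_adj_mem hG.connected (Set.mem_insert c F) ?_
    intro y hy hyc z hyz
    by_cases hz : z ∈ F
    · exact .inr hz
    · exact .inl (hFadj y (hy.resolve_left hyc) z hz hyz).2
  -- The rooted decomposition of the reattached graph is used here only to show that it is a tree.
  obtain ⟨_, _, _, _, -, -, -, -, h⟩ := exists_rooted_reattach hG hp hcl hpadj hFp hFc hF
  exact ⟨_, h.isTree, hG.connected, c, l, p, F, hl, hc, hn, hp, ⟨x, hxF⟩, hFp,
    ⟨hFc, hG.isAcyclic.induce _⟩, hF,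
    ⟨e, fun h => hxe (hFadj e h c hcF hce.symm).1.symm, hep⟩, rfl⟩

/-- A shift is undone across the edge `cl`: all branches at `l` away from `c` are slid onto `c`.
Then `l` is a leaf next to `c`, and shifting along the one-edge path restores the tree. -/
theorem exists_isTreeShift_to [Finite V] (hG : G.IsTree) (hcl : G.Adj c l) (hc : c ∉ leaves G)
    (hl : l ∉ leaves G) : ∃ G', G'.IsTree ∧ IsTreeShift G' G := by
  classical
  have := Fintype.ofFinite V
  have : Nontrivial V := ⟨c, l, hcl.ne⟩
  obtain ⟨B, hlB, hcB, hB⟩ := exists_side hG.isAcyclic hcl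
  obtain ⟨a, hla, hac⟩ : ∃ a, G.Adj l a ∧ a ≠ c := by
    by_contra! h
    exact hl (mem_leaves_of_forall_adj hG.connected h)
  obtain ⟨e, hce, hel⟩ : ∃ e, G.Adj c e ∧ e ≠ l := by
    by_contra! h
    exact hc (mem_leaves_of_forall_adj hG.connected h)
  set F : Set V := B \ {l} with hFdef
  have mF : ∀ x, x ∈ F ↔ x ∈ B ∧ x ≠ l := fun x => by simp [hFdef]
  have hlF : l ∉ F := by simp [mF]
  have hcF : c ∉ F := fun h => hcB ((mF c).1 h).1
  have hF : ∀ u, u ∉ insert l F → ∀ v ∈ F, ¬ G.Adj u v := by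
    intro u hu v hv huv
    rw [Set.mem_insert_iff, not_or, mF, not_and, not_not] at hu
    exact ((mF v).1 hv).2 (hB v ((mF v).1 hv).1 u (fun h => hu.1 (hu.2 h)) huv.symm).1
  have haF : a ∈ F := by
    refine (mF a).2 ⟨?_, hla.ne'⟩
    by_contra haB
    exact hac (hB l hlB a haB hla).2
  have heB : e ∉ B := fun heB => hel (hB e heB c hcB hce.symm).1
  have heF : e ∉ F := fun h => heB ((mF e).1 h).1
  have hlN : ∀ x, x ∉ F → G.Adj l x → x = c := by
    intro x hx hlx
    refine (hB l hlB x (fun h => hx ((mF x).2 ⟨h, hlx.ne'⟩)) hlx).2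
  set T := reattach G l c F with hT
  -- adjacency in the new tree
  have hT1 : ∀ {x y}, x ∉ F → y ∉ F → (T.Adj x y ↔ G.Adj x y) := reattach_adj_of_notMem
  have hT2 : ∀ {x y}, x ∈ F → y ∈ F → (T.Adj x y ↔ G.Adj x y) :=
    reattach_adj_of_mem hlF hcF
  have hT3 : ∀ {x y}, x ∈ F → y ∉ F → (T.Adj x y ↔ G.Adj x l ∧ y = c) :=
    reattach_adj_of_mem_of_notMem hF
  have hTF : ∀ u, u ∉ insert c F → ∀ v ∈ F, ¬ T.Adj u v := by
    intro u hu v hv huv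
    rw [Set.mem_insert_iff, not_or] at hu
    exact hu.1 ((hT3 hv hu.2).1 huv.symm).2
  -- The tree is reassembled from the side of `c`, the slid branches now rooted at `c`, and the leaf
  -- `l`.
  have hTtree : T.IsTree := by
    set A : Finset V := Bᶜ.toFinset with hA
    set D : Finset V := B.toFinset with hD
    obtain ⟨g, hg⟩ := Rooted.exists_of_connected (U := A) (r := c) hG.isAcyclic
      (connected_induce_of_forall_adj_mem hG.connected (r := c) (by simpa [hA] using hcB) (by
        intro x hx hxc y hxy
        simp only [hA, Set.coe_toFinset, Set.mem_compl_iff] at hx ⊢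
        exact fun hy => hxc (hB y hy x hx hxy.symm).2)) (by simpa [hA] using hcB)
    obtain ⟨f, hf⟩ := Rooted.exists_of_connected (U := D) (r := l) hG.isAcyclic
      (connected_induce_of_forall_adj_mem hG.connected (r := l) (by simpa [hD] using hlB) (by
        intro x hx hxl y hxy
        simp only [hD, Set.coe_toFinset] at hx ⊢
        by_contra hy
        exact hxl (hB x hx y hy hxy).1)) (by simpa [hD] using hlB)
    have hAF : ∀ x ∈ A, x ∉ F := fun x hx h =>
      (by simpa [hA] using hx : x ∉ B) ((mF x).1 h).1
    have hA' : Rooted T A c g := by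
      have := hg.image (G' := T) id (Set.injOn_id _) fun x hx y hy =>
        (hT1 (hAF x hx) (hAF y hy)).symm
      rwa [Finset.image_id] at this
    set σ : V → V := fun x => if x = l then c else x with hσ
    have σF : ∀ x ∈ F, σ x = x := fun x hx => if_neg fun h : x = l => hlF (h ▸ hx)
    have σl : σ l = c := if_pos rfl
    have mD : ∀ x, x ∈ D → x = l ∨ x ∈ F := by
      intro x hx
      rw [hD, Set.mem_toFinset] at hx
      exact or_iff_not_imp_left.2 fun h => (mF x).2 ⟨hx, h⟩
    have hD' := hf.image (G' := T) σ (by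
        intro x hx y hy hxy
        rcases mD x hx with rfl | hx <;> rcases mD y hy with rfl | hy
        · rfl
        · rw [σl, σF y hy] at hxy; exact absurd (hxy ▸ hy) hcF
        · rw [σl, σF x hx] at hxy; exact absurd (hxy ▸ hx) hcF
        · rwa [σF x hx, σF y hy] at hxy) (by
        intro x hx y hy
        rcases mD x hx with rfl | hx <;> rcases mD y hy with rfl | hy
        · simp
        · rw [σl, σF y hy, SimpleGraph.adj_comm T, hT3 hy hcF, G.adj_comm]; simp
        · rw [σl, σF x hx, hT3 hx hcF]; simp
        · rw [σF x hx, σF y hy, hT2 hx hy])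
    rw [σl] at hD'
    have mσ : ∀ x, x ∈ D.image σ → x = c ∨ x ∈ F := by
      intro x hx
      obtain ⟨y, hy, rfl⟩ := Finset.mem_image.1 hx
      rcases mD y hy with rfl | hy
      · exact .inl σl
      · exact .inr (by rwa [σF y hy])
    have hAD := hA'.wedge hD' (fun x hx hx' => (mσ x hx').resolve_right (hAF x hx)) (by
      intro x hx y hy hxy
      rcases mσ y hy with h | h
      · exact .inr h
      · exact .inl ((hT3 h (hAF x hx)).1 hxy.symm).2)
    have hlA : l ∉ A := by simpa [hA] using hlB
    have hall := hAD.graft (Rooted.single l) (by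
        rw [Finset.disjoint_singleton_right, Finset.mem_union, not_or]
        refine ⟨hlA, fun h => ?_⟩
        rcases mσ l h with h | h
        · exact hcl.ne h.symm
        · exact hlF h) ((hT1 hcF hlF).2 hcl) (by
        intro x hx y hy hxy
        obtain rfl := Finset.mem_singleton.1 hy
        refine ⟨?_, rfl⟩
        have : x = c ∨ x ∈ F ∨ x ∈ A := by
          rcases Finset.mem_union.1 hx with h | h
          · exact .inr (.inr h)
          · exact (mσ x h).imp_right .inl
        rcases this with h | h | h
        · exact h
        · exact absurd ((hT3 h hlF).1 hxy).2 hcl.ne'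
        · exact hlN x (hAF x h) ((hT1 (hAF x h) hlF).1 hxy).symm)
    have huniv : A ∪ D.image σ ∪ {l} = Finset.univ := by
      ext x
      simp only [Finset.mem_union, Finset.mem_singleton, Finset.mem_univ, iff_true]
      by_cases hxl : x = l
      · exact .inr hxl
      · refine .inl ?_
        by_cases hxB : x ∈ B
        · exact .inr (Finset.mem_image.2 ⟨x, by simpa [hD] using hxB, if_neg hxl⟩)
        · exact .inl (by simpa [hA] using hxB)
    rw [huniv] at hall
    exact hall.isTree
  have hadj : T.Adj c l := (hT1 hcF hlF).2 hcl
  have hsupp : hadj.toWalk.support = [c, l] := rfl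
  have hlT : l ∈ leaves T := by
    refine mem_leaves.2 ⟨c, fun x => ⟨fun hx => ?_, by rintro rfl; exact hadj.symm⟩⟩
    by_cases hxF : x ∈ F
    · exact absurd ((hT3 hxF hlF).1 hx.symm).2 hcl.ne'
    · exact hlN x hxF ((hT1 hlF hxF).1 hx)
  refine ⟨T, hTtree, hTtree.connected, c, l, hadj.toWalk, F, hlT, ?_, ?_, ?_, ⟨a, haF⟩, ?_, ?_, hTF,
    ⟨e, heF, ?_⟩, ?_⟩
  · rw [Set.two_lt_ncard_iff (Set.toFinite _)]
    exact ⟨l, a, e, hadj, ((hT3 haF hcF).2 ⟨hla.symm, rfl⟩).symm, (hT1 hcF heF).2 hce,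
      fun h => hlF (h ▸ haF), hel.symm, fun h => heF (h ▸ haF)⟩
  · intro v hv
    -- The vertex `c` is at distance one from `l`, so only `l` itself could be nearer, and `l` is a
    -- leaf.
    rw [SimpleGraph.dist_eq_one_iff_adj.2 hadj.symm]
    refine hTtree.connected.pos_dist_of_ne ?_
    rintro rfl
    have : (T.neighborSet l).ncard = 1 := hlT
    omega
  · simp [SimpleGraph.Walk.isPath_def, hsupp, hcl.ne]
  · intro v hv
    rw [hsupp]
    simp only [List.mem_cons, List.not_mem_nil, or_false, not_or]
    exact ⟨fun h => hcF (h ▸ hv), fun h => hlF (h ▸ hv)⟩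
  · refine ⟨connected_induce_of_forall_adj_mem hTtree.connected (Set.mem_insert c F) ?_,
      hTtree.isAcyclic.induce _⟩
    intro y hy hyc z hyz
    by_cases hz : z ∈ F
    · exact .inr hz
    · exact .inl ((hT3 (hy.resolve_left hyc) hz).1 hyz).2
  · rw [hsupp]
    simp only [List.mem_cons, List.not_mem_nil, or_false, not_or]
    exact ⟨hce.ne', hel⟩
  · have mixed : ∀ x y, x ∈ F → y ∉ F → (G.Adj x y ↔ (reattach T c l F).Adj x y) := by
      intro x y hx hy
      rw [reattach_adj_of_mem_of_notMem hTF hx hy, hT3 hx hcF]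
      constructor
      · intro h
        have hyl : y = l := by
          by_contra hyl
          exact hF y (by simp [hyl, hy]) x hx h.symm
        exact ⟨⟨hyl ▸ h, rfl⟩, hyl⟩
      · rintro ⟨⟨h, -⟩, rfl⟩
        exact h
    ext x y
    by_cases hx : x ∈ F <;> by_cases hy : y ∈ F
    · rw [reattach_adj_of_mem hcF hlF hx hy, hT2 hx hy]
    · exact mixed x y hx hy
    · rw [SimpleGraph.adj_comm, SimpleGraph.adj_comm _ x]
      exact mixed y x hy hx
    · rw [reattach_adj_of_notMem hx hy, hT1 hx hy]

end


/-! ### Paths and stars -/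

section

variable {V : Type*} {G : SimpleGraph V}

theorem exists_mem_leaves [Finite V] [Nontrivial V] (hG : G.IsTree) : ∃ l, l ∈ leaves G := by
  classical
  have := Fintype.ofFinite V
  obtain ⟨l, hl⟩ := hG.exists_vert_degree_one_of_nontrivial
  refine ⟨l, ?_⟩
  rw [leaves, Set.mem_ofPred_eq, ← hl, ← SimpleGraph.card_neighborSet_eq_degree,
    ← Nat.card_coe_set_eq, Nat.card_eq_fintype_card]

theorem exists_adj_dist_eq (hG : G.Connected) {l v : V} {k : ℕ} (h : G.dist l v = k + 1) :
    ∃ w, G.Adj v w ∧ G.dist l w = k := by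
  obtain ⟨p, hp⟩ := hG.exists_walk_length_eq_dist v l
  rw [SimpleGraph.dist_comm, h] at hp
  cases p with
  | nil => simp at hp
  | @cons _ w _ hvw q =>
    refine ⟨w, hvw, ?_⟩
    have h1 : q.length = k := by simpa using hp
    have h2 := SimpleGraph.dist_le q
    have h3 := hvw.symm.diff_dist_adj (u := l)
    rw [SimpleGraph.dist_comm] at h2
    omega

/-- Two vertices at the same distance share a predecessor by induction. That predecessor also has a
neighbour nearer to `l`, or is the leaf `l` itself, so it has no room for both. -/
theorem dist_injective_of_ncard_le_two [Finite V] (hG : G.IsTree) {l : V} (hl : l ∈ leaves G)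
    (h : ∀ v, (G.neighborSet v).ncard ≤ 2) : Function.Injective (G.dist l) := by
  intro v w hvw
  generalize hk : G.dist l v = k at hvw
  induction k using Nat.strong_induction_on generalizing v w with
  | _ k ih =>
    match k, ih with
    | 0, _ =>
      rw [← (hG.connected.dist_eq_zero_iff).1 hk, ← (hG.connected.dist_eq_zero_iff).1 hvw.symm]
    | k + 1, ih =>
      obtain ⟨v', hv, hv'⟩ := exists_adj_dist_eq hG.connected hk
      obtain ⟨w', hw, hw'⟩ := exists_adj_dist_eq hG.connected hvw.symm
      obtain rfl : v' = w' := ih k (Nat.lt_succ_self k) hv' hw'.symm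
      match k, hv', ih with
      | 0, hv', _ =>
        obtain rfl := (hG.connected.dist_eq_zero_iff).1 hv'
        exact eq_of_mem_leaves hl hv.symm hw.symm
      | k + 1, hv', _ =>
        obtain ⟨u, hu, hu'⟩ := exists_adj_dist_eq hG.connected hv'
        by_contra hne
        have : 2 < (G.neighborSet v').ncard := by
          rw [Set.two_lt_ncard_iff (Set.toFinite _)]
          refine ⟨v, w, u, hv.symm, hw.symm, hu, hne, ?_, ?_⟩ <;> rintro rfl <;> omega
        exact absurd (h v') (by omega)

theorem nonempty_iso_pathGraph {n : ℕ} {G : SimpleGraph (Fin n)} (hG : G.IsTree)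
    (h : ∀ v, (G.neighborSet v).ncard ≤ 2) : Nonempty (G ≃g SimpleGraph.pathGraph n) := by
  rcases subsingleton_or_nontrivial (Fin n) with hn | hn
  · rw [Subsingleton.elim G (SimpleGraph.pathGraph n)]
    exact ⟨.refl⟩
  obtain ⟨l, hl⟩ := exists_mem_leaves hG
  have hinj := dist_injective_of_ncard_le_two hG hl h
  have hlt : ∀ v, G.dist l v < n := by
    intro v
    obtain ⟨p, hp, hp'⟩ := hG.connected.exists_path_of_dist l v
    have := hp.length_lt
    rwa [hp', Fintype.card_fin] at this
  let σ : Fin n → Fin n := fun v => ⟨G.dist l v, hlt v⟩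
  have hσ : Function.Injective σ := fun v w hvw => hinj (Fin.mk.inj_iff.1 hvw)
  refine ⟨⟨Equiv.ofBijective σ (Finite.injective_iff_bijective.1 hσ), ?_⟩⟩
  intro v w
  have key : ∀ v w, G.dist l v + 1 = G.dist l w → G.Adj v w := by
    intro v w hvw
    obtain ⟨u, hu, hu'⟩ := exists_adj_dist_eq hG.connected hvw.symm
    rw [← hinj hu']
    exact hu.symm
  rw [SimpleGraph.pathGraph_adj]
  change G.dist l v + 1 = G.dist l w ∨ G.dist l w + 1 = G.dist l v ↔ _
  constructor
  · rintro (h | h)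
    · exact key v w h
    · exact (key w v h).symm
  · intro hvw
    have := hG.dist_eq_dist_add_one_of_adj l hvw
    omega

theorem exists_eq_starGraph [Finite V] (hG : G.IsTree)
    (h : ∀ c l, G.Adj c l → c ∈ leaves G ∨ l ∈ leaves G) : ∃ c, G = SimpleGraph.starGraph c := by
  rcases subsingleton_or_nontrivial V with hn | hn
  · have := hG.connected.nonempty
    exact ⟨Classical.arbitrary V, Subsingleton.elim _ _⟩
  obtain ⟨x, hx⟩ := exists_mem_leaves hG
  obtain ⟨c, hxc⟩ := hG.connected.preconnected.exists_adj_of_nontrivial x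
  -- If `c` itself is a leaf, its only neighbour is the leaf `x`. So every neighbour of `c` is a
  -- leaf, and no vertex lies beyond them.
  have hleaf : ∀ y, G.Adj c y → y ∈ leaves G := by
    intro y hcy
    rcases h c y hcy with hc | hy
    · rwa [eq_of_mem_leaves hc hcy hxc.symm]
    · exact hy
  have hall : ∀ v, v ≠ c → G.Adj c v := by
    intro v hv
    by_contra hcv
    obtain ⟨p⟩ := hG.connected.preconnected c v
    obtain ⟨d, -, hd1, hd2⟩ := p.exists_boundary_dart {v | v = c ∨ G.Adj c v} (.inl rfl)
      (by rintro (h | h) <;> contradiction)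
    rcases hd1 with hd1 | hd1
    · exact hd2 (.inr (hd1 ▸ d.adj))
    · exact hd2 (.inl (eq_of_mem_leaves (hleaf _ hd1) d.adj hd1.symm))
  refine ⟨c, ?_⟩
  ext v w
  rw [SimpleGraph.starGraph_adj]
  constructor
  · refine fun hvw => ⟨hvw.ne, or_iff_not_imp_left.2 fun hv => ?_⟩
    exact eq_of_mem_leaves (hleaf v (hall v hv)) hvw (hall v hv).symm
  · rintro ⟨hne, rfl | rfl⟩
    · exact hall w hne.symm
    · exact (hall v hne).symm

theorem nonempty_starGraph_iso (c d : V) :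
    Nonempty (SimpleGraph.starGraph c ≃g SimpleGraph.starGraph d) := by
  classical
  refine ⟨⟨Equiv.swap c d, ?_⟩⟩
  intro v w
  rw [SimpleGraph.starGraph_adj, SimpleGraph.starGraph_adj, (Equiv.swap c d).injective.ne_iff,
    Equiv.swap_apply_eq_iff, Equiv.swap_apply_eq_iff, Equiv.swap_apply_right]

end

/-! ### The order on unlabelled trees -/

section

variable {n : ℕ}

/-- The number of leaves of an unlabelled tree. -/
noncomputable def leafCount : Tree n → ℕ :=
  Quotient.lift (fun T : LabelledTree n => (leaves T.1).ncard)
    fun _ _ ⟨e⟩ => (ncard_leaves_of_iso e).symm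

theorem leafCount_lt_of_shift {T T' : Tree n} (h : shift T T') : leafCount T' < leafCount T := by
  obtain ⟨G, G', rfl, rfl, h⟩ := h
  exact h.ncard_leaves_lt G.2

theorem leafCount_le (T : Tree n) : leafCount T ≤ n := by
  induction T using Quotient.inductionOn with
  | _ G =>
    refine (Set.ncard_le_card (leaves G.1)).trans ?_
    rw [Nat.card_fin]

theorem eq_or_leafCount_lt_of_treeLE {T T' : Tree n} (h : treeLE T' T) :
    T' = T ∨ leafCount T' < leafCount T := by
  induction h with
  | refl => exact .inl rfl
  | tail _ h ih =>
    have := leafCount_lt_of_shift h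
    rcases ih with rfl | ih
    · exact .inr this
    · exact .inr (this.trans ih)

theorem treeLE_antisymm {T T' : Tree n} (h : treeLE T T') (h' : treeLE T' T) : T = T' := by
  rcases eq_or_leafCount_lt_of_treeLE h with h | h
  · exact h
  rcases eq_or_leafCount_lt_of_treeLE h' with h' | h'
  · exact h'.symm
  · omega

theorem pathTree_treeLE [NeZero n] (T : Tree n) : treeLE (pathTree n) T := by
  generalize hk : leafCount T = k
  induction k using Nat.strong_induction_on generalizing T with
  | _ k ih =>
    obtain ⟨G, rfl⟩ := Quotient.exists_rep T
    by_cases h : ∃ v, 2 < (G.1.neighborSet v).ncard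
    · obtain ⟨G', hG', hs⟩ := exists_isTreeShift_from G.2 h
      have hs' : shift (⟦G⟧ : Tree n) ⟦⟨G', hG'⟩⟧ := ⟨G, ⟨G', hG'⟩, rfl, rfl, hs⟩
      exact .head hs' (ih _ (hk ▸ leafCount_lt_of_shift hs') _ rfl)
    · push Not at h
      rw [show (⟦G⟧ : Tree n) = pathTree n from Quotient.sound (nonempty_iso_pathGraph G.2 h)]
      exact .refl

theorem treeLE_starTree [NeZero n] (T : Tree n) : treeLE T (starTree n) := by
  -- Induction is on the number of non-leaves, since the trees above `T` have more leaves.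
  generalize hk : n - leafCount T = k
  induction k using Nat.strong_induction_on generalizing T with
  | _ k ih =>
    obtain ⟨G, rfl⟩ := Quotient.exists_rep T
    by_cases h : ∀ c l, G.1.Adj c l → c ∈ leaves G.1 ∨ l ∈ leaves G.1
    · obtain ⟨c, hc⟩ := exists_eq_starGraph G.2 h
      obtain ⟨e⟩ := nonempty_starGraph_iso c (0 : Fin n)
      rw [show (⟦G⟧ : Tree n) = starTree n from Quotient.sound ⟨hc ▸ e⟩]
      exact .refl
    · push Not at h
      obtain ⟨c, l, hcl, hc, hl⟩ := h
      obtain ⟨G', hG', hs⟩ := exists_isTreeShift_to G.2 hcl hc hl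
      have hs' : shift (⟦⟨G', hG'⟩⟧ : Tree n) ⟦G⟧ := ⟨⟨G', hG'⟩, G, rfl, rfl, hs⟩
      have h1 := leafCount_lt_of_shift hs'
      have h2 := leafCount_le (⟦⟨G', hG'⟩⟧ : Tree n)
      exact .tail (ih _ (by omega) _ rfl) hs'

theorem coeff_gamma_le_of_treeLE {T T' : LabelledTree n} (h : treeLE ⟦T'⟧ ⟦T⟧) (i : ℕ) :
    (gamma (graphical T'.1)).coeff i ≤ (gamma (graphical T.1)).coeff i := by
  generalize hS : (⟦T'⟧ : Tree n) = S at h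
  induction h generalizing T' with
  | refl =>
    obtain ⟨e⟩ := Quotient.exact hS
    exact coeff_gamma_le_of_iso T.2 e.symm i
  | tail _ hs ih =>
    obtain ⟨G, G', hG, rfl, hs⟩ := hs
    obtain ⟨e⟩ := Quotient.exact hS
    exact (coeff_gamma_le_of_iso G'.2 e.symm i).trans ((hs.coeff_gamma_le G.2 i).trans (ih hG))

end

end GraphAssoc

theorem theorem4p2 (n : ℕ) [NeZero n] :
    -- the relation defined by tree shifts is a partial order
    IsPartialOrder (GraphAssoc.Tree n) GraphAssoc.treeLE ∧
    -- `Path_n` is the minimum, and the only minimal element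
    (∀ T : GraphAssoc.Tree n, GraphAssoc.treeLE (GraphAssoc.pathTree n) T) ∧
    (∀ M : GraphAssoc.Tree n,
      (∀ T : GraphAssoc.Tree n, GraphAssoc.treeLE T M → T = M) ↔ M = GraphAssoc.pathTree n) ∧
    -- `K_{1,n-1}` is the maximum, and the only maximal element
    (∀ T : GraphAssoc.Tree n, GraphAssoc.treeLE T (GraphAssoc.starTree n)) ∧
    (∀ M : GraphAssoc.Tree n,
      (∀ T : GraphAssoc.Tree n, GraphAssoc.treeLE M T → T = M) ↔ M = GraphAssoc.starTree n) ∧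
    -- the `γ`-polynomial of every graph-associahedron of a tree is well defined
    (∀ T : GraphAssoc.LabelledTree n,
      GraphAssoc.IsGammaPolynomial (GraphAssoc.nestohedron (GraphAssoc.graphical T.1))
        (GraphAssoc.gamma (GraphAssoc.graphical T.1))) ∧
    -- `T' ≤ T` implies `γ(B(T')) ≤ γ(B(T))`, coefficient by coefficient
    (∀ T' T : GraphAssoc.LabelledTree n, GraphAssoc.treeLE ⟦T'⟧ ⟦T⟧ → ∀ i : ℕ,
      (GraphAssoc.gamma (GraphAssoc.graphical T'.1)).coeff i ≤
        (GraphAssoc.gamma (GraphAssoc.graphical T.1)).coeff i) := by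
  refine ⟨{ refl := fun _ => .refl, trans := fun _ _ _ h h' => h'.trans h,
            antisymm := fun _ _ => GraphAssoc.treeLE_antisymm },
    GraphAssoc.pathTree_treeLE, fun M => ⟨fun h => (h _ (GraphAssoc.pathTree_treeLE M)).symm, ?_⟩,
    GraphAssoc.treeLE_starTree, fun M => ⟨fun h => (h _ (GraphAssoc.treeLE_starTree M)).symm, ?_⟩,
    fun T => ?_, fun _ _ => GraphAssoc.coeff_gamma_le_of_treeLE⟩
  · rintro rfl T hT
    exact GraphAssoc.treeLE_antisymm hT (GraphAssoc.pathTree_treeLE T)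
  · rintro rfl T hT
    exact GraphAssoc.treeLE_antisymm (GraphAssoc.treeLE_starTree T) hT
  · obtain ⟨f, hf⟩ := T.2.exists_rooted 0
    exact hf.isGammaPolynomial_gamma
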